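/- **Setting.** Let $k$ be a commutative ring with $\mathbb Q\subseteq k$, let $(A,L)$ be a Lie–Rinehart algebra over $k$ (with anchor $L\to\mathrm{Der}_k(A)$, $X\mapsto(a\mapsto X(a))$) such that $L$ is flat, but not necessarily finitely generated, over $A$, let $VL$ be its universal enveloping algebra (an $A$-module by left multiplication) and $M$ a left $VL$-module. Call the elements of $\bigwedge_A L$ multivector fields and those of $\mathrm{Hom}_A(\bigwedge^n_AL,M)$ forms of degree $n$. A hat denotes omission. **(1) The operators.** The following formulas give well-defined and uniquely determined operators. * The differential $d_{dR}:\mathrm{Hom}_A(\bigwedge^n_A L,M)\to\mathrm{Hom}_A(\bigwedge^{n+1}_AL,M)$, $$d_{dR}\omega(X^1,\dots,X^{n+1})=\sum_{i}(-1)^{i-1}X^i\,\omega(X^1,\dots,\hat X^i,\dots,X^{n+1})+\sum_{i<j}(-1)^{i+j}\omega([X^i,X^j],X^1,\dots,\hat X^i,\dots,\hat X^j,\dots,X^{n+1}).$$ * The Schouten–Nijenhuis bracket, $k$-bilinear on $\bigwedge_AL$: for $a,b\in A$, $[a,b]=0$, $[Y^1\wedge\dots\wedge Y^p,a]=\sum_i(-1)^{p-i}Y^i(a)\,Y^1\wedge\dots\hat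 Y^i\dots\wedge Y^p$, $[a,Y^1\wedge\dots\wedge Y^p]=\sum_i(-1)^{i}Y^i(a)\,Y^1\wedge\dots\hat Y^i\dots\wedge Y^p$, and $$[Y^1\wedge\dots\wedge Y^p,Z^1\wedge\dots\wedge Z^q]=\sum_{i,j}(-1)^{i+j}[Y^i,Z^j]\wedge Y^1\wedge\dots\hat Y^i\dots\wedge Y^p\wedge Z^1\wedge\dots\hat Z^j\dots\wedge Z^q .$$ * The contraction $(\iota_Y\omega)(X^1,\dots,X^{n-p})=\omega(Y^1,\dots,Y^p,X^1,\dots,X^{n-p})$ and the Lie derivative along $Y=Y^1\wedge\dots\wedge Y^p$, $p\ge1$, of a form $\omega$ of degree $n$, $$\begin{aligned}(-1)^{p-1}(\mathcal L_Y\omega)(X^1,\dots,X^{n-p+1})={}&\sum_{i}(-1)^{i-1}Y^i\,\omega(Y^1,\dots,\hat Y^i,\dots,Y^p,X^1,\dots,X^{n-p+1})\\&+\sum_{j}\sum_{i}(-1)^{j}\omega(Y^1,\dots,\hat Y^j,\dots,Y^p,X^1,\dots,[Y^j,X^i],\dots,X^{n-p+1})\\&+\sum_{i<j}(-1)^{i+j}\omega([Y^i,Y^j],Y^1,\dots,\hat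 Y^i,\dots,\hat Y^j,\dots,Y^p,X^1,\dots,X^{n-p+1}),\end{aligned}$$ and $(\mathcal L_a\omega)(X^1,\dots,X^{n+1})=\sum_i(-1)^{i-1}X^i(a)\,\omega(X^1,\dots,\hat X^i,\dots,X^{n+1})$ for $a\in A$. These are the classical (Rinehart) operations; $\iota_Y$ and $\mathcal L_Y$ vanish on forms of degree $<p$, respectively $<p-1$. **(2) The calculus.** $(\bigwedge_AL,\wedge,[\cdot,\cdot])$ is a Gerstenhaber algebra. With the opposite Gerstenhaber structure $Y\smallsmile Z:=Z\wedge Y$ and $\{Y,Z\}:=-[Z,Y]=(-1)^{(p-1)(q-1)}[Y,Z]$ for $Y\in\bigwedge^p_A L$, $Z\in\bigwedge^q_A L$, the operators $\iota$, $\mathcal L$ and $d_{dR}$ form a noncommutative calculus (that is, a homotopy calculus with zero homotopy operators) on the pair consisting of the Gerstenhaber algebra $(\bigwedge_AL,0,\smallsmile,\{\cdot,\cdot\})$ and the mixed complex $(\mathrm{Hom}_A(\bigwedge_AL,M),0,d_{dR})$: one has $d_{dR}^2=0$ and, for graded commutators of operators, where $\iota_Y,\mathcal L_Y,d_{dR}$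 have degrees $p,\,p-1,\,1$, $$\iota_{Y\smallsmile Z}=\iota_Y\iota_Z,\qquad \mathcal L_{\{Y,Z\}}=[\mathcal L_Y,\mathcal L_Z],\qquad[\iota_Y,\mathcal L_Z]=\iota_{\{Y,Z\}},\qquad\mathcal L_Y=[d_{dR},\iota_Y].$$ **(3) Comparison with the operators on $VL$.** Write $(v^1|\dots|v^n)$ for tensors in $VL^{\otimes_An}$ (all $A$-module structures being given by left multiplication), let $u\triangleleft t$ be the diagonal left $VL$-action on $VL^{\otimes_An}$ (with $\Delta X=X|1+1|X$ for $X\in L$; on $VL^{\otimes_A0}=A$ the canonical action), and let $u\triangleright f$ be the left $VL$-action on $\mathrm{Hom}_A(VL^{\otimes_An},M)$ determined by $a\triangleright f=af$ for $a\in A$ and $(X\triangleright f)(t)=Xf(t)-f(X\triangleleft t)$ for $X\in L$. For $w=(u^1|\dots|u^p)$ and $f\in\mathrm{Hom}_A(VL^{\otimes_An},M)$ put $(\iota_wf)(v^1|\dots|v^{n-p})=f(u^1|\dots|u^p|v^1|\dots|v^{n-p})$ and $$\begin{aligned}(\mathcal L_wf)(v^1|\dots|v^{n-p+1})={}&\sum_{i=1}^{n-p+1}(-1)^{(p-1)(i-1)}f(v^1|\dots|v^i\triangleleft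 w|\dots|v^{n-p+1})\\&+\sum_{i=1}^{p}(-1)^{n(i-1)+p-1}(u^i\triangleright f)(u^{i+1}|\dots|u^p|v^1|\dots|v^{n-p+1}|u^1|\dots|u^{i-1}).\end{aligned}$$ Let $\mathrm{Alt}:\bigwedge^n_AL\to VL^{\otimes_An}$, $X^1\wedge\dots\wedge X^n\mapsto\frac1{n!}\sum_{\sigma}(-1)^\sigma(X^{\sigma(1)}|\dots|X^{\sigma(n)})$. Let $\mathrm{pr}:VL\to L$ be any projection, that is, any left $A$-linear map with $\mathrm{pr}(X)=X$ for all $X\in L$, and $\mathcal P:=\mathrm{pr}\wedge\dots\wedge\mathrm{pr}:VL^{\otimes_An}\to\bigwedge^n_AL$. Then $\mathcal P\circ\mathrm{Alt}=\mathrm{id}$, and for every multivector field $Y\in\bigwedge_A^pL$ the operators $$\mathrm{Hom}_A(\mathrm{Alt},M)\circ\iota_{\mathrm{Alt}(Y)}\circ\mathrm{Hom}_A(\mathcal P,M)\quad\text{and}\quad\mathrm{Hom}_A(\mathrm{Alt},M)\circ\mathcal L_{\mathrm{Alt}(Y)}\circ\mathrm{Hom}_A(\mathcal P,M)$$ coincide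 with the $\iota_Y$ and $\mathcal L_Y$ of (1); in particular they do not depend on $\mathrm{pr}$. -/

import Mathlib

open scoped TensorProduct

noncomputable section

set_option linter.unusedSectionVars false

namespace LieRinehart

/-! ### The universal enveloping algebra of a Lie-Rinehart algebra -/

section Enveloping

variable (k A L : Type*) [CommRing k] [CommRing A] [Algebra k A] [LieRing L] [LieAlgebra k L]
  [Module A L] [LieRingModule L A]

/-- The defining relations of the enveloping algebra, on the free `k`-algebra on `A ⊔ L`:
`A` is a subalgebra (image), `L → VL` is additive, `a · X = aX`, `XY - YX = [X, Y]`, and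
`X · a - a · X = X(a)`. -/
inductive VLRel : FreeAlgebra k (A ⊕ L) → FreeAlgebra k (A ⊕ L) → Prop
  | algebraMap (r : k) : VLRel (FreeAlgebra.ι k (Sum.inl (algebraMap k A r)))
      (algebraMap k (FreeAlgebra k (A ⊕ L)) r)
  | add_A (a b : A) : VLRel (FreeAlgebra.ι k (Sum.inl (a + b)))
      (FreeAlgebra.ι k (Sum.inl a) + FreeAlgebra.ι k (Sum.inl b))
  | mul_A (a b : A) : VLRel (FreeAlgebra.ι k (Sum.inl (a * b)))
      (FreeAlgebra.ι k (Sum.inl a) * FreeAlgebra.ι k (Sum.inl b))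
  | add_L (X Y : L) : VLRel (FreeAlgebra.ι k (Sum.inr (X + Y)))
      (FreeAlgebra.ι k (Sum.inr X) + FreeAlgebra.ι k (Sum.inr Y))
  | smul_L (a : A) (X : L) : VLRel (FreeAlgebra.ι k (Sum.inr (a • X)))
      (FreeAlgebra.ι k (Sum.inl a) * FreeAlgebra.ι k (Sum.inr X))
  | lie_L (X Y : L) : VLRel
      (FreeAlgebra.ι k (Sum.inr ⁅X, Y⁆) + FreeAlgebra.ι k (Sum.inr Y) * FreeAlgebra.ι k (Sum.inr X))
      (FreeAlgebra.ι k (Sum.inr X) * FreeAlgebra.ι k (Sum.inr Y))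
  | anchor (X : L) (a : A) : VLRel
      (FreeAlgebra.ι k (Sum.inr X) * FreeAlgebra.ι k (Sum.inl a))
      (FreeAlgebra.ι k (Sum.inl a) * FreeAlgebra.ι k (Sum.inr X)
        + FreeAlgebra.ι k (Sum.inl ⁅X, a⁆))

/-- The universal enveloping algebra `VL` of the Lie-Rinehart algebra `(A, L)`. -/
def VL : Type _ := RingQuot (VLRel k A L)

namespace VL

instance : Ring (VL k A L) := inferInstanceAs (Ring (RingQuot (VLRel k A L)))

instance : Algebra k (VL k A L) := inferInstanceAs (Algebra k (RingQuot (VLRel k A L)))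

/-- The quotient map from the free algebra. -/
def mk : FreeAlgebra k (A ⊕ L) →ₐ[k] VL k A L := RingQuot.mkAlgHom k (VLRel k A L)

variable {k A L} in
theorem mk_rel {x y : FreeAlgebra k (A ⊕ L)} (h : VLRel k A L x y) : mk k A L x = mk k A L y :=
  RingQuot.mkAlgHom_rel k h

/-- The canonical algebra map `A → VL`. -/
def ofA : A →ₐ[k] VL k A L :=
  AlgHom.ofLinearMap
    { toFun := fun a => mk k A L (FreeAlgebra.ι k (Sum.inl a))
      map_add' := fun a b => by rw [mk_rel (VLRel.add_A a b), map_add]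
      map_smul' := fun r a => by
        rw [Algebra.smul_def, mk_rel (VLRel.mul_A _ a), map_mul, mk_rel (VLRel.algebraMap r),
          AlgHom.commutes, RingHom.id_apply, Algebra.smul_def] }
    (by
      change mk k A L (FreeAlgebra.ι k (Sum.inl 1)) = 1
      rw [← map_one (algebraMap k A), mk_rel (VLRel.algebraMap 1), map_one, map_one])
    (fun a b => by
      change mk k A L (FreeAlgebra.ι k (Sum.inl (a * b))) = _
      rw [mk_rel (VLRel.mul_A a b), map_mul]; rfl)

/-- `VL` is a left `A`-module by left multiplication. -/
instance : Module A (VL k A L) := Module.compHom _ (ofA k A L).toRingHom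

theorem smul_eq (a : A) (u : VL k A L) : a • u = ofA k A L a * u := rfl

instance : IsScalarTower k A (VL k A L) :=
  ⟨fun r a u => by rw [smul_eq, smul_eq, map_smul, smul_mul_assoc]⟩

instance : IsScalarTower A (VL k A L) (VL k A L) :=
  ⟨fun a u v => by rw [smul_eq, smul_eq, smul_eq_mul, smul_eq_mul, mul_assoc]⟩

/-- The canonical map `L → VL`, linear over `A` for left multiplication. -/
def ofL : L →ₗ[A] VL k A L where
  toFun X := mk k A L (FreeAlgebra.ι k (Sum.inr X))
  map_add' X Y := by rw [mk_rel (VLRel.add_L X Y), map_add]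
  map_smul' a X := by rw [mk_rel (VLRel.smul_L a X), map_mul]; rfl

theorem ofL_lie (X Y : L) :
    ofL k A L ⁅X, Y⁆ + ofL k A L Y * ofL k A L X = ofL k A L X * ofL k A L Y := by
  have h := mk_rel (VLRel.lie_L (k := k) (A := A) X Y)
  rwa [map_add, map_mul, map_mul] at h

theorem ofL_mul_ofA (X : L) (a : A) :
    ofL k A L X * ofA k A L a = ofA k A L a * ofL k A L X + ofA k A L ⁅X, a⁆ := by
  have h := mk_rel (VLRel.anchor (k := k) X a)
  rwa [map_add, map_mul, map_mul] at h

variable {k A L}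

/-- A left `VL`-module structure on an `A`-module `N`, given by its restriction to `L`: a flat
left `L`-connection on `N`. -/
def rep {N : Type*} [AddCommGroup N] [Module k N] [Module A N] [IsScalarTower k A N]
    (nabla : L → Module.End k N)
    (hadd : ∀ X Y, nabla (X + Y) = nabla X + nabla Y)
    (hsmul : ∀ (a : A) X n, nabla (a • X) n = a • nabla X n)
    (hlie : ∀ X Y n, nabla ⁅X, Y⁆ n = nabla X (nabla Y n) - nabla Y (nabla X n))
    (hleib : ∀ X (a : A) n, nabla X (a • n) = a • nabla X n + ⁅X, a⁆ • n) :
    VL k A L →ₐ[k] Module.End k N :=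
  RingQuot.liftAlgHom k
    ⟨FreeAlgebra.lift k (Sum.elim (Algebra.lsmul k k N : A →ₐ[k] Module.End k N) nabla), by
      intro x y h
      induction h with
      | algebraMap r => simp
      | add_A a b => simp
      | mul_A a b => simp
      | add_L X Y => simp [hadd]
      | smul_L a X => ext n; simp [hsmul]
      | lie_L X Y => ext n; simp [hlie]
      | anchor X a => ext n; simp [hleib]⟩

theorem rep_ofL {N : Type*} [AddCommGroup N] [Module k N] [Module A N] [IsScalarTower k A N]
    (nabla : L → Module.End k N) (h₁ h₂ h₃ h₄) (X : L) :
    rep (A := A) nabla h₁ h₂ h₃ h₄ (ofL k A L X) = nabla X := by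
  change RingQuot.liftAlgHom k _ (RingQuot.mkAlgHom k (VLRel k A L) _) = _
  rw [RingQuot.liftAlgHom_mkAlgHom_apply, FreeAlgebra.lift_ι_apply]
  rfl

theorem rep_ofA {N : Type*} [AddCommGroup N] [Module k N] [Module A N] [IsScalarTower k A N]
    (nabla : L → Module.End k N) (h₁ h₂ h₃ h₄) (a : A) (n : N) :
    rep (A := A) nabla h₁ h₂ h₃ h₄ (ofA k A L a) n = a • n := by
  have h : rep (A := A) nabla h₁ h₂ h₃ h₄ (ofA k A L a) = Algebra.lsmul k k N a := by
    change RingQuot.liftAlgHom k _ (RingQuot.mkAlgHom k (VLRel k A L) _) = _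
    rw [RingQuot.liftAlgHom_mkAlgHom_apply, FreeAlgebra.lift_ι_apply]
    rfl
  rw [h]; rfl

end VL

end Enveloping


/-! ### Cochains on the tensor powers of `VL` and their `VL`-actions -/

section Cochains

variable (k A L : Type*) [CommRing k] [CommRing A] [Algebra k A] [LieRing L] [LieAlgebra k L]
  [Module A L] [LieRingModule L A] [LieRinehartRing A L] [LieRinehartAlgebra k A L]

/-- The direct sum over all `n` of the tensor powers of the left `A`-module `VL`; the product
`v 0 * ... * v (n-1)` is the tensor `(v 0 | ... | v (n-1))`. -/
abbrev TVL : Type _ := TensorAlgebra A (VL k A L)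

variable {k A L}

theorem lie_algebraMap (X : L) (r : k) : ⁅X, algebraMap k A r⁆ = 0 := by
  rw [← LieRinehartAlgebra.anchor_apply (R := k) (A₁ := A), Derivation.map_algebraMap]

theorem lie_one (X : L) : ⁅X, (1 : A)⁆ = 0 := by
  simpa using LieRinehartRing.leibniz_mul_right X (1 : A) 1

/-- Dual numbers over `TVL`, as an `A`-algebra through `a ↦ a + ε X(a)`. -/
def TwistedDual (_X : L) : Type _ := DualNumber (TVL k A L)

namespace TwistedDual

variable {X : L}

instance : Ring (TwistedDual (k := k) (A := A) X) :=
  inferInstanceAs (Ring (DualNumber (TVL k A L)))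

/-- The element `s + ε t`. -/
def pair (s t : TVL k A L) : TwistedDual (k := k) (A := A) X :=
  (show DualNumber (TVL k A L) from (s, t))

/-- The first component. -/
def fst (x : TwistedDual (k := k) (A := A) X) : TVL k A L :=
  TrivSqZeroExt.fst (show DualNumber (TVL k A L) from x)

/-- The coefficient of `ε`. -/
def snd (x : TwistedDual (k := k) (A := A) X) : TVL k A L :=
  TrivSqZeroExt.snd (show DualNumber (TVL k A L) from x)

theorem ext {x y : TwistedDual (k := k) (A := A) X} (h₁ : x.fst = y.fst) (h₂ : x.snd = y.snd) :
    x = y := TrivSqZeroExt.ext h₁ h₂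

theorem fst_pair (s t : TVL k A L) : (pair s t : TwistedDual X).fst = s := rfl
theorem snd_pair (s t : TVL k A L) : (pair s t : TwistedDual X).snd = t := rfl
theorem fst_one : (1 : TwistedDual (k := k) (A := A) X).fst = 1 := rfl
theorem snd_one : (1 : TwistedDual (k := k) (A := A) X).snd = 0 := rfl
theorem fst_zero : (0 : TwistedDual (k := k) (A := A) X).fst = 0 := rfl
theorem snd_zero : (0 : TwistedDual (k := k) (A := A) X).snd = 0 := rfl
theorem fst_add (x y : TwistedDual (k := k) (A := A) X) : (x + y).fst = x.fst + y.fst := rfl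
theorem snd_add (x y : TwistedDual (k := k) (A := A) X) : (x + y).snd = x.snd + y.snd := rfl
theorem fst_mul (x y : TwistedDual (k := k) (A := A) X) : (x * y).fst = x.fst * y.fst := rfl
theorem snd_mul (x y : TwistedDual (k := k) (A := A) X) :
    (x * y).snd = x.fst * y.snd + x.snd * y.fst := rfl

end TwistedDual

open TwistedDual

/-- The structure map `a ↦ a + ε X(a)`. -/
def twistedMap (X : L) : A →+* TwistedDual (k := k) (A := A) X where
  toFun a := pair (algebraMap A _ a) (algebraMap A _ ⁅X, a⁆)
  map_one' := by
    apply TwistedDual.ext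
    · rw [fst_pair, fst_one, map_one]
    · rw [snd_pair, snd_one, lie_one, map_zero]
  map_mul' a b := by
    apply TwistedDual.ext
    · rw [fst_mul, fst_pair, fst_pair, fst_pair, map_mul]
    · rw [snd_mul, snd_pair, snd_pair, snd_pair, fst_pair, fst_pair,
        LieRinehartRing.leibniz_mul_right, map_add, smul_eq_mul, map_mul, map_mul]
  map_zero' := by
    apply TwistedDual.ext
    · rw [fst_pair, fst_zero, map_zero]
    · rw [snd_pair, snd_zero, lie_zero, map_zero]
  map_add' a b := by
    apply TwistedDual.ext
    · rw [fst_add, fst_pair, fst_pair, fst_pair, map_add]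
    · rw [snd_add, snd_pair, snd_pair, snd_pair, lie_add, map_add]

theorem fst_twistedMap (X : L) (a : A) :
    (twistedMap (k := k) X a).fst = algebraMap A (TVL k A L) a := rfl

theorem snd_twistedMap (X : L) (a : A) :
    (twistedMap (k := k) X a).snd = algebraMap A (TVL k A L) ⁅X, a⁆ := rfl

instance (X : L) : Algebra A (TwistedDual (k := k) (A := A) X) :=
  (twistedMap X).toAlgebra' (by
    intro a x
    apply TwistedDual.ext
    · rw [fst_mul, fst_mul, fst_twistedMap, Algebra.commutes]
    · rw [snd_mul, snd_mul, fst_twistedMap, snd_twistedMap, Algebra.commutes,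
        Algebra.commutes ⁅X, a⁆, add_comm])

theorem twisted_smul (X : L) (a : A) (x : TwistedDual (k := k) (A := A) X) :
    a • x = twistedMap X a * x := rfl

theorem twisted_algebraMap (X : L) (a : A) :
    algebraMap A (TwistedDual (k := k) (A := A) X) a = twistedMap X a := rfl

/-- The algebra map `t ↦ t + ε D_X(t)`, with `v ↦ v + ε X v` on `VL`. -/
def twistedLift (X : L) : TVL k A L →ₐ[A] TwistedDual (k := k) (A := A) X :=
  TensorAlgebra.lift A
    { toFun := fun v =>
        pair (TensorAlgebra.ι A v) (TensorAlgebra.ι A (VL.ofL k A L X * v))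
      map_add' := fun u v => by
        apply TwistedDual.ext
        · rw [fst_add, fst_pair, fst_pair, fst_pair, map_add]
        · rw [snd_add, snd_pair, snd_pair, snd_pair, mul_add, map_add]
      map_smul' := fun a v => by
        rw [RingHom.id_apply, twisted_smul]
        apply TwistedDual.ext
        · rw [fst_mul, fst_pair, fst_pair, fst_twistedMap, map_smul, Algebra.smul_def]
        · have : VL.ofL k A L X * (a • v) = a • (VL.ofL k A L X * v) + ⁅X, a⁆ • v := by
            rw [VL.smul_eq, ← mul_assoc, VL.ofL_mul_ofA, add_mul, VL.smul_eq, VL.smul_eq,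
              mul_assoc]
          rw [snd_mul, snd_pair, snd_pair, fst_pair, fst_twistedMap, snd_twistedMap, this,
            map_add, map_smul, map_smul, Algebra.smul_def, Algebra.smul_def] }

theorem twistedLift_ι (X : L) (v : VL k A L) :
    twistedLift X (TensorAlgebra.ι A v)
      = pair (TensorAlgebra.ι A v) (TensorAlgebra.ι A (VL.ofL k A L X * v)) := by
  rw [twistedLift, TensorAlgebra.lift_ι_apply]; rfl

theorem twistedLift_fst (X : L) (t : TVL k A L) : (twistedLift X t).fst = t := by
  induction t using TensorAlgebra.induction with
  | algebraMap a => rw [AlgHom.commutes, twisted_algebraMap, fst_twistedMap]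
  | ι v => rw [twistedLift_ι, fst_pair]
  | mul s t hs ht => rw [map_mul, TwistedDual.fst_mul, hs, ht]
  | add s t hs ht => rw [map_add, TwistedDual.fst_add, hs, ht]

/-- The action of `X ∈ L` on tensors, `(v¹|…|vⁿ) ↦ ∑ᵢ (v¹|…|X vⁱ|…|vⁿ)`, as a derivation
extending the anchor on `A` (see the three lemmas below). -/
def diagDerAdd (X : L) : TVL k A L →+ TVL k A L where
  toFun t := (twistedLift X t).snd
  map_zero' := by rw [map_zero]; rfl
  map_add' s t := by rw [map_add]; rfl

theorem diagDerAdd_algebraMap (X : L) (a : A) :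
    diagDerAdd X (algebraMap A (TVL k A L) a) = algebraMap A _ ⁅X, a⁆ := by
  change (twistedLift X _).snd = _
  rw [AlgHom.commutes, twisted_algebraMap, snd_twistedMap]

theorem diagDerAdd_ι (X : L) (v : VL k A L) :
    diagDerAdd X (TensorAlgebra.ι A v) = TensorAlgebra.ι A (VL.ofL k A L X * v) := by
  change (twistedLift X _).snd = _
  rw [twistedLift_ι, snd_pair]

theorem diagDerAdd_mul (X : L) (s t : TVL k A L) :
    diagDerAdd X (s * t) = s * diagDerAdd X t + diagDerAdd X s * t := by
  change (twistedLift X _).snd = _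
  rw [map_mul, TwistedDual.snd_mul, twistedLift_fst, twistedLift_fst]
  rfl

theorem diagDerAdd_smul (X : L) (a : A) (t : TVL k A L) :
    diagDerAdd X (a • t) = a • diagDerAdd X t + ⁅X, a⁆ • t := by
  rw [Algebra.smul_def, diagDerAdd_mul, diagDerAdd_algebraMap, Algebra.smul_def, Algebra.smul_def]

/-- `diagDerAdd` as a `k`-linear map. -/
def diagDer (X : L) : Module.End k (TVL k A L) where
  __ := diagDerAdd X
  map_smul' r t := by
    change diagDerAdd X (r • t) = r • diagDerAdd X t
    rw [← algebraMap_smul A r t, diagDerAdd_smul, lie_algebraMap, zero_smul, add_zero,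
      algebraMap_smul]

theorem diagDer_algebraMap (X : L) (a : A) :
    diagDer X (algebraMap A (TVL k A L) a) = algebraMap A _ ⁅X, a⁆ := diagDerAdd_algebraMap X a

theorem diagDer_ι (X : L) (v : VL k A L) :
    diagDer X (TensorAlgebra.ι A v) = TensorAlgebra.ι A (VL.ofL k A L X * v) := diagDerAdd_ι X v

theorem diagDer_mul (X : L) (s t : TVL k A L) :
    diagDer X (s * t) = s * diagDer X t + diagDer X s * t := diagDerAdd_mul X s t

theorem diagDer_smul (X : L) (a : A) (t : TVL k A L) :
    diagDer X (a • t) = a • diagDer X t + ⁅X, a⁆ • t := diagDerAdd_smul X a t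

theorem diagDer_add (X Y : L) :
    diagDer (k := k) (A := A) (X + Y) = diagDer X + diagDer Y := by
  ext t
  rw [LinearMap.add_apply]
  induction t using TensorAlgebra.induction with
  | algebraMap a => simp [diagDer_algebraMap]
  | ι v => simp [diagDer_ι, add_mul]
  | mul s t hs ht => simp only [diagDer_mul, hs, ht, mul_add, add_mul]; abel
  | add s t hs ht => simp only [map_add, hs, ht]; abel

theorem diagDer_smul_left (a : A) (X : L) (t : TVL k A L) :
    diagDer (a • X) t = a • diagDer X t := by
  induction t using TensorAlgebra.induction with
  | algebraMap b => simp [diagDer_algebraMap, Algebra.smul_def]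
  | ι v => rw [diagDer_ι, diagDer_ι, map_smul, smul_mul_assoc, map_smul]
  | mul s t hs ht => simp only [diagDer_mul, hs, ht, smul_add, mul_smul_comm, smul_mul_assoc]
  | add s t hs ht => simp only [map_add, hs, ht, smul_add]

theorem diagDer_lie (X Y : L) (t : TVL k A L) :
    diagDer ⁅X, Y⁆ t = diagDer X (diagDer Y t) - diagDer Y (diagDer X t) := by
  induction t using TensorAlgebra.induction with
  | algebraMap b => simp [diagDer_algebraMap]
  | ι v =>
    simp only [diagDer_ι, ← map_sub]
    rw [← mul_assoc, ← mul_assoc, ← sub_mul, ← VL.ofL_lie, add_sub_cancel_right]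
  | mul s t hs ht => simp only [diagDer_mul, hs, ht, map_add, mul_sub, sub_mul]; abel
  | add s t hs ht => simp only [map_add, hs, ht]; abel

/-- The diagonal left `VL`-action on tensors over `A` of copies of `VL`, through the iterated
coproduct (`Δ X = X | 1 + 1 | X`, `Δ a = a | 1`), and through the counit on `A`, the zeroth power:
`diag u (v¹|…|vⁿ) = (u₍₁₎ v¹|…|u₍ₙ₎ vⁿ)`. -/
def diag : VL k A L →ₐ[k] Module.End k (TVL k A L) :=
  VL.rep diagDer diagDer_add diagDer_smul_left diagDer_lie diagDer_smul

theorem diag_ofL (X : L) : diag (VL.ofL k A L X) = diagDer (k := k) (A := A) X :=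
  VL.rep_ofL _ _ _ _ _ X

theorem diag_ofA (a : A) (t : TVL k A L) : diag (VL.ofA k A L a) t = a • t :=
  VL.rep_ofA _ _ _ _ _ a t

/-- For fixed `w`, the `A`-linear map `v ↦ diag v w` on `VL`. -/
def diagOn (w : TVL k A L) : VL k A L →ₗ[A] TVL k A L where
  toFun v := diag v w
  map_add' u v := by rw [map_add, LinearMap.add_apply]
  map_smul' a v := by
    rw [VL.smul_eq, map_mul, Module.End.mul_apply, diag_ofA, RingHom.id_apply]

variable (M : Type*) [AddCommGroup M] [Module k M] [Module A M] [IsScalarTower k A M]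
  [Module (VL k A L) M] [IsScalarTower A (VL k A L) M]

theorem ofA_smul (a : A) (m : M) : VL.ofA k A L a • m = a • m := by
  have h : VL.ofA k A L a = a • (1 : VL k A L) := by rw [VL.smul_eq, mul_one]
  rw [h, smul_assoc, one_smul]

theorem ofL_smul_smul (X : L) (a : A) (m : M) :
    VL.ofL k A L X • a • m = a • VL.ofL k A L X • m + ⁅X, a⁆ • m := by
  rw [← ofA_smul (k := k) (L := L) M a m, ← mul_smul, VL.ofL_mul_ofA, add_smul, mul_smul, ofA_smul,
    ofA_smul]

variable (k A L) in
/-- The product over all `n` of the cochain spaces `Hom_A(VL ⊗_A ... ⊗_A VL, M)`. -/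
abbrev Cochains : Type _ := TVL k A L →ₗ[A] M

variable {M}

/-- The action of `X ∈ L` on cochains, `(X ▷ f)(t) = X f(t) - f(X ◃ t)`. -/
def homDer (X : L) : Module.End k (Cochains k A L M) where
  toFun f :=
    { toFun := fun t => VL.ofL k A L X • f t - f (diagDer X t)
      map_add' := fun s t => by simp only [map_add, smul_add]; abel
      map_smul' := fun a t => by
        simp only [diagDer_smul, map_add, map_smul, ofL_smul_smul, RingHom.id_apply, smul_sub]
        abel }
  map_add' f g := by
    ext1 t
    change VL.ofL k A L X • (f t + g t) - (f _ + g _) = (_ - _) + (_ - _)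
    rw [smul_add]; abel
  map_smul' r f := by
    ext1 t
    change VL.ofL k A L X • (r • f t) - r • f _ = r • (_ - _)
    rw [smul_sub, ← algebraMap_smul A r (f t), ofL_smul_smul, lie_algebraMap, zero_smul, add_zero,
      algebraMap_smul]

theorem homDer_apply (X : L) (f : Cochains k A L M) (t : TVL k A L) :
    homDer X f t = VL.ofL k A L X • f t - f (diagDer X t) := rfl

/-- The left `VL`-action on cochains, `(u ▷ f)(t) = u₊ f(u₋ ◃ t)`, where `a₊ ⊗ a₋ = a ⊗ 1` and
`X₊ ⊗ X₋ = X ⊗ 1 - 1 ⊗ X` on generators. -/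
def homAct : VL k A L →ₐ[k] Module.End k (Cochains k A L M) :=
  VL.rep homDer
    (fun X Y => by
      ext f t
      simp only [homDer_apply, LinearMap.add_apply, diagDer_add, map_add, add_smul]
      abel)
    (fun a X f => by
      ext1 t
      rw [LinearMap.smul_apply, homDer_apply, homDer_apply, diagDer_smul_left, map_smul, map_smul,
        smul_assoc, smul_sub])
    (fun X Y f => by
      ext1 t
      rw [LinearMap.sub_apply]
      have h : VL.ofL k A L ⁅X, Y⁆ • f t = VL.ofL k A L X • VL.ofL k A L Y • f t
          - VL.ofL k A L Y • VL.ofL k A L X • f t := by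
        rw [← mul_smul, ← mul_smul, ← sub_smul, ← VL.ofL_lie, add_sub_cancel_right]
      simp only [homDer_apply, diagDer_lie, map_sub, smul_sub, h]
      abel)
    (fun X a f => by
      ext1 t
      simp only [homDer_apply, LinearMap.add_apply, LinearMap.smul_apply, ofL_smul_smul, smul_sub]
      abel)

theorem homAct_ofA (a : A) (f : Cochains k A L M) : homAct (VL.ofA k A L a) f = a • f :=
  VL.rep_ofA _ _ _ _ _ a f

theorem homAct_ofL (X : L) (f : Cochains k A L M) : homAct (VL.ofL k A L X) f = homDer X f :=
  LinearMap.congr_fun (VL.rep_ofL _ _ _ _ _ X) f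

theorem homAct_smul (a : A) (u : VL k A L) (f : Cochains k A L M) :
    homAct (a • u) f = a • homAct u f := by
  rw [VL.smul_eq, map_mul, Module.End.mul_apply, homAct_ofA]

/-- The product of those factors `g l` of `g 0 * ... * g (p-1)` with `P l`, in increasing order. -/
def prodWhere {R : Type*} [Monoid R] {p : ℕ} (P : Fin p → Prop) [DecidablePred P]
    (g : Fin p → R) : R :=
  (List.ofFn fun l => if P l then g l else 1).prod

theorem prodWhere_update_of_not {R : Type*} [Monoid R] {p : ℕ} (P : Fin p → Prop)
    [DecidablePred P] (g : Fin p → R) (j : Fin p) (hj : ¬ P j) (x : R) :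
    prodWhere P (Function.update g j x) = prodWhere P g := by
  unfold prodWhere
  congr 2
  funext l
  by_cases h : l = j
  · subst h; simp [hj]
  · simp [Function.update_of_ne h]

theorem prodWhere_update_of_pos {p : ℕ} (P : Fin p → Prop)
    [DecidablePred P] (g : Fin p → TVL k A L) (j : Fin p) (hj : P j) (x : TVL k A L) :
    prodWhere P (Function.update g j x) = MultilinearMap.mkPiAlgebraFin A p (TVL k A L)
      (Function.update (fun l => if P l then g l else 1) j x) := by
  rw [MultilinearMap.mkPiAlgebraFin_apply]
  unfold prodWhere
  congr 2
  funext l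
  by_cases h : l = j
  · subst h; simp [hj]
  · simp [Function.update_of_ne h]

theorem prodWhere_add {p : ℕ} (P : Fin p → Prop)
    [DecidablePred P] (g : Fin p → TVL k A L) (j : Fin p) (hj : P j) (x y : TVL k A L) :
    prodWhere P (Function.update g j (x + y))
      = prodWhere P (Function.update g j x) + prodWhere P (Function.update g j y) := by
  simp only [prodWhere_update_of_pos P g j hj, MultilinearMap.map_update_add]

theorem prodWhere_smul {p : ℕ} (P : Fin p → Prop)
    [DecidablePred P] (g : Fin p → TVL k A L) (j : Fin p) (hj : P j) (a : A) (x : TVL k A L) :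
    prodWhere P (Function.update g j (a • x)) = a • prodWhere P (Function.update g j x) := by
  simp only [prodWhere_update_of_pos P g j hj, MultilinearMap.map_update_smul]

/-- The cochain `t ↦ (uⁱ ▷ f)(uⁱ⁺¹ | ... | uᵖ | t | u¹ | ... | uⁱ⁻¹)`. -/
def rotTerm {p : ℕ} (f : Cochains k A L M) (i : Fin p) (u : Fin p → VL k A L) :
    Cochains k A L M :=
  homAct (u i) f ∘ₗ
    LinearMap.mulLeft A (prodWhere (fun l => i < l) fun l => TensorAlgebra.ι A (u l)) ∘ₗ
    LinearMap.mulRight A (prodWhere (fun l => l < i) fun l => TensorAlgebra.ι A (u l))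

theorem rotTerm_apply {p : ℕ} (f : Cochains k A L M) (i : Fin p) (u : Fin p → VL k A L)
    (t : TVL k A L) :
    rotTerm f i u t = homAct (u i) f
      (prodWhere (fun l => i < l) (fun l => TensorAlgebra.ι A (u l)) *
        (t * prodWhere (fun l => l < i) fun l => TensorAlgebra.ι A (u l))) := rfl

theorem ι_update {p : ℕ} (u : Fin p → VL k A L) (j : Fin p) (x : VL k A L) :
    (fun l => TensorAlgebra.ι A (Function.update u j x l))
      = Function.update (fun l => TensorAlgebra.ι A (u l)) j (TensorAlgebra.ι A x) := by
  funext l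
  exact Function.apply_update (fun _ => TensorAlgebra.ι A) u j x l

/-- `rotTerm` is multilinear over `A` in the entries `u¹, ..., uᵖ`. -/
def rotMultilinear {p : ℕ} (f : Cochains k A L M) (i : Fin p) :
    MultilinearMap A (fun _ : Fin p => VL k A L) (Cochains k A L M) :=
  MultilinearMap.mk' (rotTerm f i)
    (by
      intro u j x y
      ext1 t
      rw [LinearMap.add_apply]
      simp only [rotTerm_apply, ι_update]
      rcases lt_trichotomy i j with h | h | h
      · have h' : ¬ j < i := not_lt.mpr h.le
        simp only [Function.update_of_ne h.ne, map_add, prodWhere_add (fun l => i < l) _ j h,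
          prodWhere_update_of_not (fun l => l < i) _ j h', add_mul]
      · subst h
        simp only [Function.update_self, map_add, LinearMap.add_apply,
          prodWhere_update_of_not (fun l => i < l) _ i (lt_irrefl i),
          prodWhere_update_of_not (fun l => l < i) _ i (lt_irrefl i)]
      · have h' : ¬ i < j := not_lt.mpr h.le
        simp only [Function.update_of_ne h.ne', map_add, prodWhere_add (fun l => l < i) _ j h,
          prodWhere_update_of_not (fun l => i < l) _ j h', mul_add])
    (by
      intro u j a x
      ext1 t
      rw [LinearMap.smul_apply]
      simp only [rotTerm_apply, ι_update]
      rcases lt_trichotomy i j with h | h | h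
      · have h' : ¬ j < i := not_lt.mpr h.le
        simp only [Function.update_of_ne h.ne, map_smul, prodWhere_smul (fun l => i < l) _ j h,
          prodWhere_update_of_not (fun l => l < i) _ j h', smul_mul_assoc]
      · subst h
        simp only [Function.update_self, homAct_smul, LinearMap.smul_apply,
          prodWhere_update_of_not (fun l => i < l) _ i (lt_irrefl i),
          prodWhere_update_of_not (fun l => l < i) _ i (lt_irrefl i)]
      · have h' : ¬ i < j := not_lt.mpr h.le
        simp only [Function.update_of_ne h.ne', map_smul, prodWhere_smul (fun l => l < i) _ j h,
          prodWhere_update_of_not (fun l => i < l) _ j h', mul_smul_comm])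

/-- The linear map on all tensors assembled from one multilinear map in each degree. -/
def ofMultilinear (g : ∀ m, MultilinearMap A (fun _ : Fin m => VL k A L) M) :
    Cochains k A L M :=
  DirectSum.toModule A ℕ M (fun m => PiTensorProduct.lift (g m)) ∘ₗ
    (TensorAlgebra.equivDirectSum (R := A) (M := VL k A L)).toLinearMap

theorem ofMultilinear_tprod (g : ∀ m, MultilinearMap A (fun _ : Fin m => VL k A L) M) (m : ℕ)
    (v : Fin m → VL k A L) : ofMultilinear g (TensorAlgebra.tprod A (VL k A L) m v) = g m v := by
  change DirectSum.toModule A ℕ M _ (TensorAlgebra.toDirectSum _) = _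
  rw [TensorAlgebra.toDirectSum_tensorPower_tprod]
  erw [DirectSum.toModule_lof]
  exact PiTensorProduct.lift.tprod v

/-- The map `(v¹, ..., vᵐ) ↦ (v¹ | ... | vⁱ ◃ w | ... | vᵐ)`. -/
def insertAt (w : TVL k A L) {m : ℕ} (i : Fin m) :
    MultilinearMap A (fun _ : Fin m => VL k A L) (TVL k A L) :=
  (MultilinearMap.mkPiAlgebraFin A m (TVL k A L)).compLinearMap
    fun l => if l = i then diagOn w else TensorAlgebra.ι A

/-- The contraction of cochains on tensor powers of `VL` by `w = (u¹|...|uᵖ)`: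
`(ι_w f)(v¹|...|vᵐ) = f(u¹|...|uᵖ|v¹|...|vᵐ)`. -/
def cochainContraction {p : ℕ} (w : ⨂[A]^p (VL k A L)) (f : Cochains k A L M) :
    Cochains k A L M :=
  f ∘ₗ LinearMap.mulLeft A (TensorPower.toTensorAlgebra w)

/-- The Lie derivative of cochains on tensor powers of `VL` along `w = (u¹|...|uᵖ)`. For `f` of
degree `n` and `m = n - p + 1`,
`(L_w f)(v¹|...|vᵐ) = ∑_{i=1}^m (-1)^{(p-1)(i-1)} f(v¹|...|vⁱ ◃ (u¹|...|uᵖ)|...|vᵐ)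
 + ∑_{i=1}^p (-1)^{n(i-1)+p-1} (uⁱ ▷ f)(uⁱ⁺¹|...|uᵖ|v¹|...|vᵐ|u¹|...|uⁱ⁻¹)`.
Below, the indices start at `0` and signs have been rewritten using `n = m + p - 1`. -/
def cochainLie {p : ℕ} (w : ⨂[A]^p (VL k A L)) (f : Cochains k A L M) : Cochains k A L M :=
  ofMultilinear fun m =>
    ∑ i : Fin m, (-1 : ℤ) ^ ((p + 1) * (i : ℕ)) •
      f.compMultilinearMap (insertAt (TensorPower.toTensorAlgebra w) i)
    + ∑ i : Fin p, (-1 : ℤ) ^ ((m + p + 1) * (i : ℕ) + (p + 1)) •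
      (PiTensorProduct.lift (rotMultilinear f i) w).compMultilinearMap
        (TensorAlgebra.tprod A (VL k A L) m)

/-- The formula for the Lie derivative on pure tensors. -/
theorem cochainLie_tprod {p m : ℕ} (u : Fin p → VL k A L) (f : Cochains k A L M)
    (v : Fin m → VL k A L) :
    cochainLie (PiTensorProduct.tprod A u) f (TensorAlgebra.tprod A (VL k A L) m v) =
      ∑ i : Fin m, (-1 : ℤ) ^ ((p + 1) * (i : ℕ)) •
        f (List.ofFn fun l => if l = i then diag (v l) (TensorAlgebra.tprod A (VL k A L) p u)
          else TensorAlgebra.ι A (v l)).prod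
      + ∑ i : Fin p, (-1 : ℤ) ^ ((m + p + 1) * (i : ℕ) + (p + 1)) •
        homAct (u i) f (prodWhere (fun l => i < l) (fun l => TensorAlgebra.ι A (u l)) *
          (TensorAlgebra.tprod A (VL k A L) m v *
            prodWhere (fun l => l < i) fun l => TensorAlgebra.ι A (u l))) := by
  rw [cochainLie, ofMultilinear_tprod, _root_.add_apply, _root_.sum_apply,
    _root_.sum_apply]
  congr 1
  · refine Finset.sum_congr rfl fun i _ => ?_
    rw [_root_.smul_apply, LinearMap.compMultilinearMap_apply, insertAt,
      MultilinearMap.compLinearMap_apply, MultilinearMap.mkPiAlgebraFin_apply]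
    congr 4
    funext l
    split_ifs
    · rw [TensorPower.toTensorAlgebra_tprod]; rfl
    · rfl
  · refine Finset.sum_congr rfl fun i _ => ?_
    rw [_root_.smul_apply, LinearMap.compMultilinearMap_apply, PiTensorProduct.lift.tprod]
    rfl

end Cochains

/-! ### Forms, antisymmetrisation and the projection -/

section Forms

variable (k A L : Type*) [CommRing k] [CommRing A] [Algebra k A] [LieRing L] [LieAlgebra k L]
  [Module A L] [LieRingModule L A] [LieRinehartRing A L] [LieRinehartAlgebra k A L]

/-- The antisymmetrisation `X¹ ∧ ... ∧ Xᵖ ↦ 1/p! ∑_σ (-1)^σ (X^σ(1)|...|X^σ(p))` in degree `p`,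
as an alternating map. -/
def altMap [Algebra ℚ k] (p : ℕ) : L [⋀^Fin p]→ₗ[A] ⨂[A]^p (VL k A L) :=
  algebraMap k A (algebraMap ℚ k (1 / (p.factorial : ℚ))) •
    MultilinearMap.alternatization
      ((PiTensorProduct.tprod A).compLinearMap fun _ => VL.ofL k A L)

/-- `Alt` on the `p`-th exterior power. -/
def alt [Algebra ℚ k] (p : ℕ) : ⋀[A]^p L →ₗ[A] ⨂[A]^p (VL k A L) :=
  exteriorPower.alternatingMapLinearEquiv (altMap k A L p)

/-- `Alt` in all degrees at once. -/
def altTotal [Algebra ℚ k] : ExteriorAlgebra A L →ₗ[A] TVL k A L :=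
  ExteriorAlgebra.liftAlternating fun p =>
    (TensorPower.toTensorAlgebra (R := A) (M := VL k A L)).compAlternatingMap (altMap k A L p)

variable {k A L}

/-- The map `pr ∧ ... ∧ pr`, `(v¹|...|vⁿ) ↦ pr v¹ ∧ ... ∧ pr vⁿ`. -/
def wedgeProj (pr : VL k A L →ₗ[A] L) : TVL k A L →ₐ[A] ExteriorAlgebra A L :=
  TensorAlgebra.lift A (ExteriorAlgebra.ι A ∘ₗ pr)

variable (A L) in
/-- The product over all `n` of the spaces `Hom_A(⋀ⁿ_A L, M)` of alternating forms. -/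
abbrev Forms (M : Type*) [AddCommGroup M] [Module A M] : Type _ := ExteriorAlgebra A L →ₗ[A] M

variable {M : Type*} [AddCommGroup M] [Module k M] [Module A M] [IsScalarTower k A M]
  [Module (VL k A L) M] [IsScalarTower A (VL k A L) M]

/-- `ι_Y` transported from cochains to forms:
`Hom(Alt, M) ∘ ι_{Alt Y} ∘ Hom(pr ∧ ... ∧ pr, M)`. -/
def transportedContraction [Algebra ℚ k] (pr : VL k A L →ₗ[A] L) {p : ℕ} (y : ⋀[A]^p L)
    (ω : Forms A L M) : Forms A L M :=
  cochainContraction (alt k A L p y) (ω ∘ₗ (wedgeProj pr).toLinearMap) ∘ₗ altTotal k A L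

/-- `L_Y` transported from cochains to forms:
`Hom(Alt, M) ∘ L_{Alt Y} ∘ Hom(pr ∧ ... ∧ pr, M)`. -/
def transportedLie [Algebra ℚ k] (pr : VL k A L →ₗ[A] L) {p : ℕ} (y : ⋀[A]^p L)
    (ω : Forms A L M) : Forms A L M :=
  cochainLie (alt k A L p y) (ω ∘ₗ (wedgeProj pr).toLinearMap) ∘ₗ altTotal k A L

/-- The wedge product of the `X l` with `l ∉ s`, in increasing order of `l`. -/
def wedgeOmit {n : ℕ} (s : Finset (Fin n)) (X : Fin n → L) : ExteriorAlgebra A L :=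
  prodWhere (fun l => l ∉ s) fun l => ExteriorAlgebra.ι A (X l)

variable (k A L M) in
/-- The forms of degree `n`. -/
def formDegree (n : ℕ) : Submodule k (Forms A L M) where
  carrier := {ω | ∀ m, m ≠ n → ∀ x ∈ ⋀[A]^m L, ω x = 0}
  add_mem' := fun {ω η} hω hη m hm x hx => by
    rw [LinearMap.add_apply, hω m hm x hx, hη m hm x hx, add_zero]
  zero_mem' := fun _ _ _ _ => rfl
  smul_mem' := fun r ω hω m hm x hx => by
    rw [LinearMap.smul_apply, hω m hm x hx, smul_zero]

variable (k A L) in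
/-- The multivector fields of degree `p`. -/
def vectorDegree (p : ℕ) : Submodule k (ExteriorAlgebra A L) :=
  (⋀[A]^p L).restrictScalars k

variable (k A L) in
/-- The wedge product of multivector fields. -/
def wedge : ExteriorAlgebra A L →ₗ[k] ExteriorAlgebra A L →ₗ[k] ExteriorAlgebra A L :=
  LinearMap.mul k (ExteriorAlgebra A L)

variable (k A L M) in
/-- The contraction, `(ι_Y ω)(X) = ω(Y ∧ X)`; on tuples,
`(ι_Y ω)(X¹, ..., Xᵐ) = ω(Y¹, ..., Yᵖ, X¹, ..., Xᵐ)`. -/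
def contraction : ExteriorAlgebra A L →ₗ[k] Module.End k (Forms A L M) :=
  LinearMap.mk₂ k (fun y ω => ω ∘ₗ LinearMap.mulLeft A y)
    (fun y z ω => by
      refine LinearMap.ext fun x => ?_
      change ω ((y + z) * x) = ω (y * x) + ω (z * x)
      rw [add_mul, map_add])
    (fun r y ω => by
      refine LinearMap.ext fun x => ?_
      change ω ((r • y) * x) = r • ω (y * x)
      rw [smul_mul_assoc, ← algebraMap_smul A r (y * x), map_smul, algebraMap_smul])
    (fun y ω η => rfl)
    (fun r y ω => rfl)

/-- `d` is the de Rham-Chevalley-Eilenberg differential: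
`dω(X¹, ..., Xⁿ) = ∑ᵢ (-1)^{i-1} Xⁱ ω(..., omit Xⁱ, ...)
  + ∑_{i<j} (-1)^{i+j} ω([Xⁱ, Xʲ], ..., omit Xⁱ, Xʲ, ...)`. -/
def IsDeRhamDifferential (d : Module.End k (Forms A L M)) : Prop :=
  ∀ (ω : Forms A L M) (n : ℕ) (X : Fin n → L),
    d ω (ExteriorAlgebra.ιMulti A n X) =
      ∑ i : Fin n, (-1 : ℤ) ^ (i : ℕ) • (VL.ofL k A L (X i) • ω (wedgeOmit {i} X))
      + ∑ i : Fin n, ∑ j ∈ Finset.Ioi i, (-1 : ℤ) ^ ((i : ℕ) + (j : ℕ)) •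
          ω (ExteriorAlgebra.ι A ⁅X i, X j⁆ * wedgeOmit {i, j} X)

/-- `br` is the Schouten-Nijenhuis bracket on multivector fields:
`[a, b] = 0`, `[Y¹ ∧ ... ∧ Yᵖ, a] = ∑ᵢ (-1)^{p-i} Yⁱ(a) Y¹ ∧ ... omit Yⁱ ... ∧ Yᵖ`,
`[a, Y¹ ∧ ... ∧ Yᵖ] = ∑ᵢ (-1)^i Yⁱ(a) Y¹ ∧ ... omit Yⁱ ... ∧ Yᵖ` for `a, b ∈ A`, and
`[Y¹ ∧ ... ∧ Yᵖ, Z¹ ∧ ... ∧ Z^q] = ∑ᵢⱼ (-1)^{i+j} [Yⁱ, Zʲ] ∧ (omit Yⁱ) ∧ (omit Zʲ)`. -/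
def IsSchoutenBracket
    (br : ExteriorAlgebra A L →ₗ[k] ExteriorAlgebra A L →ₗ[k] ExteriorAlgebra A L) : Prop :=
  (∀ a b : A, br (algebraMap A _ a) (algebraMap A _ b) = 0) ∧
  (∀ (p : ℕ) (Y : Fin p → L) (a : A), br (ExteriorAlgebra.ιMulti A p Y) (algebraMap A _ a) =
    ∑ i : Fin p, (-1 : ℤ) ^ (p + (i : ℕ) + 1) • (⁅Y i, a⁆ • wedgeOmit {i} Y)) ∧
  (∀ (p : ℕ) (Y : Fin p → L) (a : A), br (algebraMap A _ a) (ExteriorAlgebra.ιMulti A p Y) =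
    ∑ i : Fin p, (-1 : ℤ) ^ ((i : ℕ) + 1) • (⁅Y i, a⁆ • wedgeOmit {i} Y)) ∧
  ∀ (p q : ℕ) (Y : Fin p → L) (Z : Fin q → L),
    br (ExteriorAlgebra.ιMulti A p Y) (ExteriorAlgebra.ιMulti A q Z) =
      ∑ i : Fin p, ∑ j : Fin q, (-1 : ℤ) ^ ((i : ℕ) + (j : ℕ)) •
        (ExteriorAlgebra.ι A ⁅Y i, Z j⁆ * wedgeOmit {i} Y * wedgeOmit {j} Z)

/-- `lie` is the Lie derivative of forms along multivector fields: for `Y = Y¹ ∧ ... ∧ Yᵖ`,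
`(-1)^{p-1} (L_Y ω)(X¹, ..., Xᵐ) = ∑ᵢ (-1)^{i-1} Yⁱ ω(..., omit Yⁱ, ..., Yᵖ, X¹, ..., Xᵐ)
  + ∑ⱼ ∑ᵢ (-1)^j ω(..., omit Yʲ, ..., Yᵖ, X¹, ..., [Yʲ, Xⁱ], ..., Xᵐ)
  + ∑_{i<j} (-1)^{i+j} ω([Yⁱ, Yʲ], ..., omit Yⁱ, Yʲ, ..., Yᵖ, X¹, ..., Xᵐ)`,
and for `a ∈ A`, `(L_a ω)(X¹, ..., Xᵐ) = ∑ᵢ (-1)^{i-1} Xⁱ(a) ω(..., omit Xⁱ, ...)`. -/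
def IsLieDerivative (lie : ExteriorAlgebra A L →ₗ[k] Module.End k (Forms A L M)) : Prop :=
  (∀ (p m : ℕ) (Y : Fin p → L) (X : Fin m → L) (ω : Forms A L M),
    lie (ExteriorAlgebra.ιMulti A p Y) ω (ExteriorAlgebra.ιMulti A m X) =
      (-1 : ℤ) ^ (p + 1) •
        (∑ i : Fin p, (-1 : ℤ) ^ (i : ℕ) •
            (VL.ofL k A L (Y i) • ω (wedgeOmit {i} Y * ExteriorAlgebra.ιMulti A m X))
          + ∑ j : Fin p, ∑ i : Fin m, (-1 : ℤ) ^ ((j : ℕ) + 1) •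
            ω (wedgeOmit {j} Y *
              ExteriorAlgebra.ιMulti A m (Function.update X i ⁅Y j, X i⁆))
          + ∑ i : Fin p, ∑ j ∈ Finset.Ioi i, (-1 : ℤ) ^ ((i : ℕ) + (j : ℕ)) •
            ω (ExteriorAlgebra.ι A ⁅Y i, Y j⁆ * wedgeOmit {i, j} Y *
              ExteriorAlgebra.ιMulti A m X))) ∧
  ∀ (a : A) (m : ℕ) (X : Fin m → L) (ω : Forms A L M),
    lie (algebraMap A _ a) ω (ExteriorAlgebra.ιMulti A m X) =
      ∑ i : Fin m, (-1 : ℤ) ^ (i : ℕ) • (⁅X i, a⁆ • ω (wedgeOmit {i} X))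

end Forms

/-! ### Gerstenhaber algebras and noncommutative calculi -/

section Calculus

variable {k G X : Type*} [CommRing k] [AddCommGroup G] [Module k G] [AddCommGroup X] [Module k X]

/-- A Gerstenhaber algebra structure on the graded module `G = ⨁ₚ gr p`: a graded commutative
associative product and a graded Lie bracket of degree `-1`, related by the Leibniz rule. -/
structure IsGerstenhaberAlgebra (gr : ℕ → Submodule k G) (mul br : G →ₗ[k] G →ₗ[k] G) :
    Prop where
  isInternal : DirectSum.IsInternal gr
  mul_mem : ∀ {p q : ℕ} {y z : G}, y ∈ gr p → z ∈ gr q → mul y z ∈ gr (p + q)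
  mul_assoc : ∀ x y z : G, mul (mul x y) z = mul x (mul y z)
  mul_comm : ∀ {p q : ℕ} {y z : G}, y ∈ gr p → z ∈ gr q →
    mul y z = (-1 : ℤ) ^ (p * q) • mul z y
  br_zero : ∀ {y z : G}, y ∈ gr 0 → z ∈ gr 0 → br y z = 0
  br_mem : ∀ {p q r : ℕ} {y z : G}, p + q = r + 1 → y ∈ gr p → z ∈ gr q → br y z ∈ gr r
  br_antisymm : ∀ {p q : ℕ} {y z : G}, y ∈ gr p → z ∈ gr q →
    br y z = -((-1 : ℤ) ^ ((p + 1) * (q + 1)) • br z y)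
  jacobi : ∀ {p q r : ℕ} {x y z : G}, x ∈ gr p → y ∈ gr q → z ∈ gr r →
    br x (br y z) = br (br x y) z + (-1 : ℤ) ^ ((p + 1) * (q + 1)) • br y (br x z)
  leibniz : ∀ {p q r : ℕ} {x y z : G}, x ∈ gr p → y ∈ gr q → z ∈ gr r →
    br x (mul y z) = mul (br x y) z + (-1 : ℤ) ^ ((p + 1) * q) • mul y (br x z)

/-- A noncommutative calculus (Batalin-Vilkovisky module) with zero differentials, i.e. a homotopy
calculus all of whose homotopy operators, and whose differentials `δ` on `G` and `b` on `X`,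
vanish: `(G, mul, br)` is a Gerstenhaber algebra, `(X, 0, B)` is a mixed complex (so `B` has degree
`1` and square zero), `X` is a module over `(G, mul)` through the contraction `con`, of degree
`-p` on `gr p`, and over the graded Lie algebra `(G, br)` through the Lie derivative `lie`, of
degree `1 - p`, with `[con φ, lie ψ] = con {φ, ψ}` and `lie φ = [B, con φ]`. The brackets of
operators are graded commutators, `con φ`, `lie φ`, `B` having degrees `p`, `p - 1`, `1` up to an
overall sign. -/
structure IsNoncommutativeCalculus (gr : ℕ → Submodule k G) (mul br : G →ₗ[k] G →ₗ[k] G)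
    (deg : ℕ → Submodule k X) (B : Module.End k X) (con lie : G →ₗ[k] Module.End k X) :
    Prop where
  gerstenhaber : IsGerstenhaberAlgebra gr mul br
  B_mem : ∀ {n : ℕ} {x : X}, x ∈ deg n → B x ∈ deg (n + 1)
  B_sq : ∀ x : X, B (B x) = 0
  con_mem : ∀ {p m : ℕ} {y : G} {x : X}, y ∈ gr p → x ∈ deg (p + m) → con y x ∈ deg m
  con_zero : ∀ {p n : ℕ} {y : G} {x : X}, n < p → y ∈ gr p → x ∈ deg n → con y x = 0
  lie_mem : ∀ {p m n : ℕ} {y : G} {x : X}, n + 1 = p + m → y ∈ gr p → x ∈ deg n →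
    lie y x ∈ deg m
  lie_zero : ∀ {p n : ℕ} {y : G} {x : X}, n + 1 < p → y ∈ gr p → x ∈ deg n → lie y x = 0
  con_mul : ∀ (y z : G) (x : X), con (mul y z) x = con y (con z x)
  lie_br : ∀ {p q : ℕ} {y z : G}, y ∈ gr p → z ∈ gr q → ∀ x : X,
    lie (br y z) x = lie y (lie z x) - (-1 : ℤ) ^ ((p + 1) * (q + 1)) • lie z (lie y x)
  con_lie : ∀ {p q : ℕ} {y z : G}, y ∈ gr p → z ∈ gr q → ∀ x : X,
    con y (lie z x) - (-1 : ℤ) ^ (p * (q + 1)) • lie z (con y x) = con (br y z) x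
  lie_eq : ∀ {p : ℕ} {y : G}, y ∈ gr p → ∀ x : X,
    lie y x = B (con y x) - (-1 : ℤ) ^ p • con y (B x)

end Calculus

end LieRinehart

set_option linter.unusedSimpArgs false

namespace LieRinehart

open ExteriorAlgebra (ι ιMulti)

/-! ### Additive maps out of an exterior algebra -/

section Extension

variable {A L P : Type*} [CommRing A] [AddCommGroup L] [Module A L] [AddCommGroup P] [Module A P]

/-! Uniqueness is easy: multivector fields are additively generated by functions and by products of
vector fields (`ιMulti_induction`), and a form is determined by its values on such products
(`form_ext`). The work lies in existence and in the identities.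

The explicit formulas are not visibly well defined over `A`, because vector fields differentiate
scalars. Each operator is therefore built recursively, by splitting one vector field off the left of
a product, and allowed to fail `A`-linearity by a prescribed defect. `exists_of_cocycle` does this
once and for all: if the defect satisfies the cocycle identity and is compatible with the recursion
step, it twists the `A`-module structure on `Λ × P` so that the recursion becomes `A`-linear, and
the universal property of the exterior algebra applies. Its instances are the even derivations
`derAlong`, the Schouten bracket `schouten`, with values in operators on multivector fields, and the
values `deRhamEval` of the differential on all forms simultaneously. The explicit formulas and the
identities then follow by induction along the same recursions. The Jacobi identity reduces to the
facts that Lie derivatives along vector fields and contractions with differentials of functions act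
compatibly on the bracket (`lieDer_schouten`, `contractD_schouten`).

The Lie derivative of forms is defined as the graded commutator of `deRham` with contraction, so
Cartan's formula holds by construction and the formula of `IsLieDerivative` is a computation
(`lieDerivative_ιMulti_apply`). The commutator of contraction and Lie derivative is proved by
induction (`contraction_lieDerivative`); compatibility with the bracket is then formal, from
Cartan's formula and `deRham_deRham`. Contraction reverses products, `ι_{y ∧ z} = ι_z ι_y`, which is
what forces the opposite Gerstenhaber structure.

For the comparison, a projection `pr` gives a torsion free connection `∇_X Z = pr (X Z)`: indeed `XZ
- ZX = [X, Z]` lies in `L`, where `pr` is the identity. On tensors with entries in `L`, the map `pr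
∧ ... ∧ pr` turns the diagonal action of `X` into `∇_X` (`wedgeProj_diagDer`). The transported Lie
derivative is thus the classical formula with brackets written through `∇`, and torsion freeness
removes `∇` from the total (`sum_projDer_wedgeOmit`, `sum_projDer_mul_wedgeOmit`,
`cochainLie_rot_sum`). What remains is alternating in the `Y`'s and in the `X`'s, so both
antisymmetrisations act trivially. -/

/-- Induction on elements of the exterior algebra, multiplying by generators on the left. -/
theorem exterior_induction {C : ExteriorAlgebra A L → Prop}
    (algebraMap : ∀ a, C (algebraMap A _ a)) (add : ∀ x y, C x → C y → C (x + y))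
    (ι_mul : ∀ X x, C x → C (ExteriorAlgebra.ι A X * x)) (x : ExteriorAlgebra A L) : C x := by
  induction x using CliffordAlgebra.left_induction with
  | algebraMap a => exact algebraMap a
  | add x y hx hy => exact add x y hx hy
  | ι_mul x X hx => exact ι_mul X x hx

theorem ι_mem (X : L) : ExteriorAlgebra.ι A X ∈ ⋀[A]^1 L := by
  change _ ∈ LinearMap.range (ExteriorAlgebra.ι A : L →ₗ[A] _) ^ 1
  rw [pow_one]; exact LinearMap.mem_range_self _ X

theorem mul_mem_exteriorPower {p q : ℕ} {x y : ExteriorAlgebra A L} (hx : x ∈ ⋀[A]^p L)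
    (hy : y ∈ ⋀[A]^q L) : x * y ∈ ⋀[A]^(p + q) L := by
  change _ ∈ LinearMap.range (ExteriorAlgebra.ι A : L →ₗ[A] _) ^ (p + q)
  rw [pow_add]; exact Submodule.mul_mem_mul hx hy

theorem ι_mul_mem {n : ℕ} (X : L) {x : ExteriorAlgebra A L} (hx : x ∈ ⋀[A]^n L) :
    ExteriorAlgebra.ι A X * x ∈ ⋀[A]^(n + 1) L := by
  rw [add_comm]; exact mul_mem_exteriorPower (ι_mem X) hx

theorem algebraMap_mem_zero (a : A) : algebraMap A (ExteriorAlgebra A L) a ∈ ⋀[A]^0 L := by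
  change _ ∈ LinearMap.range (ExteriorAlgebra.ι A : L →ₗ[A] _) ^ 0
  rw [pow_zero]; exact Submodule.algebraMap_mem a

/-- Induction on homogeneous elements of the exterior algebra. -/
theorem homogeneous_induction {C : ∀ (n : ℕ) (x : ExteriorAlgebra A L), x ∈ ⋀[A]^n L → Prop}
    (algebraMap : ∀ a, C 0 (algebraMap A _ a) (algebraMap_mem_zero a))
    (add : ∀ n x y hx hy, C n x hx → C n y hy → C n (x + y) (Submodule.add_mem _ hx hy))
    (ι_mul : ∀ n X x hx, C n x hx → C (n + 1) (ExteriorAlgebra.ι A X * x) (ι_mul_mem X hx))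
    {n : ℕ} {x : ExteriorAlgebra A L} (hx : x ∈ ⋀[A]^n L) : C n x hx := by
  induction hx using Submodule.pow_induction_on_left' with
  | algebraMap a => exact algebraMap a
  | add x y i hx hy h₁ h₂ => exact add i x y hx hy h₁ h₂
  | mem_mul m hm i x hx h => obtain ⟨X, rfl⟩ := hm; exact ι_mul i X x hx h

/-- The module `Λ × P`, to be equipped with an `A`-module structure twisted by a cocycle. -/
def CocycleExtension (A L P : Type*) [CommRing A] [AddCommGroup L] [Module A L]
    [AddCommGroup P] : Type _ := ExteriorAlgebra A L × P

instance : AddCommGroup (CocycleExtension A L P) :=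
  inferInstanceAs (AddCommGroup (ExteriorAlgebra A L × P))

/-- An additive map on the exterior algebra can be prescribed recursively, by its defect `δ₀` of
`A`-linearity and its values on products `X ∧ x`. -/
theorem exists_of_cocycle (σ : L →ₗ[A] Module.End A P)
    (δ₀ : A →+ ExteriorAlgebra A L →+ P) (δ₁ : L →+ ExteriorAlgebra A L →+ P)
    (h₁ : ∀ a b x, δ₀ (a * b) x = a • δ₀ b x + δ₀ a (b • x))
    (h₂ : ∀ a Z x, δ₁ (a • Z) x = a • δ₁ Z x + δ₀ a (ExteriorAlgebra.ι A Z * x))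
    (h₃ : ∀ a Z x, δ₁ Z (a • x) + σ Z (δ₀ a x)
      = a • δ₁ Z x + δ₀ a (ExteriorAlgebra.ι A Z * x))
    (h₄ : ∀ Z x, δ₁ Z (ExteriorAlgebra.ι A Z * x) + σ Z (δ₁ Z x) = 0)
    (h₅ : ∀ Z t, σ Z (σ Z t) = 0) :
    ∃ D : ExteriorAlgebra A L →+ P, D 1 = 0 ∧ (∀ a x, D (a • x) = a • D x + δ₀ a x) ∧
      ∀ Z x, D (ExteriorAlgebra.ι A Z * x) = δ₁ Z x + σ Z (D x) := by
  have h10 : ∀ x, δ₀ 1 x = 0 := fun x => by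
    have := h₁ 1 1 x
    rw [mul_one, one_smul, one_smul] at this
    simpa using this
  -- The twisted action is `a • (x, t) = (a x, a t + δ₀ a x)`. Associativity is the cocycle identity
  -- `h₁`, and the unit law is its consequence `δ₀ 1 = 0`.
  let _ : Module A (CocycleExtension A L P) :=
    { smul := fun a s => (a • s.1, a • s.2 + δ₀ a s.1)
      one_smul := fun s => by
        refine Prod.ext (one_smul _ _) ?_
        change (1 : A) • s.2 + δ₀ 1 s.1 = s.2
        rw [h10, one_smul, add_zero]
      mul_smul := fun a b s => by
        refine Prod.ext (mul_smul _ _ _) ?_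
        change (a * b) • s.2 + δ₀ (a * b) s.1 = a • (b • s.2 + δ₀ b s.1) + δ₀ a (b • s.1)
        rw [h₁, smul_add, mul_smul, add_assoc]
      smul_zero := fun a => by
        refine Prod.ext (smul_zero _) ?_
        change a • (0 : P) + δ₀ a 0 = 0
        rw [smul_zero, map_zero, add_zero]
      smul_add := fun a s t => by
        refine Prod.ext (smul_add _ _ _) ?_
        change a • (s.2 + t.2) + δ₀ a (s.1 + t.1) = (a • s.2 + δ₀ a s.1) + (a • t.2 + δ₀ a t.1)
        rw [smul_add, map_add]; abel
      add_smul := fun a b s => by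
        refine Prod.ext (add_smul _ _ _) ?_
        change (a + b) • s.2 + δ₀ (a + b) s.1 = (a • s.2 + δ₀ a s.1) + (b • s.2 + δ₀ b s.1)
        rw [add_smul, map_add, AddMonoidHom.add_apply]; abel
      zero_smul := fun s => by
        refine Prod.ext (zero_smul _ _) ?_
        change (0 : A) • s.2 + δ₀ 0 s.1 = 0
        rw [zero_smul, map_zero, AddMonoidHom.zero_apply, add_zero] }
  -- The recursion step as an operator on pairs. For the twisted action, `h₂` is its linearity in
  -- `Z` and `h₃` its linearity in the pair.
  let f : L →ₗ[A] CocycleExtension A L P →ₗ[A] CocycleExtension A L P :=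
    LinearMap.mk₂ A (fun Z s => (ExteriorAlgebra.ι A Z * s.1, δ₁ Z s.1 + σ Z s.2))
      (fun Y Z s => by
        refine Prod.ext ?_ ?_
        · change ExteriorAlgebra.ι A (Y + Z) * s.1 = _ * _ + _ * _
          rw [map_add, add_mul]
        · change δ₁ (Y + Z) s.1 + σ (Y + Z) s.2 = (_ + _) + (_ + _)
          rw [map_add, map_add, AddMonoidHom.add_apply, LinearMap.add_apply]; abel)
      (fun a Z s => by
        refine Prod.ext ?_ ?_
        · change ExteriorAlgebra.ι A (a • Z) * s.1 = a • (_ * _)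
          rw [map_smul, smul_mul_assoc]
        · change δ₁ (a • Z) s.1 + σ (a • Z) s.2
            = a • (δ₁ Z s.1 + σ Z s.2) + δ₀ a (ExteriorAlgebra.ι A Z * s.1)
          rw [LinearMap.map_smul σ, LinearMap.smul_apply, h₂, smul_add]; abel)
      (fun Z s t => by
        refine Prod.ext ?_ ?_
        · change ExteriorAlgebra.ι A Z * (s.1 + t.1) = _ * _ + _ * _
          rw [mul_add]
        · change δ₁ Z (s.1 + t.1) + σ Z (s.2 + t.2) = (_ + _) + (_ + _)
          rw [map_add, map_add]; abel)
      (fun a Z s => by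
        refine Prod.ext ?_ ?_
        · change ExteriorAlgebra.ι A Z * (a • s.1) = a • (_ * _)
          rw [mul_smul_comm]
        · change δ₁ Z (a • s.1) + σ Z (a • s.2 + δ₀ a s.1)
            = a • (δ₁ Z s.1 + σ Z s.2) + δ₀ a (ExteriorAlgebra.ι A Z * s.1)
          rw [map_add, LinearMap.map_smul (σ Z), smul_add, add_right_comm _ (a • σ Z s.2), ← h₃]
          abel)
  -- The exterior algebra is the Clifford algebra of the zero form, so folding along `f` only
  -- requires each `f Z` to square to zero; this is what `h₄` and `h₅` say.
  have hf : ∀ Z s, f Z (f Z s) = (0 : QuadraticForm A L) Z • s := fun Z s => by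
    rw [_root_.zero_apply, zero_smul]
    refine Prod.ext ?_ ?_
    · change ExteriorAlgebra.ι A Z * (ExteriorAlgebra.ι A Z * s.1) = 0
      rw [← mul_assoc, ExteriorAlgebra.ι_sq_zero, zero_mul]
    · change δ₁ Z (ExteriorAlgebra.ι A Z * s.1) + σ Z (δ₁ Z s.1 + σ Z s.2) = 0
      rw [map_add, h₅, add_zero, h₄]
  let one : CocycleExtension A L P := ((1 : ExteriorAlgebra A L), (0 : P))
  let F : ExteriorAlgebra A L →ₗ[A] CocycleExtension A L P := CliffordAlgebra.foldr 0 f hf one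
  have F1 : F 1 = one := CliffordAlgebra.foldr_one _ _ _ _
  have Fι : ∀ Z x, F (ExteriorAlgebra.ι A Z * x) = f Z (F x) := fun Z x => by
    change CliffordAlgebra.foldr 0 f hf one (CliffordAlgebra.ι _ Z * x) = _
    rw [CliffordAlgebra.foldr_mul, CliffordAlgebra.foldr_ι]
  -- `F` is a section of the first projection. Hence linearity of `F` for the twisted action, read
  -- in the second component, is exactly the prescribed defect formula.
  have hfst : ∀ x, (F x).1 = x := fun x => by
    induction x using exterior_induction with
    | algebraMap a =>
      rw [Algebra.algebraMap_eq_smul_one, map_smul, F1]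
      rfl
    | add x y hx hy =>
      rw [map_add]
      change (F x).1 + (F y).1 = _
      rw [hx, hy]
    | ι_mul Z x hx =>
      rw [Fι]
      change ExteriorAlgebra.ι A Z * (F x).1 = _
      rw [hx]
  refine ⟨AddMonoidHom.mk' (fun x => (F x).2) fun x y => congrArg Prod.snd (map_add F x y),
    ?_, fun a x => ?_, fun Z x => ?_⟩
  · change (F 1).2 = 0
    rw [F1]
  · change (F (a • x)).2 = a • (F x).2 + δ₀ a x
    rw [map_smul]
    change a • (F x).2 + δ₀ a (F x).1 = _
    rw [hfst]
  · change (F (ExteriorAlgebra.ι A Z * x)).2 = δ₁ Z x + σ Z (F x).2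
    rw [Fι]
    change δ₁ Z (F x).1 + σ Z (F x).2 = _
    rw [hfst]

end Extension

/-! ### Derivations and contractions of multivector fields -/

/-! ### Grading involution and graded commutativity. -/

section Involution

variable {A L : Type*} [CommRing A] [AddCommGroup L] [Module A L]

/-- The grading involution of the exterior algebra. -/
def sgn : ExteriorAlgebra A L →ₐ[A] ExteriorAlgebra A L := CliffordAlgebra.involute

theorem sgn_ι (X : L) : sgn (ι A X) = -ι A X := CliffordAlgebra.involute_ι X

theorem sgn_sgn (x : ExteriorAlgebra A L) : sgn (sgn x) = x := CliffordAlgebra.involute_involute x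

theorem sgn_of_mem {n : ℕ} {x : ExteriorAlgebra A L} (hx : x ∈ ⋀[A]^n L) :
    sgn x = (-1 : ℤ) ^ n • x := by
  induction hx using homogeneous_induction with
  | algebraMap a => rw [AlgHom.commutes, pow_zero, one_smul]
  | add n x y _ _ hx hy => rw [map_add, hx, hy, smul_add]
  | ι_mul n X x _ h => rw [map_mul, h, sgn_ι, pow_succ, neg_mul, mul_smul_comm]; simp

theorem ι_mul_ι_mul (X : L) (x : ExteriorAlgebra A L) : ι A X * (ι A X * x) = 0 := by
  rw [← mul_assoc, ExteriorAlgebra.ι_sq_zero, zero_mul]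

theorem ι_mul_ι (X Y : L) : ι A X * ι A Y = -(ι A Y * ι A X) :=
  eq_neg_of_add_eq_zero_left (ExteriorAlgebra.ι_add_mul_swap X Y)

/-- Writing the sign through the involution makes the commutation rule additive in `x`, so that no
homogeneity is needed in the recursions below. -/
theorem sgn_mul_ι (X : L) (x : ExteriorAlgebra A L) : sgn x * ι A X = ι A X * x := by
  induction x using exterior_induction with
  | algebraMap a => rw [AlgHom.commutes, Algebra.commutes]
  | add x y hx hy => rw [map_add, add_mul, mul_add, hx, hy]
  | ι_mul Y x hx =>
    rw [map_mul, mul_assoc, hx, sgn_ι, neg_mul, ← mul_assoc, ← mul_assoc, ι_mul_ι Y X, neg_mul,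
      neg_neg]

theorem mul_ι (X : L) (x : ExteriorAlgebra A L) : x * ι A X = ι A X * sgn x := by
  rw [← sgn_mul_ι, sgn_sgn]

theorem exterior_mul_comm {p q : ℕ} {y z : ExteriorAlgebra A L} (hy : y ∈ ⋀[A]^p L)
    (hz : z ∈ ⋀[A]^q L) : y * z = (-1 : ℤ) ^ (p * q) • (z * y) := by
  induction hy using homogeneous_induction with
  | algebraMap a => rw [zero_mul, pow_zero, one_smul, Algebra.commutes]
  | add n x y _ _ hx hy => rw [add_mul, mul_add, hx, hy, smul_add]
  | ι_mul n X x _ h =>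
    rw [mul_assoc, h, ← mul_assoc z, mul_ι, sgn_of_mem hz, mul_smul_comm, mul_smul_comm,
      smul_mul_assoc, smul_smul, ← pow_add, show (n + 1) * q + q = n * q + 2 * q by ring, pow_add,
      pow_mul _ 2, mul_assoc]
    simp

end Involution

/-! ### Even derivations over the anchor and contraction with differentials of functions. -/

section Derivations

variable {A L : Type*} [CommRing A] [LieRing L] [Module A L] [LieRingModule L A]
  [LieRinehartRing A L]

/-- An instance of `exists_of_cocycle`, with `σ` left multiplication, defect `X(a) x` and step `ψ(Z)
∧ x`; the cocycle identity is the Leibniz rule of the anchor. A general `ψ` is kept because two are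
needed: `[X, ·]` for `lieDer` and the connection `pr (X ·)` for `projDer`. -/
theorem exists_derAlong (X : L) (ψ : L →+ L) (hψ : ∀ (a : A) Z, ψ (a • Z) = a • ψ Z + ⁅X, a⁆ • Z) :
    ∃ D : ExteriorAlgebra A L →+ ExteriorAlgebra A L,
      D 1 = 0 ∧ (∀ (a : A) x, D (a • x) = a • D x + ⁅X, a⁆ • x) ∧
      ∀ Z x, D (ι A Z * x) = ι A (ψ Z) * x + ι A Z * D x := by
  have := exists_of_cocycle (A := A) (L := L) (P := ExteriorAlgebra A L)
    ((LinearMap.mul A _).comp (ι A))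
    (AddMonoidHom.mk' (fun a => AddMonoidHom.mk' (fun x => ⁅X, a⁆ • x) fun x y => smul_add _ x y)
      fun a b => by ext x; simp [add_smul])
    (AddMonoidHom.mk' (fun Z => AddMonoidHom.mulLeft (ι A (ψ Z))) fun Y Z => by
      ext x; simp [add_mul])
    (fun a b x => by
      simp only [AddMonoidHom.mk'_apply, LieRinehartRing.leibniz_mul_right, add_smul, smul_smul,
        smul_eq_mul])
    (fun a Z x => by
      simp [hψ, add_mul])
    (fun a Z x => by
      simp)
    (fun Z x => by
      simp only [AddMonoidHom.mk'_apply, AddMonoidHom.coe_mulLeft, LinearMap.comp_apply,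
        LinearMap.mul_apply_apply]
      rw [← mul_assoc, ← mul_assoc, ← add_mul, ExteriorAlgebra.ι_add_mul_swap, zero_mul])
    (fun Z x => ι_mul_ι_mul Z x)
  exact this

/-- The even derivation of the exterior algebra extending the anchor of `X` on `A` and `ψ`
on `L`. -/
def derAlong (X : L) (ψ : L →+ L) (hψ : ∀ (a : A) Z, ψ (a • Z) = a • ψ Z + ⁅X, a⁆ • Z) :
    ExteriorAlgebra A L →+ ExteriorAlgebra A L := (exists_derAlong X ψ hψ).choose

variable (X : L) (ψ : L →+ L) (hψ : ∀ (a : A) Z, ψ (a • Z) = a • ψ Z + ⁅X, a⁆ • Z)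

theorem derAlong_one : derAlong X ψ hψ 1 = 0 := (exists_derAlong X ψ hψ).choose_spec.1

theorem derAlong_smul (a : A) (x : ExteriorAlgebra A L) :
    derAlong X ψ hψ (a • x) = a • derAlong X ψ hψ x + ⁅X, a⁆ • x :=
  (exists_derAlong X ψ hψ).choose_spec.2.1 a x

theorem derAlong_ι_mul (Z : L) (x : ExteriorAlgebra A L) :
    derAlong X ψ hψ (ι A Z * x) = ι A (ψ Z) * x + ι A Z * derAlong X ψ hψ x :=
  (exists_derAlong X ψ hψ).choose_spec.2.2 Z x

theorem derAlong_algebraMap (a : A) :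
    derAlong X ψ hψ (algebraMap A _ a) = algebraMap A _ ⁅X, a⁆ := by
  rw [Algebra.algebraMap_eq_smul_one, derAlong_smul, derAlong_one, smul_zero, zero_add,
    Algebra.algebraMap_eq_smul_one]

theorem derAlong_ι (Z : L) : derAlong X ψ hψ (ι A Z) = ι A (ψ Z) := by
  simpa [derAlong_one] using derAlong_ι_mul X ψ hψ Z 1

theorem derAlong_mul (x y : ExteriorAlgebra A L) :
    derAlong X ψ hψ (x * y) = derAlong X ψ hψ x * y + x * derAlong X ψ hψ y := by
  induction x using exterior_induction with
  | algebraMap a =>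
    rw [← Algebra.smul_def, derAlong_smul, derAlong_algebraMap, Algebra.smul_def, Algebra.smul_def,
      add_comm]
  | add x z hx hz => rw [add_mul, map_add, hx, hz, map_add, add_mul, add_mul]; abel
  | ι_mul Z x hx =>
    rw [mul_assoc, derAlong_ι_mul, hx, derAlong_ι_mul]
    simp only [mul_add, add_mul, mul_assoc, add_assoc]

theorem derAlong_mem {n : ℕ} {x : ExteriorAlgebra A L} (hx : x ∈ ⋀[A]^n L) :
    derAlong X ψ hψ x ∈ ⋀[A]^n L := by
  induction hx using homogeneous_induction with
  | algebraMap a => rw [derAlong_algebraMap]; exact algebraMap_mem_zero _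
  | add n x y _ _ hx hy => rw [map_add]; exact Submodule.add_mem _ hx hy
  | ι_mul n Z x hx h =>
    rw [derAlong_ι_mul]
    exact Submodule.add_mem _ (ι_mul_mem _ hx) (ι_mul_mem _ h)

theorem sgn_derAlong (x : ExteriorAlgebra A L) :
    sgn (derAlong X ψ hψ x) = derAlong X ψ hψ (sgn x) := by
  induction x using exterior_induction with
  | algebraMap a => rw [AlgHom.commutes, derAlong_algebraMap, AlgHom.commutes]
  | add x y hx hy => rw [map_add, map_add, map_add, hx, hy, map_add]
  | ι_mul Z x hx =>
    rw [derAlong_ι_mul, map_add, map_mul, map_mul, map_mul, hx, sgn_ι, sgn_ι, neg_mul, neg_mul, neg_mul,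
      map_neg, derAlong_ι_mul, neg_add]

/-- The Lie derivative of multivector fields along `X`. -/
def lieDer (X : L) : ExteriorAlgebra A L →+ ExteriorAlgebra A L :=
  derAlong X (AddMonoidHom.mk' (fun Z => ⁅X, Z⁆) fun Y Z => lie_add X Y Z)
    fun a Z => LieRinehartRing.leibniz_smul_right X Z a

theorem lieDer_smul (X : L) (a : A) (x : ExteriorAlgebra A L) :
    lieDer X (a • x) = a • lieDer X x + ⁅X, a⁆ • x := derAlong_smul _ _ _ a x

theorem lieDer_ι_mul (X Z : L) (x : ExteriorAlgebra A L) :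
    lieDer X (ι A Z * x) = ι A ⁅X, Z⁆ * x + ι A Z * lieDer X x := derAlong_ι_mul _ _ _ Z x

theorem lieDer_algebraMap (X : L) (a : A) :
    lieDer X (algebraMap A (ExteriorAlgebra A L) a) = algebraMap A _ ⁅X, a⁆ :=
  derAlong_algebraMap _ _ _ a

theorem lieDer_ι (X Z : L) : lieDer X (ι A Z) = ι A ⁅X, Z⁆ := derAlong_ι _ _ _ Z

theorem lieDer_mul (X : L) (x y : ExteriorAlgebra A L) :
    lieDer X (x * y) = lieDer X x * y + x * lieDer X y := derAlong_mul _ _ _ x y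

theorem lieDer_mem (X : L) {n : ℕ} {x : ExteriorAlgebra A L} (hx : x ∈ ⋀[A]^n L) :
    lieDer X x ∈ ⋀[A]^n L := derAlong_mem _ _ _ hx

theorem sgn_lieDer (X : L) (x : ExteriorAlgebra A L) : sgn (lieDer X x) = lieDer X (sgn x) :=
  sgn_derAlong _ _ _ x

theorem lieDer_add (X Y : L) (x : ExteriorAlgebra A L) :
    lieDer (X + Y) x = lieDer X x + lieDer Y x := by
  induction x using exterior_induction with
  | algebraMap a => simp only [lieDer_algebraMap, add_lie, map_add]
  | add x y hx hy => simp only [map_add, hx, hy]; abel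
  | ι_mul Z x hx => simp only [lieDer_ι_mul, hx, add_lie, map_add, add_mul, mul_add]; abel

theorem lieDer_lie (X Y : L) (x : ExteriorAlgebra A L) :
    lieDer ⁅X, Y⁆ x = lieDer X (lieDer Y x) - lieDer Y (lieDer X x) := by
  induction x using exterior_induction with
  | algebraMap a => simp only [lieDer_algebraMap, lie_lie, map_sub]
  | add x y hx hy => simp only [map_add, hx, hy]; abel
  | ι_mul Z x hx => simp only [lieDer_ι_mul, hx, lie_lie, map_sub, sub_mul, mul_sub, map_add]; abel

/-- The differential of a function, as a linear form on `L`. -/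
def dA (a : A) : Module.Dual A L where
  toFun X := ⁅X, a⁆
  map_add' X Y := add_lie X Y a
  map_smul' b X := LieRinehartRing.lie_smul_eq_mul b a X

/-- The contraction of multivector fields with the differential of a function. -/
def contractD (a : A) : ExteriorAlgebra A L →ₗ[A] ExteriorAlgebra A L :=
  CliffordAlgebra.contractLeft (dA a)

theorem contractD_ι_mul (a : A) (X : L) (x : ExteriorAlgebra A L) :
    contractD a (ι A X * x) = ⁅X, a⁆ • x - ι A X * contractD a x :=
  CliffordAlgebra.contractLeft_ι_mul _ _ _

theorem contractD_algebraMap (a b : A) :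
    contractD a (algebraMap A (ExteriorAlgebra A L) b) = 0 :=
  CliffordAlgebra.contractLeft_algebraMap _ _ _

theorem contractD_one (a : A) : contractD a (1 : ExteriorAlgebra A L) = 0 :=
  CliffordAlgebra.contractLeft_one _ _

theorem contractD_ι (a : A) (X : L) : contractD a (ι A X) = algebraMap A _ ⁅X, a⁆ :=
  CliffordAlgebra.contractLeft_ι _ _ _

theorem contractD_add (a b : A) (x : ExteriorAlgebra A L) :
    contractD (a + b) x = contractD a x + contractD b x := by
  have : dA (L := L) (a + b) = dA a + dA b := LinearMap.ext fun X => lie_add X a b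
  rw [contractD, this, map_add]; rfl

theorem contractD_mul_eq (a b : A) (x : ExteriorAlgebra A L) :
    contractD (a * b) x = a • contractD b x + b • contractD a x := by
  have : dA (L := L) (a * b) = a • dA b + b • dA a := LinearMap.ext fun X => by
    change ⁅X, a * b⁆ = a • ⁅X, b⁆ + b • ⁅X, a⁆
    rw [LieRinehartRing.leibniz_mul_right, smul_eq_mul, smul_eq_mul, mul_comm b]
  rw [contractD, this, map_add, map_smul, map_smul]; rfl

theorem contractD_contractD (a b : A) (x : ExteriorAlgebra A L) :
    contractD a (contractD b x) = -contractD b (contractD a x) :=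
  CliffordAlgebra.contractLeft_comm _ _ _

theorem contractD_mul (a : A) (x y : ExteriorAlgebra A L) :
    contractD a (x * y) = contractD a x * y + sgn x * contractD a y := by
  induction x using exterior_induction with
  | algebraMap b =>
    rw [← Algebra.smul_def, map_smul, contractD_algebraMap, zero_mul, zero_add, AlgHom.commutes,
      Algebra.smul_def]
  | add x z hx hz => simp only [add_mul, map_add, hx, hz]; abel
  | ι_mul Z x hx =>
    simp only [mul_assoc, contractD_ι_mul, hx, map_mul, sgn_ι, mul_add, sub_mul, smul_mul_assoc,
      neg_mul]
    abel

theorem sgn_contractD (a : A) (x : ExteriorAlgebra A L) :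
    sgn (contractD a x) = -contractD a (sgn x) := by
  induction x using exterior_induction with
  | algebraMap b => rw [AlgHom.commutes, contractD_algebraMap, map_zero, neg_zero]
  | add x z hx hz => simp only [map_add, hx, hz]; abel
  | ι_mul Z x hx =>
    simp only [contractD_ι_mul, hx, map_mul, map_sub, map_smul, sgn_ι, neg_mul, map_neg]
    simp

theorem contractD_of_mem_zero (a : A) {x : ExteriorAlgebra A L} (hx : x ∈ ⋀[A]^0 L) :
    contractD a x = 0 := by
  change _ ∈ LinearMap.range (ι A : L →ₗ[A] _) ^ 0 at hx
  rw [pow_zero] at hx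
  obtain ⟨b, rfl⟩ := Submodule.mem_one.mp hx
  exact contractD_algebraMap a b

theorem contractD_mem_pred (a : A) {n : ℕ} {x : ExteriorAlgebra A L} (hx : x ∈ ⋀[A]^n L) :
    ∀ m, n = m + 1 → contractD a x ∈ ⋀[A]^m L := by
  induction hx using homogeneous_induction with
  | algebraMap b => intro m hm; omega
  | add n x y _ _ hx hy => intro m hm; rw [map_add]; exact Submodule.add_mem _ (hx m hm) (hy m hm)
  | ι_mul n Z x hx h =>
    intro m hm
    obtain rfl : n = m := by omega
    rw [contractD_ι_mul]
    refine Submodule.sub_mem _ (Submodule.smul_mem _ _ hx) ?_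
    cases n with
    | zero => rw [contractD_of_mem_zero a hx, mul_zero]; exact Submodule.zero_mem _
    | succ m => exact ι_mul_mem _ (h m rfl)

/-- On a vector field `Z` this is `X(Z(a)) = Z(X(a)) + [X, Z](a)`; both sides then obey the same
recursion. -/
theorem lieDer_contractD (X : L) (a : A) (x : ExteriorAlgebra A L) :
    lieDer X (contractD a x) = contractD ⁅X, a⁆ x + contractD a (lieDer X x) := by
  induction x using exterior_induction with
  | algebraMap b => simp [contractD_algebraMap, lieDer_algebraMap]
  | add x z hx hz => simp only [map_add, hx, hz]; abel
  | ι_mul Z x hx =>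
    simp only [contractD_ι_mul, lieDer_ι_mul, map_sub, map_add, lieDer_smul, hx, lie_lie, mul_add,
      sub_smul]
    abel

/-- The correction comes from `[aX, Z] = a[X, Z] - Z(a)X`. It is what makes the recursions for the
bracket and for the differential consistent with `A`-linearity of their step. -/
theorem lieDer_smul_left (a : A) (X : L) (x : ExteriorAlgebra A L) :
    lieDer (a • X) x = a • lieDer X x - ι A X * contractD a x := by
  induction x using exterior_induction with
  | algebraMap b =>
    simp only [lieDer_algebraMap, contractD_algebraMap, LieRinehartRing.lie_smul_eq_mul, mul_zero,
      sub_zero, Algebra.smul_def, map_mul]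
  | add x z hx hz => simp only [map_add, hx, hz, smul_add, mul_add]; abel
  | ι_mul Z x hx =>
    have h : ⁅a • X, Z⁆ = a • ⁅X, Z⁆ - ⁅Z, a⁆ • X := by
      rw [← lie_skew, LieRinehartRing.leibniz_smul_right, ← lie_skew X Z, smul_neg]; abel
    have h' : ι A Z * (ι A X * contractD a x) = -(ι A X * (ι A Z * contractD a x)) := by
      rw [← mul_assoc, ι_mul_ι, neg_mul, mul_assoc]
    simp only [lieDer_ι_mul, contractD_ι_mul, h, hx, map_sub, map_smul, sub_mul, smul_mul_assoc,
      mul_sub, mul_smul_comm, smul_add, h']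
    abel

end Derivations

/-! ### The Schouten-Nijenhuis bracket -/

section Schouten

variable {A L : Type*} [CommRing A] [LieRing L] [Module A L] [LieRingModule L A]
  [LieRinehartRing A L]

variable (A L) in
/-- Left multiplication by `Z` on operators on multivector fields. -/
def mulOp : L →ₗ[A] Module.End A (ExteriorAlgebra A L →+ ExteriorAlgebra A L) where
  toFun Z :=
    { toFun := fun T => (AddMonoidHom.mulLeft (ι A Z)).comp T
      map_add' := fun S T => by ext y; simp [mul_add]
      map_smul' := fun a T => by ext y; simp }
  map_add' Y Z := by ext T y; simp [add_mul]
  map_smul' a Z := by ext T y; simp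

theorem mulOp_apply (Z : L) (T : ExteriorAlgebra A L →+ ExteriorAlgebra A L)
    (y : ExteriorAlgebra A L) : mulOp A L Z T y = ι A Z * T y := rfl

variable (A L) in
/-- The defect of `A`-linearity of the bracket in its first argument. -/
def schoutenDefect : A →+ ExteriorAlgebra A L →+ (ExteriorAlgebra A L →+ ExteriorAlgebra A L) :=
  AddMonoidHom.mk' (fun a => AddMonoidHom.mk' (fun x => AddMonoidHom.mk'
      (fun y => -(x * contractD a y)) fun y z => by rw [map_add, mul_add, neg_add])
      fun x z => by ext y; simp [add_mul]; abel)
    fun a b => by ext x y; simp [contractD_add, mul_add]; abel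

theorem schoutenDefect_apply (a : A) (x y : ExteriorAlgebra A L) :
    schoutenDefect A L a x y = -(x * contractD a y) := rfl

variable (A L) in
/-- The part of the bracket of `Z ∧ x` with `y` that involves the Lie derivative along `Z`. -/
def schoutenStep : L →+ ExteriorAlgebra A L →+ (ExteriorAlgebra A L →+ ExteriorAlgebra A L) :=
  AddMonoidHom.mk' (fun Z => AddMonoidHom.mk' (fun x => (AddMonoidHom.mulLeft (sgn x)).comp
      (lieDer Z)) fun x y => by ext z; simp [add_mul])
    fun Y Z => by ext x y; simp [lieDer_add, mul_add]

theorem schoutenStep_apply (Z : L) (x y : ExteriorAlgebra A L) :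
    schoutenStep A L Z x y = sgn x * lieDer Z y := rfl

variable (A L) in
-- The recursion is in the first argument only: `[Z ∧ x, y] = Z ∧ [x, y] + sgn x ∧ L_Z y`, with `[a
-- x, y] = a [x, y] - x ∧ ι_{da} y`. Values lie in additive operators in `y`, since the bracket is
-- not `A`-linear in its second argument either.
theorem exists_schouten :
    ∃ D : ExteriorAlgebra A L →+ (ExteriorAlgebra A L →+ ExteriorAlgebra A L),
      D 1 = 0 ∧ (∀ (a : A) x, D (a • x) = a • D x + schoutenDefect A L a x) ∧
      ∀ Z x, D (ι A Z * x) = schoutenStep A L Z x + mulOp A L Z (D x) := by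
  refine exists_of_cocycle (mulOp A L) (schoutenDefect A L) (schoutenStep A L) (fun a b x => ?_)
    (fun a Z x => ?_) (fun a Z x => ?_) (fun Z x => ?_) (fun Z T => ?_) <;>
    refine AddMonoidHom.ext fun y => ?_ <;>
    simp only [AddMonoidHom.add_apply, AddMonoidHom.smul_apply, schoutenDefect_apply, mulOp_apply,
      schoutenStep_apply, AddMonoidHom.zero_apply]
  · simp only [contractD_mul_eq, mul_add, mul_smul_comm, smul_mul_assoc, smul_neg]
    abel
  · rw [lieDer_smul_left, mul_sub, ← mul_assoc, sgn_mul_ι, mul_smul_comm, sub_eq_add_neg]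
  · simp only [map_smul, smul_mul_assoc, mul_neg, mul_assoc]
  · simp only [map_mul, sgn_ι, neg_mul, mul_assoc, neg_add_cancel]
  · exact ι_mul_ι_mul Z _

/-- The Schouten-Nijenhuis bracket. -/
def schouten : ExteriorAlgebra A L →+ (ExteriorAlgebra A L →+ ExteriorAlgebra A L) :=
  (exists_schouten A L).choose

theorem schouten_one (y : ExteriorAlgebra A L) : schouten 1 y = 0 := by
  rw [schouten, (exists_schouten A L).choose_spec.1]; rfl

theorem schouten_smul (a : A) (x y : ExteriorAlgebra A L) :
    schouten (a • x) y = a • schouten x y - x * contractD a y := by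
  rw [sub_eq_add_neg]
  exact DFunLike.congr_fun ((exists_schouten A L).choose_spec.2.1 a x) y

theorem schouten_ι_mul (Z : L) (x y : ExteriorAlgebra A L) :
    schouten (ι A Z * x) y = ι A Z * schouten x y + sgn x * lieDer Z y := by
  rw [add_comm]
  exact DFunLike.congr_fun ((exists_schouten A L).choose_spec.2.2 Z x) y

theorem schouten_algebraMap (a : A) (y : ExteriorAlgebra A L) :
    schouten (algebraMap A _ a) y = -contractD a y := by
  rw [Algebra.algebraMap_eq_smul_one, schouten_smul, schouten_one]; simp

theorem schouten_mem_pred {p q : ℕ} {x y : ExteriorAlgebra A L} (hx : x ∈ ⋀[A]^p L)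
    (hy : y ∈ ⋀[A]^q L) : ∀ r, p + q = r + 1 → schouten x y ∈ ⋀[A]^r L := by
  induction hx using homogeneous_induction with
  | algebraMap a =>
    intro r hr
    rw [schouten_algebraMap]
    exact Submodule.neg_mem _ (contractD_mem_pred a hy r (by omega))
  | add n x z _ _ hx hz =>
    intro r hr
    rw [map_add]
    exact Submodule.add_mem _ (hx r hr) (hz r hr)
  | ι_mul n Z x hx h =>
    intro r hr
    rw [schouten_ι_mul, sgn_of_mem hx]
    obtain rfl : r = n + q := by omega
    refine Submodule.add_mem _ ?_
      (mul_mem_exteriorPower (Submodule.smul_of_tower_mem _ _ hx) (lieDer_mem Z hy))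
    -- The induction hypothesis places the bracket in degree `n + q - 1`, which does not exist when
    -- both degrees vanish; there the bracket of two functions is zero.
    by_cases hnq : n + q = 0
    · obtain ⟨rfl, rfl⟩ : n = 0 ∧ q = 0 := by omega
      rw [show schouten x y = 0 from ?_, mul_zero]
      · exact Submodule.zero_mem _
      · change _ ∈ LinearMap.range (ι A : L →ₗ[A] _) ^ 0 at hx
        rw [pow_zero] at hx
        obtain ⟨b, rfl⟩ := Submodule.mem_one.mp hx
        rw [schouten_algebraMap, contractD_of_mem_zero b hy, neg_zero]
    · obtain ⟨r, hr⟩ := Nat.exists_eq_succ_of_ne_zero hnq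
      rw [hr]
      exact ι_mul_mem _ (h r hr)

theorem schouten_mem {p q r : ℕ} {x y : ExteriorAlgebra A L} (h : p + q = r + 1)
    (hx : x ∈ ⋀[A]^p L) (hy : y ∈ ⋀[A]^q L) : schouten x y ∈ ⋀[A]^r L :=
  schouten_mem_pred hx hy r h

theorem schouten_of_mem_zero {x y : ExteriorAlgebra A L} (hx : x ∈ ⋀[A]^0 L) (hy : y ∈ ⋀[A]^0 L) :
    schouten x y = 0 := by
  change _ ∈ LinearMap.range (ι A : L →ₗ[A] _) ^ 0 at hx
  rw [pow_zero] at hx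
  obtain ⟨b, rfl⟩ := Submodule.mem_one.mp hx
  rw [schouten_algebraMap, contractD_of_mem_zero b hy, neg_zero]

theorem sgn_schouten (x y : ExteriorAlgebra A L) :
    sgn (schouten x y) = -schouten (sgn x) (sgn y) := by
  induction x using exterior_induction with
  | algebraMap a => rw [AlgHom.commutes, schouten_algebraMap, schouten_algebraMap, map_neg,
      sgn_contractD]
  | add x z hx hz => simp only [map_add, AddMonoidHom.add_apply, hx, hz]; abel
  | ι_mul Z x hx =>
    simp only [schouten_ι_mul, map_add, map_mul, sgn_ι, hx, neg_mul, sgn_lieDer, map_neg,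
      AddMonoidHom.neg_apply, mul_neg]
    abel

theorem mul_ι_mul {q : ℕ} {y : ExteriorAlgebra A L} (hy : y ∈ ⋀[A]^q L) (X : L)
    (w : ExteriorAlgebra A L) : y * (ι A X * w) = (-1 : ℤ) ^ q • (ι A X * (y * w)) := by
  rw [← mul_assoc, mul_ι, sgn_of_mem hy, mul_smul_comm, smul_mul_assoc, mul_assoc]

theorem mul_left_comm_of_mem {p q : ℕ} {x y : ExteriorAlgebra A L} (hx : x ∈ ⋀[A]^p L)
    (hy : y ∈ ⋀[A]^q L) (w : ExteriorAlgebra A L) :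
    y * (x * w) = (-1 : ℤ) ^ (p * q) • (x * (y * w)) := by
  rw [← mul_assoc, exterior_mul_comm hy hx, smul_mul_assoc, mul_assoc, mul_comm q p]

/-- Induction on the first argument: the base case is that `ι_{da}` is an antiderivation, and the
step uses that `L_X` is a derivation. -/
theorem schouten_leibniz {p q : ℕ} {x y : ExteriorAlgebra A L} (hx : x ∈ ⋀[A]^p L)
    (hy : y ∈ ⋀[A]^q L) (z : ExteriorAlgebra A L) :
    schouten x (y * z) = schouten x y * z + (-1 : ℤ) ^ ((p + 1) * q) • (y * schouten x z) := by
  induction hx using homogeneous_induction with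
  | algebraMap a =>
    simp only [schouten_algebraMap, contractD_mul, sgn_of_mem hy, smul_mul_assoc, neg_mul, mul_neg,
      zero_add, one_mul, smul_neg, neg_add]
  | add n x w _ _ hx hw =>
    simp only [map_add, AddMonoidHom.add_apply, hx, hw, mul_add, add_mul, smul_add]; abel
  | ι_mul n X x hx h =>
    simp only [schouten_ι_mul, h, lieDer_mul, mul_add, add_mul, mul_assoc, smul_add, mul_smul_comm,
      mul_ι_mul hy, sgn_of_mem hx, smul_mul_assoc, mul_left_comm_of_mem hx hy, smul_smul]
    -- Both sides now have the same monomials, with signs depending only on the parities of `n` and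
    -- `q`, so four cases suffice.
    rcases neg_one_pow_eq_or ℤ n with hn | hn <;> rcases neg_one_pow_eq_or ℤ q with hq | hq <;>
      simp only [pow_add, pow_mul, pow_one, hn, hq, one_pow, mul_one, one_mul, mul_neg, neg_neg,
        one_smul, neg_smul] <;> abel

theorem schouten_mul_left {p q : ℕ} {x y : ExteriorAlgebra A L} (hx : x ∈ ⋀[A]^p L)
    (hy : y ∈ ⋀[A]^q L) (z : ExteriorAlgebra A L) :
    schouten (x * y) z = x * schouten y z + (-1 : ℤ) ^ (p * q) • (y * schouten x z) := by
  induction hx using homogeneous_induction with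
  | algebraMap a =>
    rw [← Algebra.smul_def, schouten_smul, schouten_algebraMap, Algebra.smul_def, zero_mul,
      pow_zero, one_smul, mul_neg, sub_eq_add_neg]
  | add n x w _ _ hx hw =>
    simp only [map_add, AddMonoidHom.add_apply, hx, hw, mul_add, add_mul, smul_add]; abel
  | ι_mul n X x hx h =>
    simp only [schouten_ι_mul, mul_assoc, h, mul_add, smul_add, mul_smul_comm, map_mul,
      mul_ι_mul hy, sgn_of_mem hx, sgn_of_mem hy, smul_mul_assoc, mul_left_comm_of_mem hx hy,
      smul_smul]
    rcases neg_one_pow_eq_or ℤ n with hn | hn <;> rcases neg_one_pow_eq_or ℤ q with hq | hq <;>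
      simp only [pow_add, pow_mul, pow_one, hn, hq, one_pow, mul_one, one_mul, mul_neg, neg_neg,
        one_smul, neg_smul] <;> abel

theorem schouten_algebraMap_right {p : ℕ} {x : ExteriorAlgebra A L} (hx : x ∈ ⋀[A]^p L) (a : A) :
    schouten x (algebraMap A _ a) = (-1 : ℤ) ^ (p + 1) • contractD a x := by
  induction hx using homogeneous_induction with
  | algebraMap b => rw [schouten_algebraMap, contractD_algebraMap, contractD_algebraMap]; simp
  | add n x w _ _ hx hw =>
    simp only [map_add, AddMonoidHom.add_apply, hx, hw, smul_add]
  | ι_mul n X x hx h =>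
    rw [schouten_ι_mul, h, lieDer_algebraMap, contractD_ι_mul, sgn_of_mem hx, ← Algebra.commutes,
      ← Algebra.smul_def, mul_smul_comm, smul_sub, smul_comm ⁅X, a⁆]
    simp only [pow_succ, mul_neg, mul_one, neg_neg, neg_smul]
    abel

theorem schouten_ι_right (x : ExteriorAlgebra A L) (Z : L) :
    schouten x (ι A Z) = -lieDer Z x := by
  induction x using exterior_induction with
  | algebraMap b => rw [schouten_algebraMap, contractD_ι, lieDer_algebraMap]
  | add x w hx hw =>
    simp only [map_add, AddMonoidHom.add_apply, hx, hw, neg_add]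
  | ι_mul X x h =>
    rw [schouten_ι_mul, h, lieDer_ι, lieDer_ι_mul, sgn_mul_ι, ← lie_skew X Z, map_neg]
    simp only [mul_neg, neg_mul]
    abel

/-- The defining recursion treats the first argument. On the other side the product `X ∧ x` sits in
the second argument, where `schouten_leibniz` and `schouten_ι_right` give the matching expansion. -/
theorem schouten_antisymm {p q : ℕ} {y z : ExteriorAlgebra A L} (hy : y ∈ ⋀[A]^p L)
    (hz : z ∈ ⋀[A]^q L) :
    schouten y z = -((-1 : ℤ) ^ ((p + 1) * (q + 1)) • schouten z y) := by
  induction hy using homogeneous_induction with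
  | algebraMap b =>
    rw [schouten_algebraMap, schouten_algebraMap_right hz, smul_smul, ← pow_add]
    rw [Even.neg_one_pow ⟨q + 1, by ring⟩, one_smul]
  | add n x w _ _ hx hw =>
    simp only [map_add, AddMonoidHom.add_apply, hx, hw, smul_add, neg_add]
  | ι_mul n X x hx h =>
    rw [schouten_ι_mul, h, schouten_leibniz hz (ι_mem X), schouten_ι_right, sgn_of_mem hx,
      neg_mul, exterior_mul_comm (lieDer_mem X hz) hx]
    simp only [mul_neg, smul_neg, mul_smul_comm, smul_mul_assoc, smul_add, smul_smul]
    rcases neg_one_pow_eq_or ℤ n with hn | hn <;> rcases neg_one_pow_eq_or ℤ q with hq | hq <;>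
      simp only [pow_add, pow_mul, pow_one, hn, hq, one_pow, mul_one, one_mul, mul_neg, neg_neg,
        one_smul, neg_smul] <;> abel

/-- The Jacobi identity with a vector field as first entry; the inductive step rests on `L_[X,Z] =
[L_X, L_Z]`. -/
theorem lieDer_schouten (X : L) (x y : ExteriorAlgebra A L) :
    lieDer X (schouten x y) = schouten (lieDer X x) y + schouten x (lieDer X y) := by
  induction x using exterior_induction with
  | algebraMap b =>
    rw [schouten_algebraMap, lieDer_algebraMap, schouten_algebraMap, schouten_algebraMap, map_neg,
      lieDer_contractD, neg_add]
  | add x w hx hw => simp only [map_add, AddMonoidHom.add_apply, hx, hw]; abel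
  | ι_mul Z x h =>
    rw [lieDer_ι_mul, schouten_ι_mul, schouten_ι_mul, map_add, map_add, AddMonoidHom.add_apply,
      schouten_ι_mul, schouten_ι_mul, lieDer_ι_mul, h, lieDer_mul, sgn_lieDer, lieDer_lie, mul_add,
      mul_sub]
    abel

/-- The Jacobi identity with a function as first entry, up to sign. The base case is the
anticommutation of two contractions, the step is `lieDer_contractD`. -/
theorem contractD_schouten (a : A) (x y : ExteriorAlgebra A L) :
    contractD a (schouten x y) = schouten (contractD a x) y - schouten (sgn x) (contractD a y) := by
  induction x using exterior_induction with
  | algebraMap b =>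
    rw [schouten_algebraMap, contractD_algebraMap, AlgHom.commutes, schouten_algebraMap, map_neg,
      map_zero, AddMonoidHom.zero_apply, contractD_contractD]; abel
  | add x w hx hw => simp only [map_add, map_sub, AddMonoidHom.add_apply, hx, hw]; abel
  | ι_mul Z x h =>
    rw [contractD_ι_mul, schouten_ι_mul, map_add, contractD_ι_mul, map_sub, AddMonoidHom.sub_apply,
      schouten_smul, schouten_ι_mul, h, contractD_mul, map_mul, sgn_ι, neg_mul, map_neg,
      AddMonoidHom.neg_apply, schouten_ι_mul, lieDer_contractD, sgn_contractD, sgn_sgn]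
    simp only [mul_add, mul_sub, neg_mul, mul_neg]
    abel

/-- Induction on `x`: the base case is `contractD_schouten`, and splitting off a vector field brings
in `lieDer_schouten` together with the two Leibniz rules. The terms containing `[y, x]` are matched
by antisymmetry. -/
theorem schouten_jacobi {p q : ℕ} {x y : ExteriorAlgebra A L} (hx : x ∈ ⋀[A]^p L)
    (hy : y ∈ ⋀[A]^q L) (z : ExteriorAlgebra A L) :
    schouten x (schouten y z) = schouten (schouten x y) z +
      (-1 : ℤ) ^ ((p + 1) * (q + 1)) • schouten y (schouten x z) := by
  induction hx using homogeneous_induction with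
  | algebraMap b =>
    rw [schouten_algebraMap, schouten_algebraMap, schouten_algebraMap, contractD_schouten,
      sgn_of_mem hy, map_neg, map_neg, AddMonoidHom.neg_apply, zero_add, one_mul, pow_succ, map_zsmul]
    simp only [AddMonoidHom.smul_apply, mul_neg, mul_one, smul_neg, neg_smul]
    abel
  | add n x w _ _ hx hw => simp only [map_add, AddMonoidHom.add_apply, hx, hw, smul_add]; abel
  | ι_mul n X x hx h =>
    have hsx : sgn x ∈ ⋀[A]^n L := by
      rw [sgn_of_mem hx]; exact Submodule.smul_of_tower_mem _ _ hx
    rw [schouten_ι_mul, schouten_ι_mul, schouten_ι_mul, map_add, map_add, AddMonoidHom.add_apply,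
      schouten_ι_mul, schouten_mul_left hsx (lieDer_mem X hy), schouten_leibniz hy (ι_mem X),
      schouten_leibniz hy hsx, schouten_ι_right, sgn_schouten, lieDer_schouten, h,
      sgn_of_mem hx, sgn_of_mem hy]
    simp only [map_zsmul, AddMonoidHom.smul_apply, smul_mul_assoc, mul_smul_comm, mul_add, smul_add,
      neg_mul, smul_neg, schouten_antisymm hy hx, smul_smul, mul_one]
    rcases neg_one_pow_eq_or ℤ n with hn | hn <;> rcases neg_one_pow_eq_or ℤ q with hq | hq <;>
      simp only [pow_add, pow_mul, pow_one, hn, hq, one_pow, mul_one, one_mul, mul_neg, neg_neg,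
        one_smul, neg_smul, neg_mul] <;> abel

end Schouten

/-! ### Formulas on products of vector fields -/

section Explicit

variable {A L : Type*} [CommRing A] [LieRing L] [Module A L]

theorem ιMulti_succ {n : ℕ} (X : Fin (n + 1) → L) :
    ιMulti A (n + 1) X = ι A (X 0) * ιMulti A n (Fin.tail X) :=
  ExteriorAlgebra.ιMulti_succ_apply X

theorem ιMulti_mem {n : ℕ} (X : Fin n → L) : ιMulti A n X ∈ ⋀[A]^n L :=
  (exteriorPower.ιMulti A n X).2

theorem wedgeOmit_singleton_zero {n : ℕ} (X : Fin (n + 1) → L) :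
    wedgeOmit (A := A) {0} X = ιMulti A n (Fin.tail X) := by
  simp [wedgeOmit, prodWhere, List.ofFn_succ, ExteriorAlgebra.ιMulti_apply, Fin.tail]

theorem wedgeOmit_singleton_succ {n : ℕ} (X : Fin (n + 1) → L) (i : Fin n) :
    wedgeOmit (A := A) {i.succ} X = ι A (X 0) * wedgeOmit {i} (Fin.tail X) := by
  simp [wedgeOmit, prodWhere, List.ofFn_succ, Fin.tail, (Fin.succ_ne_zero i).symm]

theorem wedgeOmit_pair_zero_succ {n : ℕ} (X : Fin (n + 1) → L) (j : Fin n) :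
    wedgeOmit (A := A) {0, j.succ} X = wedgeOmit {j} (Fin.tail X) := by
  simp [wedgeOmit, prodWhere, List.ofFn_succ, Fin.tail]

theorem wedgeOmit_pair_succ_succ {n : ℕ} (X : Fin (n + 1) → L) (i j : Fin n) :
    wedgeOmit (A := A) {i.succ, j.succ} X = ι A (X 0) * wedgeOmit {i, j} (Fin.tail X) := by
  simp [wedgeOmit, prodWhere, List.ofFn_succ, Fin.tail, (Fin.succ_ne_zero _).symm]

theorem wedgeOmit_singleton_mem {n : ℕ} (X : Fin (n + 1) → L) (i : Fin (n + 1)) :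
    wedgeOmit (A := A) {i} X ∈ ⋀[A]^n L := by
  induction n with
  | zero =>
    obtain rfl : i = 0 := by omega
    rw [wedgeOmit_singleton_zero]; exact ιMulti_mem _
  | succ n ih =>
    refine Fin.cases ?_ (fun i => ?_) i
    · rw [wedgeOmit_singleton_zero]; exact ιMulti_mem _
    · rw [wedgeOmit_singleton_succ]; exact ι_mul_mem _ (ih _ i)

/-- A sum over pairs `i < j`, with the pairs with `i = 0` split off. -/
theorem sum_Ioi_succ {N : Type*} [AddCommMonoid N] {n : ℕ} (f : Fin (n + 1) → Fin (n + 1) → N) :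
    ∑ i, ∑ j ∈ Finset.Ioi i, f i j
      = ∑ j : Fin n, f 0 j.succ + ∑ i : Fin n, ∑ j ∈ Finset.Ioi i, f i.succ j.succ := by
  rw [Fin.sum_univ_succ]
  congr 1
  · rw [Fin.Ioi_zero_eq_map, Finset.sum_map]; rfl
  · refine Finset.sum_congr rfl fun i _ => ?_
    rw [Fin.Ioi_succ, Finset.sum_map]; rfl

/-- Additive properties of multivector fields need only be checked on functions and on products
of vector fields. -/
theorem ιMulti_induction {C : ExteriorAlgebra A L → Prop}
    (algebraMap : ∀ a, C (algebraMap A _ a)) (add : ∀ x y, C x → C y → C (x + y))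
    (ιMulti : ∀ n (X : Fin n → L), C (ιMulti A n X)) (x : ExteriorAlgebra A L) : C x := by
  have hx : x ∈ Submodule.span A
      (Set.range fun x : Σ n, (Fin n → L) => ExteriorAlgebra.ιMulti A x.1 x.2) := by
    rw [ExteriorAlgebra.ιMulti_span]; trivial
  have h0 : C 0 := by simpa using algebraMap 0
  induction hx using Submodule.closure_induction with
  | zero => exact h0
  | add x y _ _ hx hy => exact add x y hx hy
  | smul_mem a x hx =>
    obtain ⟨⟨n, X⟩, rfl⟩ := hx
    cases n with
    | zero =>
      dsimp only
      rw [ExteriorAlgebra.ιMulti_zero_apply, ← Algebra.algebraMap_eq_smul_one]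
      exact algebraMap a
    | succ n =>
      -- A scalar is absorbed into the first vector field. In degree zero there is none, which is
      -- why functions form a separate case.
      have := ιMulti _ (Function.update X 0 (a • X 0))
      rwa [AlternatingMap.map_update_smul, Function.update_eq_self] at this

variable [LieRingModule L A] [LieRinehartRing A L]

theorem derAlong_ιMulti (X : L) (ψ : L →+ L) (hψ : ∀ (a : A) Z, ψ (a • Z) = a • ψ Z + ⁅X, a⁆ • Z)
    {n : ℕ} (Y : Fin n → L) :
    derAlong X ψ hψ (ιMulti A n Y)
      = ∑ i : Fin n, (-1 : ℤ) ^ (i : ℕ) • (ι A (ψ (Y i)) * wedgeOmit {i} Y) := by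
  induction n with
  | zero => simp [derAlong_one]
  | succ n ih =>
    rw [ιMulti_succ, derAlong_ι_mul, ih, Fin.sum_univ_succ, wedgeOmit_singleton_zero]
    simp only [wedgeOmit_singleton_succ, Finset.mul_sum, Fin.val_zero, pow_zero, one_smul]
    congr 1
    refine Finset.sum_congr rfl fun i _ => ?_
    rw [mul_smul_comm, ← mul_assoc, ι_mul_ι, Fin.val_succ, pow_succ, mul_neg_one, neg_smul,
      neg_mul, smul_neg, mul_assoc]; rfl

/-- Keeps the differentiated vector field in its slot, as the middle sum of `IsLieDerivative`
requires, whereas `derAlong_ιMulti` moves it to the front with a sign. -/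
theorem derAlong_ιMulti_update (X : L) (ψ : L →+ L)
    (hψ : ∀ (a : A) Z, ψ (a • Z) = a • ψ Z + ⁅X, a⁆ • Z) {n : ℕ} (Y : Fin n → L) :
    derAlong X ψ hψ (ιMulti A n Y) = ∑ i, ιMulti A n (Function.update Y i (ψ (Y i))) := by
  induction n with
  | zero => simp [derAlong_one]
  | succ n ih =>
    rw [ιMulti_succ, derAlong_ι_mul, ih, Fin.sum_univ_succ, ιMulti_succ, Finset.mul_sum,
      Function.update_self, Fin.tail_update_zero]
    congr 1
    refine Finset.sum_congr rfl fun i _ => ?_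
    rw [ιMulti_succ, Fin.tail_update_succ, Function.update_of_ne (Fin.succ_ne_zero i).symm]; rfl

theorem lieDer_ιMulti (X : L) {n : ℕ} (Y : Fin n → L) :
    lieDer X (ιMulti A n Y) = ∑ i : Fin n, (-1 : ℤ) ^ (i : ℕ) • (ι A ⁅X, Y i⁆ * wedgeOmit {i} Y) :=
  derAlong_ιMulti _ _ _ Y

theorem lieDer_ιMulti_update (X : L) {n : ℕ} (Y : Fin n → L) :
    lieDer X (ιMulti A n Y) = ∑ i, ιMulti A n (Function.update Y i ⁅X, Y i⁆) :=
  derAlong_ιMulti_update _ _ _ Y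

theorem contractD_ιMulti (a : A) {n : ℕ} (Y : Fin n → L) :
    contractD a (ιMulti A n Y) = ∑ i : Fin n, (-1 : ℤ) ^ (i : ℕ) • (⁅Y i, a⁆ • wedgeOmit {i} Y) := by
  induction n with
  | zero => simp [contractD_one]
  | succ n ih =>
    rw [ιMulti_succ, contractD_ι_mul, ih, Fin.sum_univ_succ, wedgeOmit_singleton_zero,
      Finset.mul_sum, sub_eq_add_neg, ← Finset.sum_neg_distrib]
    simp only [Fin.val_zero, pow_zero, one_smul]
    congr 1
    refine Finset.sum_congr rfl fun i _ => ?_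
    rw [wedgeOmit_singleton_succ, Fin.val_succ, pow_succ, mul_neg_one, neg_smul, mul_smul_comm,
      mul_smul_comm]; rfl

theorem schouten_ιMulti {p q : ℕ} (Y : Fin p → L) (Z : Fin q → L) :
    schouten (ιMulti A p Y) (ιMulti A q Z) = ∑ i : Fin p, ∑ j : Fin q,
      (-1 : ℤ) ^ ((i : ℕ) + (j : ℕ)) • (ι A ⁅Y i, Z j⁆ * wedgeOmit {i} Y * wedgeOmit {j} Z) := by
  induction p with
  | zero => simp [schouten_one]
  | succ p ih =>
    rw [ιMulti_succ, schouten_ι_mul, ih, lieDer_ιMulti, Fin.sum_univ_succ, add_comm,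
      wedgeOmit_singleton_zero, Finset.mul_sum, Finset.mul_sum]
    congr 1
    · refine Finset.sum_congr rfl fun j _ => ?_
      rw [mul_smul_comm, ← mul_assoc, sgn_mul_ι, Fin.val_zero, zero_add]
    · refine Finset.sum_congr rfl fun i _ => ?_
      rw [Finset.mul_sum]
      refine Finset.sum_congr rfl fun j _ => ?_
      rw [mul_smul_comm, ← mul_assoc, ← mul_assoc, ι_mul_ι, wedgeOmit_singleton_succ, Fin.val_succ,
        add_right_comm, pow_succ, mul_neg_one, neg_smul, neg_mul, neg_mul, smul_neg, ← mul_assoc]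
      rfl

end Explicit

/-! ### Scalar bilinearity, uniqueness of the bracket, and the Gerstenhaber structure with its
opposite. -/

section Gerstenhaber

variable {k A L : Type*} [CommRing k] [CommRing A] [Algebra k A] [LieRing L] [LieAlgebra k L]
  [Module A L] [LieRingModule L A] [LieRinehartRing A L] [LieRinehartAlgebra k A L]

theorem lieDer_smul_scalar (X : L) (r : k) (x : ExteriorAlgebra A L) :
    lieDer X (r • x) = r • lieDer X x := by
  rw [← algebraMap_smul A r x, lieDer_smul, lie_algebraMap, zero_smul, add_zero, algebraMap_smul]

theorem contractD_algebraMap_scalar (r : k) (x : ExteriorAlgebra A L) :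
    contractD (algebraMap k A r) x = 0 := by
  have : dA (L := L) (algebraMap k A r) = 0 := LinearMap.ext fun X => lie_algebraMap X r
  rw [contractD, this, map_zero]; rfl

theorem schouten_smul_scalar_left (r : k) (x y : ExteriorAlgebra A L) :
    schouten (r • x) y = r • schouten x y := by
  rw [← algebraMap_smul A r x, schouten_smul, contractD_algebraMap_scalar, mul_zero, sub_zero,
    algebraMap_smul]

theorem schouten_smul_scalar_right (r : k) (x y : ExteriorAlgebra A L) :
    schouten x (r • y) = r • schouten x y := by
  induction x using exterior_induction with
  | algebraMap a =>
    rw [schouten_algebraMap, schouten_algebraMap, ← algebraMap_smul A r y, map_smul,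
      algebraMap_smul, smul_neg]
  | add x z hx hz => rw [map_add, AddMonoidHom.add_apply, hx, hz, ← smul_add]; rfl
  | ι_mul Z x h =>
    rw [schouten_ι_mul, schouten_ι_mul, h, lieDer_smul_scalar, smul_add, mul_smul_comm,
      mul_smul_comm]

variable (k A L) in
/-- The Schouten-Nijenhuis bracket as a `k`-bilinear map. -/
def schoutenBilin : ExteriorAlgebra A L →ₗ[k] ExteriorAlgebra A L →ₗ[k] ExteriorAlgebra A L :=
  LinearMap.mk₂ k (fun x y => schouten x y) (fun x y z => by rw [map_add]; rfl)
    schouten_smul_scalar_left (fun x y z => map_add _ y z) schouten_smul_scalar_right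

theorem schoutenBilin_apply (x y : ExteriorAlgebra A L) :
    schoutenBilin k A L x y = schouten x y := rfl

variable (k A L) in
theorem isSchoutenBracket_schoutenBilin : IsSchoutenBracket (schoutenBilin k A L) := by
  refine ⟨fun a b => ?_, fun p Y a => ?_, fun p Y a => ?_, fun p q Y Z => ?_⟩
  · exact schouten_of_mem_zero (algebraMap_mem_zero a) (algebraMap_mem_zero b)
  · rw [schoutenBilin_apply, schouten_algebraMap_right (ιMulti_mem Y), contractD_ιMulti,
      Finset.smul_sum]
    refine Finset.sum_congr rfl fun i _ => ?_
    rw [smul_smul, ← pow_add, add_right_comm]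
  · rw [schoutenBilin_apply, schouten_algebraMap, contractD_ιMulti, ← Finset.sum_neg_distrib]
    refine Finset.sum_congr rfl fun i _ => ?_
    rw [pow_succ, mul_neg_one, neg_smul]
  · exact schouten_ιMulti Y Z

theorem IsSchoutenBracket.unique
    {br br' : ExteriorAlgebra A L →ₗ[k] ExteriorAlgebra A L →ₗ[k] ExteriorAlgebra A L}
    (h : IsSchoutenBracket br) (h' : IsSchoutenBracket br') : br = br' := by
  refine LinearMap.ext fun x => LinearMap.ext fun y => ?_
  induction x using ιMulti_induction with
  | algebraMap a =>
    induction y using ιMulti_induction with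
    | algebraMap b => rw [h.1, h'.1]
    | add y z hy hz => rw [map_add, map_add, hy, hz]
    | ιMulti n Y => rw [h.2.2.1, h'.2.2.1]
  | add x z hx hz => rw [map_add, map_add, LinearMap.add_apply, LinearMap.add_apply, hx, hz]
  | ιMulti n X =>
    induction y using ιMulti_induction with
    | algebraMap b => rw [h.2.1, h'.2.1]
    | add y z hy hz => rw [map_add, map_add, hy, hz]
    | ιMulti n Y => rw [h.2.2.2, h'.2.2.2]

variable (k A L) in
theorem isGerstenhaberAlgebra_schoutenBilin :
    IsGerstenhaberAlgebra (vectorDegree k A L) (wedge k A L) (schoutenBilin k A L) where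
  isInternal := DirectSum.Decomposition.isInternal fun i : ℕ => ⋀[A]^i L
  mul_mem hy hz := mul_mem_exteriorPower hy hz
  mul_assoc x y z := _root_.mul_assoc x y z
  mul_comm hy hz := exterior_mul_comm hy hz
  br_zero hy hz := schouten_of_mem_zero hy hz
  br_mem h hy hz := schouten_mem h hy hz
  br_antisymm hy hz := schouten_antisymm hy hz
  jacobi hx hy _ := schouten_jacobi hx hy _
  leibniz hx hy _ := schouten_leibniz hx hy _

/-- The opposite of a Gerstenhaber algebra is a Gerstenhaber algebra. -/
theorem IsGerstenhaberAlgebra.opposite {k G : Type*} [CommRing k] [AddCommGroup G] [Module k G]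
    {gr : ℕ → Submodule k G} {mul br : G →ₗ[k] G →ₗ[k] G} (h : IsGerstenhaberAlgebra gr mul br) :
    IsGerstenhaberAlgebra gr mul.flip (-br.flip) where
  isInternal := h.isInternal
  mul_mem {p q y z} hy hz := by rw [add_comm]; exact h.mul_mem hz hy
  mul_assoc x y z := (h.mul_assoc z y x).symm
  mul_comm {p q y z} hy hz := by
    rw [_root_.mul_comm p q]; exact h.mul_comm hz hy
  br_zero hy hz := by
    simp only [LinearMap.neg_apply, LinearMap.flip_apply, h.br_zero hz hy, neg_zero]
  br_mem {p q r y z} hr hy hz := Submodule.neg_mem _ (h.br_mem ((add_comm q p).trans hr) hz hy)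
  br_antisymm {p q y z} hy hz := by
    simp only [LinearMap.neg_apply, LinearMap.flip_apply, smul_neg, neg_neg]
    rw [h.br_antisymm hz hy, neg_neg, _root_.mul_comm (q + 1)]
  jacobi {p q r x y z} hx hy hz := by
    simp only [LinearMap.neg_apply, LinearMap.flip_apply, map_neg, neg_neg, smul_neg]
    rw [h.jacobi hz hy hx, add_assoc, left_eq_add]
    -- Jacobi for the reversed triple leaves a single term to be reordered by antisymmetry, which
    -- needs the degree `r + p - 1` of `[z, x]`. When `r = p = 0` that bracket vanishes instead.
    by_cases hrp : r + p = 0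
    · obtain ⟨rfl, rfl⟩ : r = 0 ∧ p = 0 := by omega
      rw [h.br_zero hz hx]; simp
    · obtain ⟨s, hs⟩ := Nat.exists_eq_succ_of_ne_zero hrp
      rw [h.br_antisymm (h.br_mem hs hz hx) hy, smul_neg, smul_smul, ← pow_add,
        ← Nat.succ_eq_add_one s, ← hs, show (p + 1) * (q + 1) + (r + p) * (q + 1)
          = (r + 1) * (q + 1) + 2 * (p * (q + 1)) by ring, pow_add _ ((r + 1) * (q + 1)), pow_mul _ 2]
      simp
  leibniz {p q r x y z} hx hy hz := by
    simp only [LinearMap.neg_apply, LinearMap.flip_apply, map_neg, neg_neg, smul_neg]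
    rw [h.br_antisymm (h.mul_mem hz hy) hx, h.leibniz hx hz hy, h.br_antisymm hx hz,
      h.br_antisymm hx hy]
    simp only [map_neg, LinearMap.neg_apply, map_zsmul, LinearMap.smul_apply, smul_add, smul_neg,
      smul_smul]
    rcases neg_one_pow_eq_or ℤ p with hp | hp <;> rcases neg_one_pow_eq_or ℤ q with hq | hq <;>
      rcases neg_one_pow_eq_or ℤ r with hr | hr <;>
      simp only [pow_add, pow_mul, pow_one, hp, hq, hr, one_pow, mul_one, one_mul, mul_neg, neg_neg,
        one_smul, neg_smul, neg_mul] <;> abel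

end Gerstenhaber

/-! ### The differential and the Lie derivative of forms -/

section DeRham

/-- Additive functionals on forms with values in the coefficient module, with `A` acting through
the forms. -/
def FormFunctional (A L M : Type*) [CommRing A] [AddCommGroup L] [Module A L] [AddCommGroup M]
    [Module A M] : Type _ := (ExteriorAlgebra A L →ₗ[A] M) →+ M

namespace FormFunctional

variable {A L M : Type*} [CommRing A] [AddCommGroup L] [Module A L] [AddCommGroup M] [Module A M]

instance : AddCommGroup (FormFunctional A L M) :=
  inferInstanceAs (AddCommGroup ((ExteriorAlgebra A L →ₗ[A] M) →+ M))

/-- The value of a functional at a form. -/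
def eval (T : FormFunctional A L M) (ω : ExteriorAlgebra A L →ₗ[A] M) : M :=
  (show (ExteriorAlgebra A L →ₗ[A] M) →+ M from T) ω

/-- The functional given by an additive function. -/
def of (f : (ExteriorAlgebra A L →ₗ[A] M) → M) (hf : ∀ ω η, f (ω + η) = f ω + f η) :
    FormFunctional A L M := AddMonoidHom.mk' f hf

theorem eval_of (f : (ExteriorAlgebra A L →ₗ[A] M) → M) (hf) (ω) :
    (of f hf).eval ω = f ω := rfl

theorem ext {S T : FormFunctional A L M} (h : ∀ ω, S.eval ω = T.eval ω) : S = T :=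
  AddMonoidHom.ext h

theorem eval_add (S T : FormFunctional A L M) (ω) : (S + T).eval ω = S.eval ω + T.eval ω := rfl

theorem eval_zero (ω) : (0 : FormFunctional A L M).eval ω = 0 := rfl

theorem eval_add_form (T : FormFunctional A L M) (ω η) :
    T.eval (ω + η) = T.eval ω + T.eval η := AddMonoidHom.map_add _ _ _

theorem eval_zero_form (T : FormFunctional A L M) : T.eval 0 = 0 := AddMonoidHom.map_zero _

instance : SMul A (FormFunctional A L M) :=
  ⟨fun a T => of (fun ω => T.eval (a • ω)) fun ω η => by rw [smul_add, eval_add_form]⟩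

theorem eval_smul (a : A) (T : FormFunctional A L M) (ω) : (a • T).eval ω = T.eval (a • ω) := rfl

instance : Module A (FormFunctional A L M) where
  one_smul T := ext fun ω => by rw [eval_smul, one_smul]
  mul_smul a b T := ext fun ω => by rw [eval_smul, eval_smul, eval_smul, smul_smul, mul_comm]
  smul_zero a := ext fun ω => by rw [eval_smul, eval_zero, eval_zero]
  smul_add a S T := ext fun ω => by simp only [eval_smul, eval_add]
  add_smul a b T := ext fun ω => by simp only [eval_smul, eval_add, add_smul, eval_add_form]
  zero_smul T := ext fun ω => by rw [eval_smul, zero_smul, eval_zero_form, eval_zero]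

variable (A L M) in
/-- Precomposition of functionals with the negative of contraction by a vector field. -/
def negContract : L →ₗ[A] Module.End A (FormFunctional A L M) where
  toFun Z :=
    { toFun := fun T => of (fun ω => T.eval (-(ω ∘ₗ LinearMap.mulLeft A (ι A Z)))) fun ω η => by
        rw [← eval_add_form, LinearMap.add_comp, neg_add]
      map_add' := fun S T => rfl
      map_smul' := fun a T => ext fun ω => by
        simp only [eval_of, eval_smul, RingHom.id_apply, LinearMap.smul_comp, smul_neg] }
  map_add' Y Z := LinearMap.ext fun T => ext fun ω => by
    change T.eval _ = T.eval _ + T.eval _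
    rw [← eval_add_form]
    congr 1
    refine LinearMap.ext fun x => ?_
    simp [add_mul]; abel
  map_smul' a Z := LinearMap.ext fun T => ext fun ω => by
    change T.eval _ = T.eval _
    congr 1
    refine LinearMap.ext fun x => ?_
    simp

theorem eval_negContract (Z : L) (T : FormFunctional A L M) (ω) :
    (negContract A L M Z T).eval ω = T.eval (-(ω ∘ₗ LinearMap.mulLeft A (ι A Z))) := rfl

end FormFunctional

open FormFunctional

variable {k A L : Type*} [CommRing k] [CommRing A] [Algebra k A] [LieRing L] [LieAlgebra k L]
  [Module A L] [LieRingModule L A] [LieRinehartRing A L] [LieRinehartAlgebra k A L]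
variable {M : Type*} [AddCommGroup M] [Module k M] [Module A M] [IsScalarTower k A M]
  [Module (VL k A L) M] [IsScalarTower A (VL k A L) M]

variable (k M) in
/-- The Lie derivative of forms along the vector field `X`. -/
def lieForm (X : L) : Module.End k (Forms A L M) where
  toFun ω :=
    { toFun := fun x => VL.ofL k A L X • ω x - ω (lieDer X x)
      map_add' := fun x y => by simp only [map_add, smul_add]; abel
      map_smul' := fun a x => by
        simp only [lieDer_smul, map_add, map_smul, ofL_smul_smul, RingHom.id_apply, smul_sub]
        abel }
  map_add' ω η := by
    refine LinearMap.ext fun x => ?_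
    change VL.ofL k A L X • (ω x + η x) - (ω _ + η _) = (_ - _) + (_ - _)
    rw [smul_add]; abel
  map_smul' r ω := by
    refine LinearMap.ext fun x => ?_
    change VL.ofL k A L X • (r • ω x) - r • ω _ = r • (_ - _)
    rw [smul_sub, ← algebraMap_smul A r (ω x), ofL_smul_smul, lie_algebraMap, zero_smul, add_zero,
      algebraMap_smul]

theorem lieForm_apply (X : L) (ω : Forms A L M) (x : ExteriorAlgebra A L) :
    lieForm k M X ω x = VL.ofL k A L X • ω x - ω (lieDer X x) := rfl

theorem contraction_apply (y : ExteriorAlgebra A L) (ω : Forms A L M) (x : ExteriorAlgebra A L) :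
    contraction k A L M y ω x = ω (y * x) := rfl

variable (A L M) in
/-- The defect of `A`-linearity of the differential. -/
def deRhamDefect : A →+ ExteriorAlgebra A L →+ FormFunctional A L M :=
  AddMonoidHom.mk' (fun a => AddMonoidHom.mk'
      (fun x => of (fun ω => -ω (contractD a x)) fun ω η => by
        rw [LinearMap.add_apply, neg_add]) fun x y => FormFunctional.ext fun ω => by
      simp only [eval_of, eval_add, map_add, neg_add])
    fun a b => AddMonoidHom.ext fun x => FormFunctional.ext fun ω => by
      simp only [AddMonoidHom.add_apply, AddMonoidHom.mk'_apply, eval_of, eval_add, contractD_add,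
        map_add, neg_add]

theorem eval_deRhamDefect (a : A) (x : ExteriorAlgebra A L) (ω : Forms A L M) :
    (deRhamDefect A L M a x).eval ω = -ω (contractD a x) := rfl

variable (k A L M) in
/-- The evaluation of Lie derivatives of forms. -/
def deRhamStep : L →+ ExteriorAlgebra A L →+ FormFunctional A L M :=
  AddMonoidHom.mk' (fun Z => AddMonoidHom.mk'
      (fun x => of (fun ω => lieForm k M Z ω x) fun ω η => by
        rw [map_add, LinearMap.add_apply]) fun x y => FormFunctional.ext fun ω => by
      simp only [eval_of, eval_add, map_add])
    fun Y Z => AddMonoidHom.ext fun x => FormFunctional.ext fun ω => by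
      simp only [AddMonoidHom.add_apply, AddMonoidHom.mk'_apply, eval_of, eval_add, lieForm_apply,
        map_add, add_smul, lieDer_add]
      abel

theorem eval_deRhamStep (Z : L) (x : ExteriorAlgebra A L) (ω : Forms A L M) :
    (deRhamStep k A L M Z x).eval ω = VL.ofL k A L Z • ω x - ω (lieDer Z x) := rfl

variable (k A L M) in
-- The recursion `dω(Z ∧ x) = (L_Z ω)(x) - d(ι_Z ω)(x)` changes the form, so the values on all forms
-- are built at once, as a functional of `ω`. Scalars act on functionals through the form because `Z
-- ↦ -ι_Z` must be linear there while the functionals are merely additive. The defect is then `dω(a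
-- x) = d(aω)(x) - ω(ι_{da} x)`.
theorem exists_deRham :
    ∃ D : ExteriorAlgebra A L →+ FormFunctional A L M,
      D 1 = 0 ∧ (∀ (a : A) x, D (a • x) = a • D x + deRhamDefect A L M a x) ∧
      ∀ Z x, D (ι A Z * x) = deRhamStep k A L M Z x + negContract A L M Z (D x) := by
  refine exists_of_cocycle (negContract A L M) (deRhamDefect A L M) (deRhamStep k A L M)
    (fun a b x => ?_) (fun a Z x => ?_) (fun a Z x => ?_) (fun Z x => ?_) (fun Z T => ?_) <;>
    refine FormFunctional.ext fun ω => ?_ <;>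
    simp only [eval_add, eval_smul, eval_negContract, eval_deRhamDefect, eval_deRhamStep,
      eval_zero, LinearMap.smul_apply, LinearMap.neg_apply, LinearMap.comp_apply,
      LinearMap.mulLeft_apply]
  · simp only [contractD_mul_eq, map_add, map_smul, neg_add]
  · simp only [lieDer_smul_left, contractD_ι_mul, map_sub, map_smul, smul_assoc, ofL_smul_smul]
    abel
  · simp only [contractD_ι_mul, lieDer_smul, map_sub, map_add, map_smul, ofL_smul_smul]
    abel
  · rw [lieDer_ι_mul, lie_self, map_zero, zero_mul, zero_add, smul_neg]
    abel
  · rw [← eval_zero_form T]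
    congr 1
    refine LinearMap.ext fun x => ?_
    simp [ι_mul_ι_mul]

variable (k A L M) in
/-- The values of the differential of forms. -/
def deRhamEval : ExteriorAlgebra A L →+ FormFunctional A L M := (exists_deRham k A L M).choose

theorem deRhamEval_one (ω : Forms A L M) : (deRhamEval k A L M 1).eval ω = 0 := by
  rw [deRhamEval, (exists_deRham k A L M).choose_spec.1, eval_zero]

theorem deRhamEval_smul' (a : A) (x : ExteriorAlgebra A L) (ω : Forms A L M) :
    (deRhamEval k A L M (a • x)).eval ω
      = (deRhamEval k A L M x).eval (a • ω) - ω (contractD a x) := by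
  rw [deRhamEval, (exists_deRham k A L M).choose_spec.2.1, sub_eq_add_neg]; rfl

theorem deRhamEval_ι_mul (Z : L) (x : ExteriorAlgebra A L) (ω : Forms A L M) :
    (deRhamEval k A L M (ι A Z * x)).eval ω
      = lieForm k M Z ω x - (deRhamEval k A L M x).eval (contraction k A L M (ι A Z) ω) := by
  rw [deRhamEval, (exists_deRham k A L M).choose_spec.2.2, eval_add, eval_negContract,
    sub_eq_add_neg]
  congr 1
  exact AddMonoidHom.map_neg _ _

/-- The Leibniz rule for `aω`. Its extra term cancels the defect in `deRhamEval_smul'`, so `dω` is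
`A`-linear for the ordinary action after all. -/
theorem deRhamEval_smul_form (x : ExteriorAlgebra A L) (a : A) (ω : Forms A L M) :
    (deRhamEval k A L M x).eval (a • ω)
      = a • (deRhamEval k A L M x).eval ω + ω (contractD a x) := by
  induction x using exterior_induction generalizing a ω with
  | algebraMap b =>
    rw [Algebra.algebraMap_eq_smul_one, deRhamEval_smul', deRhamEval_smul', deRhamEval_one,
      deRhamEval_one]
    simp [contractD_one]
  | add x y hx hy => rw [map_add, eval_add, eval_add, hx, hy, map_add, map_add, smul_add]; abel
  | ι_mul Z x hx =>
    have : contraction k A L M (ι A Z) (a • ω) = a • contraction k A L M (ι A Z) ω := rfl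
    rw [deRhamEval_ι_mul, deRhamEval_ι_mul, this, hx, contraction_apply, contractD_ι_mul, map_sub,
      lieForm_apply, lieForm_apply, LinearMap.smul_apply, LinearMap.smul_apply, ofL_smul_smul,
      map_smul, smul_sub, smul_sub]
    abel

theorem deRhamEval_smul (a : A) (x : ExteriorAlgebra A L) (ω : Forms A L M) :
    (deRhamEval k A L M (a • x)).eval ω = a • (deRhamEval k A L M x).eval ω := by
  rw [deRhamEval_smul', deRhamEval_smul_form, add_sub_cancel_right]

variable (k A L M) in
/-- The de Rham-Chevalley-Eilenberg differential. -/
def deRham : Module.End k (Forms A L M) where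
  toFun ω :=
    { toFun := fun x => (deRhamEval k A L M x).eval ω
      map_add' := fun x y => by rw [map_add, eval_add]
      map_smul' := fun a x => deRhamEval_smul a x ω }
  map_add' ω η := LinearMap.ext fun x => eval_add_form _ ω η
  map_smul' r ω := LinearMap.ext fun x => by
    have := deRhamEval_smul_form (k := k) x (algebraMap k A r) ω
    rwa [contractD_algebraMap_scalar, map_zero, add_zero, algebraMap_smul, algebraMap_smul] at this

theorem deRham_one (ω : Forms A L M) : deRham k A L M ω 1 = 0 := deRhamEval_one ω

theorem deRham_algebraMap (a : A) (ω : Forms A L M) :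
    deRham k A L M ω (algebraMap A _ a) = 0 := by
  rw [Algebra.algebraMap_eq_smul_one, map_smul, deRham_one, smul_zero]

theorem deRham_ι_mul (Z : L) (x : ExteriorAlgebra A L) (ω : Forms A L M) :
    deRham k A L M ω (ι A Z * x)
      = lieForm k M Z ω x - deRham k A L M (contraction k A L M (ι A Z) ω) x :=
  deRhamEval_ι_mul Z x ω

theorem deRham_smul_form (a : A) (ω : Forms A L M) (x : ExteriorAlgebra A L) :
    deRham k A L M (a • ω) x = a • deRham k A L M ω x + ω (contractD a x) :=
  deRhamEval_smul_form x a ω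

/-- Cartan's formula for vector fields. -/
theorem contraction_deRham (Z : L) (ω : Forms A L M) :
    contraction k A L M (ι A Z) (deRham k A L M ω)
      = lieForm k M Z ω - deRham k A L M (contraction k A L M (ι A Z) ω) :=
  LinearMap.ext fun x => deRham_ι_mul Z x ω

theorem contraction_lieForm (X Y : L) (ω : Forms A L M) :
    contraction k A L M (ι A Y) (lieForm k M X ω)
      = lieForm k M X (contraction k A L M (ι A Y) ω)
        - contraction k A L M (ι A ⁅X, Y⁆) ω := by
  refine LinearMap.ext fun x => ?_
  rw [LinearMap.sub_apply]
  simp only [contraction_apply, lieForm_apply, lieDer_ι_mul, map_add]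
  abel

theorem lieForm_lie (X Y : L) (ω : Forms A L M) :
    lieForm k M ⁅X, Y⁆ ω = lieForm k M X (lieForm k M Y ω) - lieForm k M Y (lieForm k M X ω) := by
  refine LinearMap.ext fun x => ?_
  have h : VL.ofL k A L ⁅X, Y⁆ • ω x = VL.ofL k A L X • VL.ofL k A L Y • ω x
      - VL.ofL k A L Y • VL.ofL k A L X • ω x := by
    rw [← mul_smul, ← mul_smul, ← sub_smul, ← VL.ofL_lie, add_sub_cancel_right]
  rw [LinearMap.sub_apply]
  simp only [lieForm_apply, lieDer_lie, map_sub, smul_sub, h]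
  abel

/-- Cartan's formula on both sides reduces the step to `[L_X, L_Z] = L_[X,Z]` and to the induction
hypothesis for `ι_Z ω`; this is why the form must vary in the induction. -/
theorem deRham_lieForm_apply (X : L) (x : ExteriorAlgebra A L) (ω : Forms A L M) :
    deRham k A L M (lieForm k M X ω) x = lieForm k M X (deRham k A L M ω) x := by
  induction x using exterior_induction generalizing ω with
  | algebraMap a =>
    rw [deRham_algebraMap, lieForm_apply, lieDer_algebraMap, deRham_algebraMap, deRham_algebraMap,
      smul_zero, sub_zero]
  | add x y hx hy => rw [map_add, map_add, hx, hy]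
  | ι_mul Z x hx =>
    have h1 : lieForm k M X (deRham k A L M ω) (ι A Z * x)
        = contraction k A L M (ι A Z) (lieForm k M X (deRham k A L M ω)) x := rfl
    rw [deRham_ι_mul, contraction_lieForm, h1, contraction_lieForm, map_sub,
      LinearMap.sub_apply, LinearMap.sub_apply, hx, contraction_deRham, contraction_deRham,
      lieForm_lie, map_sub]
    simp only [LinearMap.sub_apply]
    abel

theorem deRham_lieForm (X : L) (ω : Forms A L M) :
    deRham k A L M (lieForm k M X ω) = lieForm k M X (deRham k A L M ω) :=
  LinearMap.ext fun x => deRham_lieForm_apply X x ω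

/-- By Cartan's formula and `deRham_lieForm`, evaluating `d²ω` on `Z ∧ x` gives `d²(ι_Z ω)` on `x`.
-/
theorem deRham_deRham_apply (x : ExteriorAlgebra A L) (ω : Forms A L M) :
    deRham k A L M (deRham k A L M ω) x = 0 := by
  induction x using exterior_induction generalizing ω with
  | algebraMap a => rw [deRham_algebraMap]
  | add x y hx hy => rw [map_add, hx, hy, add_zero]
  | ι_mul Z x hx =>
    rw [deRham_ι_mul, contraction_deRham, map_sub, LinearMap.sub_apply, hx, deRham_lieForm]
    simp

theorem deRham_deRham (ω : Forms A L M) : deRham k A L M (deRham k A L M ω) = 0 :=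
  LinearMap.ext fun x => deRham_deRham_apply x ω

/-- The Lie derivative along the first vector field produces its own term and all pairs containing
it; the remaining terms come from the differential of the contraction. -/
theorem deRham_ιMulti (ω : Forms A L M) {n : ℕ} (X : Fin n → L) :
    deRham k A L M ω (ιMulti A n X) =
      ∑ i : Fin n, (-1 : ℤ) ^ (i : ℕ) • (VL.ofL k A L (X i) • ω (wedgeOmit {i} X))
      + ∑ i : Fin n, ∑ j ∈ Finset.Ioi i, (-1 : ℤ) ^ ((i : ℕ) + (j : ℕ)) •
          ω (ι A ⁅X i, X j⁆ * wedgeOmit {i, j} X) := by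
  induction n generalizing ω with
  | zero => simp [deRham_one]
  | succ n ih =>
    rw [ιMulti_succ, deRham_ι_mul, ih, lieForm_apply, lieDer_ιMulti, Fin.sum_univ_succ,
      sum_Ioi_succ, wedgeOmit_singleton_zero, map_sum]
    simp only [wedgeOmit_singleton_succ, wedgeOmit_pair_zero_succ, wedgeOmit_pair_succ_succ,
      contraction_apply, Fin.val_zero, pow_zero, one_smul, Fin.val_succ, zero_add, map_zsmul]
    have e1 : ∀ i : Fin n, (-1 : ℤ) ^ ((i : ℕ) + 1) • (VL.ofL k A L (X i.succ) •
        ω (ι A (X 0) * wedgeOmit {i} (Fin.tail X))) = -((-1 : ℤ) ^ (i : ℕ) •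
          (VL.ofL k A L (Fin.tail X i) • ω (ι A (X 0) * wedgeOmit {i} (Fin.tail X)))) := fun i => by
      rw [pow_succ, mul_neg_one, neg_smul]; rfl
    have e2 : ∀ i : Fin n, (-1 : ℤ) ^ ((i : ℕ) + 1) •
        ω (ι A ⁅X 0, X i.succ⁆ * wedgeOmit {i} (Fin.tail X)) = -((-1 : ℤ) ^ (i : ℕ) •
          ω (ι A ⁅X 0, Fin.tail X i⁆ * wedgeOmit {i} (Fin.tail X))) := fun i => by
      rw [pow_succ, mul_neg_one, neg_smul]; rfl
    -- Two index shifts leave the sign unchanged; moving the first vector field past the bracket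
    -- gives the minus sign.
    have e3 : ∀ i j : Fin n, (-1 : ℤ) ^ ((i : ℕ) + 1 + ((j : ℕ) + 1)) •
        ω (ι A ⁅X i.succ, X j.succ⁆ * (ι A (X 0) * wedgeOmit {i, j} (Fin.tail X)))
          = -((-1 : ℤ) ^ ((i : ℕ) + (j : ℕ)) •
          ω (ι A (X 0) * (ι A ⁅Fin.tail X i, Fin.tail X j⁆ * wedgeOmit {i, j} (Fin.tail X)))) :=
      fun i j => by
        rw [← mul_assoc, ι_mul_ι, neg_mul, map_neg, smul_neg, mul_assoc,
          show (i : ℕ) + 1 + ((j : ℕ) + 1) = (i : ℕ) + (j : ℕ) + 2 by ring, pow_add]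
        simp [Fin.tail]
    simp only [e1, e2, e3, Finset.sum_neg_distrib]
    abel

variable (k A L M) in
theorem isDeRhamDifferential_deRham : IsDeRhamDifferential (deRham k A L M) :=
  fun ω _ X => deRham_ιMulti ω X

theorem form_ext {ω η : Forms A L M} (h : ∀ n (X : Fin n → L), ω (ιMulti A n X) = η (ιMulti A n X)) :
    ω = η := ExteriorAlgebra.lhom_ext fun n => AlternatingMap.ext fun X => h n X

theorem IsDeRhamDifferential.unique {d d' : Module.End k (Forms A L M)}
    (h : IsDeRhamDifferential d) (h' : IsDeRhamDifferential d') : d = d' :=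
  LinearMap.ext fun ω => form_ext fun n X => by rw [h, h']

end DeRham

/-! ### The calculus -/

section Calculus

variable {k A L : Type*} [CommRing k] [CommRing A] [Algebra k A] [LieRing L] [LieAlgebra k L]
  [Module A L] [LieRingModule L A] [LieRinehartRing A L] [LieRinehartAlgebra k A L]
variable {M : Type*} [AddCommGroup M] [Module k M] [Module A M] [IsScalarTower k A M]
  [Module (VL k A L) M] [IsScalarTower A (VL k A L) M]

theorem contraction_mul (y z : ExteriorAlgebra A L) (ω : Forms A L M) :
    contraction k A L M (y * z) ω = contraction k A L M z (contraction k A L M y ω) :=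
  LinearMap.ext fun x => by simp only [contraction_apply, mul_assoc]

theorem contraction_algebraMap (a : A) (ω : Forms A L M) :
    contraction k A L M (algebraMap A _ a) ω = a • ω :=
  LinearMap.ext fun x => by
    rw [contraction_apply, ← Algebra.smul_def, map_smul, LinearMap.smul_apply]

variable (k A L M) in
/-- The Lie derivative of forms along multivector fields, the graded commutator of the differential
with the contraction. -/
def lieDerivative : ExteriorAlgebra A L →ₗ[k] Module.End k (Forms A L M) :=
  LinearMap.mk₂ k
    (fun y ω => deRham k A L M (contraction k A L M y ω)
      - contraction k A L M (sgn y) (deRham k A L M ω))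
    (fun y z ω => by simp only [map_add, LinearMap.add_apply]; abel)
    (fun r y ω => by
      have : sgn (r • y) = r • sgn y := by
        rw [← algebraMap_smul A r y, map_smul, algebraMap_smul]
      simp only [this, map_smul, LinearMap.smul_apply, smul_sub])
    (fun y ω η => by simp only [map_add]; abel)
    (fun r y ω => by simp only [map_smul, smul_sub])

theorem lieDerivative_apply (y : ExteriorAlgebra A L) (ω : Forms A L M) :
    lieDerivative k A L M y ω = deRham k A L M (contraction k A L M y ω)
      - contraction k A L M (sgn y) (deRham k A L M ω) := rfl

theorem lieDerivative_algebraMap_apply (a : A) (ω : Forms A L M) (x : ExteriorAlgebra A L) :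
    lieDerivative k A L M (algebraMap A _ a) ω x = ω (contractD a x) := by
  rw [lieDerivative_apply, AlgHom.commutes, contraction_algebraMap, contraction_algebraMap,
    LinearMap.sub_apply, deRham_smul_form, LinearMap.smul_apply, add_sub_cancel_left]

theorem lieDerivative_one (ω : Forms A L M) : lieDerivative k A L M 1 ω = 0 :=
  LinearMap.ext fun x => by
    rw [← map_one (algebraMap A _), lieDerivative_algebraMap_apply,
      ← map_one (algebraMap k A), contractD_algebraMap_scalar, map_zero, LinearMap.zero_apply]

/-- Expanding `[d, ι_z ι_Z]` by the graded Leibniz rule for commutators, with `[d, ι_Z] = L_Z`. This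
recursion drives the explicit formula and the commutation relations. -/
theorem lieDerivative_ι_mul (Z : L) (z : ExteriorAlgebra A L) (ω : Forms A L M) :
    lieDerivative k A L M (ι A Z * z) ω
      = lieDerivative k A L M z (contraction k A L M (ι A Z) ω)
        + contraction k A L M (sgn z) (lieForm k M Z ω) := by
  rw [lieDerivative_apply, lieDerivative_apply, map_mul (sgn (A := A) (L := L)), sgn_ι, neg_mul, map_neg,
    LinearMap.neg_apply, contraction_mul, contraction_mul, contraction_deRham, map_sub]
  abel

/-- Stated for arbitrary `x`, with the middle sum expressed through `lieDer`, so that the comparison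
with cochains can use it before any expansion in the slots of `x`. -/
theorem lieDerivative_ιMulti_apply {p : ℕ} (Y : Fin p → L) (ω : Forms A L M)
    (x : ExteriorAlgebra A L) :
    lieDerivative k A L M (ιMulti A p Y) ω x =
      (-1 : ℤ) ^ (p + 1) •
        (∑ i : Fin p, (-1 : ℤ) ^ (i : ℕ) • (VL.ofL k A L (Y i) • ω (wedgeOmit {i} Y * x))
          + ∑ j : Fin p, (-1 : ℤ) ^ ((j : ℕ) + 1) • ω (wedgeOmit {j} Y * lieDer (Y j) x)
          + ∑ i : Fin p, ∑ j ∈ Finset.Ioi i, (-1 : ℤ) ^ ((i : ℕ) + (j : ℕ)) •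
            ω (ι A ⁅Y i, Y j⁆ * wedgeOmit {i, j} Y * x)) := by
  induction p generalizing ω with
  | zero => simp [lieDerivative_one]
  | succ n ih =>
    have e1 : ∀ i : Fin n, (-1 : ℤ) ^ ((i : ℕ) + 1) • (VL.ofL k A L (Y i.succ) •
        ω (ι A (Y 0) * wedgeOmit {i} (Fin.tail Y) * x)) = -((-1 : ℤ) ^ (i : ℕ) •
          (VL.ofL k A L (Fin.tail Y i) • ω (ι A (Y 0) * (wedgeOmit {i} (Fin.tail Y) * x)))) :=
      fun i => by rw [pow_succ, mul_neg_one, neg_smul, mul_assoc]; rfl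
    have e2 : ∀ i : Fin n, (-1 : ℤ) ^ ((i : ℕ) + 1 + 1) •
        ω (ι A (Y 0) * wedgeOmit {i} (Fin.tail Y) * lieDer (Y i.succ) x)
          = -((-1 : ℤ) ^ ((i : ℕ) + 1) •
          ω (ι A (Y 0) * (wedgeOmit {i} (Fin.tail Y) * lieDer (Fin.tail Y i) x))) := fun i => by
      rw [pow_succ, mul_neg_one, neg_smul, mul_assoc]; rfl
    have e3 : ∀ i j : Fin n, (-1 : ℤ) ^ ((i : ℕ) + 1 + ((j : ℕ) + 1)) •
        ω (ι A ⁅Y i.succ, Y j.succ⁆ * (ι A (Y 0) * wedgeOmit {i, j} (Fin.tail Y)) * x)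
          = -((-1 : ℤ) ^ ((i : ℕ) + (j : ℕ)) •
          ω (ι A (Y 0) * (ι A ⁅Fin.tail Y i, Fin.tail Y j⁆ * wedgeOmit {i, j} (Fin.tail Y) * x))) :=
      fun i j => by
        rw [← mul_assoc, ι_mul_ι, neg_mul, neg_mul, map_neg, smul_neg, mul_assoc, mul_assoc,
          ← mul_assoc (ι A ⁅_, _⁆),
          show (i : ℕ) + 1 + ((j : ℕ) + 1) = (i : ℕ) + (j : ℕ) + 2 by ring, pow_add]
        simp [Fin.tail]
    have e4 : ∀ i : Fin n, (-1 : ℤ) ^ ((i : ℕ) + 1) •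
        ω (ι A ⁅Y 0, Y i.succ⁆ * wedgeOmit {i} (Fin.tail Y) * x) = -((-1 : ℤ) ^ (i : ℕ) •
          ω (ι A ⁅Y 0, Fin.tail Y i⁆ * wedgeOmit {i} (Fin.tail Y) * x)) := fun i => by
      rw [pow_succ, mul_neg_one, neg_smul]; rfl
    rw [ιMulti_succ, lieDerivative_ι_mul, LinearMap.add_apply, ih, contraction_apply, lieForm_apply,
      sgn_of_mem (ιMulti_mem _), smul_mul_assoc, map_zsmul, map_zsmul, map_zsmul, smul_comm, ← smul_sub,
      lieDer_mul, map_add, lieDer_ιMulti, Finset.sum_mul, map_sum, Fin.sum_univ_succ,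
      Fin.sum_univ_succ, sum_Ioi_succ]
    simp only [wedgeOmit_singleton_zero, wedgeOmit_singleton_succ, wedgeOmit_pair_zero_succ,
      wedgeOmit_pair_succ_succ, contraction_apply, Fin.val_zero, pow_zero, one_smul, Fin.val_succ,
      zero_add, map_zsmul, e1, e2, e3, e4, Finset.sum_neg_distrib, smul_mul_assoc, pow_one]
    rw [pow_succ _ (n + 1), pow_succ _ n]
    simp only [mul_neg, mul_one, neg_neg, neg_smul, one_smul, smul_add, smul_neg, smul_sub]
    abel

variable (k A L M) in
theorem isLieDerivative_lieDerivative : IsLieDerivative (lieDerivative k A L M) := by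
  refine ⟨fun p m Y X ω => ?_, fun a m X ω => ?_⟩
  · rw [lieDerivative_ιMulti_apply]
    simp only [lieDer_ιMulti_update, Finset.mul_sum, map_sum, Finset.smul_sum]
  · rw [lieDerivative_algebraMap_apply, contractD_ιMulti, map_sum]
    simp only [map_zsmul, map_smul]

theorem IsLieDerivative.unique {lie lie' : ExteriorAlgebra A L →ₗ[k] Module.End k (Forms A L M)}
    (h : IsLieDerivative lie) (h' : IsLieDerivative lie') : lie = lie' := by
  refine LinearMap.ext fun y => LinearMap.ext fun ω => ?_
  induction y using ιMulti_induction with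
  | algebraMap a => exact form_ext fun m X => by rw [h.2, h'.2]
  | add y z hy hz => rw [map_add, map_add, LinearMap.add_apply, LinearMap.add_apply, hy, hz]
  | ιMulti p Y => exact form_ext fun m X => by rw [h.1, h'.1]

theorem contraction_lieForm_general (y : ExteriorAlgebra A L) (Z : L) (ω : Forms A L M) :
    contraction k A L M y (lieForm k M Z ω)
      = lieForm k M Z (contraction k A L M y ω) - contraction k A L M (lieDer Z y) ω := by
  refine LinearMap.ext fun x => ?_
  rw [LinearMap.sub_apply]
  simp only [contraction_apply, lieForm_apply, lieDer_mul, map_add]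
  abel

/-- Induction on `z`. For a function it is the antiderivation property of `ι_{da}`; for `Z ∧ z` the
extra terms come from `L_Z` differentiating `y`, and they are the ones in the recursion for `[Z ∧ z,
y]`. -/
theorem contraction_lieDerivative {p q : ℕ} {y z : ExteriorAlgebra A L} (hy : y ∈ ⋀[A]^p L)
    (hz : z ∈ ⋀[A]^q L) (ω : Forms A L M) :
    contraction k A L M y (lieDerivative k A L M z ω)
      = (-1 : ℤ) ^ (p * (q + 1)) • lieDerivative k A L M z (contraction k A L M y ω)
        - contraction k A L M (schouten z y) ω := by
  induction hz using homogeneous_induction generalizing ω with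
  | algebraMap a =>
    refine LinearMap.ext fun x => ?_
    rw [LinearMap.sub_apply, LinearMap.smul_apply, lieDerivative_algebraMap_apply,
      contraction_apply, contraction_apply, contraction_apply, lieDerivative_algebraMap_apply,
      contractD_mul, schouten_algebraMap, sgn_of_mem hy, neg_mul, map_neg, map_add, smul_mul_assoc,
      map_zsmul, zero_add, mul_one]
    abel
  | add n z w _ _ hz hw =>
    simp only [map_add, LinearMap.add_apply, AddMonoidHom.add_apply, hz, hw, smul_add]
    abel
  | ι_mul n Z z hz h =>
    have hsz : sgn z ∈ ⋀[A]^n L := by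
      rw [sgn_of_mem hz]; exact Submodule.smul_of_tower_mem _ _ hz
    rw [lieDerivative_ι_mul, lieDerivative_ι_mul, map_add, h, ← contraction_mul (ι A Z) y,
      ← contraction_mul (sgn z) y, exterior_mul_comm (ι_mem Z) hy, exterior_mul_comm hsz hy,
      schouten_ι_mul, map_add, LinearMap.add_apply, map_zsmul, map_zsmul, LinearMap.smul_apply,
      LinearMap.smul_apply, map_zsmul, contraction_mul y, contraction_mul y,
      contraction_lieForm_general, map_sub, contraction_mul (ι A Z), ← contraction_mul (lieDer Z y),
      exterior_mul_comm (lieDer_mem Z hy) hsz, map_zsmul, LinearMap.smul_apply]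
    rcases neg_one_pow_eq_or ℤ n with hn | hn <;> rcases neg_one_pow_eq_or ℤ p with hp | hp <;>
      simp only [pow_add, pow_mul, pow_one, hn, hp, one_pow, mul_one, one_mul, mul_neg, neg_neg,
        one_smul, neg_smul, neg_mul, smul_sub, smul_neg, smul_add] <;> abel

theorem deRham_lieDerivative {q : ℕ} {z : ExteriorAlgebra A L} (hz : z ∈ ⋀[A]^q L)
    (ω : Forms A L M) :
    deRham k A L M (lieDerivative k A L M z ω)
      = (-1 : ℤ) ^ (q + 1) • lieDerivative k A L M z (deRham k A L M ω) := by
  rw [lieDerivative_apply, lieDerivative_apply, map_sub, deRham_deRham, deRham_deRham, map_zero,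
    sgn_of_mem hz, map_zsmul, LinearMap.smul_apply, map_zsmul, pow_succ, mul_neg_one, neg_smul,
    sub_zero, zero_sub]

theorem lieDerivative_of_mem {p : ℕ} {y : ExteriorAlgebra A L} (hy : y ∈ ⋀[A]^p L)
    (ω : Forms A L M) :
    lieDerivative k A L M y ω = deRham k A L M (contraction k A L M y ω)
      - (-1 : ℤ) ^ p • contraction k A L M y (deRham k A L M ω) := by
  rw [lieDerivative_apply, sgn_of_mem hy, map_zsmul, LinearMap.smul_apply]

/-- Formal: take the graded commutator of `d` with `contraction_lieDerivative`, using that `d`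
graded commutes with every Lie derivative. -/
theorem lieDerivative_schouten {p q : ℕ} {y z : ExteriorAlgebra A L} (hy : y ∈ ⋀[A]^p L)
    (hz : z ∈ ⋀[A]^q L) (ω : Forms A L M) :
    -lieDerivative k A L M (schouten z y) ω
      = lieDerivative k A L M y (lieDerivative k A L M z ω)
        - (-1 : ℤ) ^ ((p + 1) * (q + 1)) •
          lieDerivative k A L M z (lieDerivative k A L M y ω) := by
  have hB : ∀ η : Forms A L M, contraction k A L M (schouten z y) η
      = (-1 : ℤ) ^ (p * (q + 1)) • lieDerivative k A L M z (contraction k A L M y η)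
        - contraction k A L M y (lieDerivative k A L M z η) := fun η => by
    rw [contraction_lieDerivative hy hz, sub_sub_cancel]
  have hs : sgn (schouten z y) = -((-1 : ℤ) ^ (p + q) • schouten z y) := by
    rw [sgn_schouten, sgn_of_mem hy, sgn_of_mem hz, map_zsmul, map_zsmul, AddMonoidHom.smul_apply,
      smul_smul, ← pow_add]
  rw [lieDerivative_apply (schouten z y), hs, map_neg, LinearMap.neg_apply, map_zsmul,
    LinearMap.smul_apply, hB, hB, map_sub, map_zsmul, deRham_lieDerivative hz,
    lieDerivative_of_mem hy (lieDerivative k A L M z ω), deRham_lieDerivative hz,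
    lieDerivative_of_mem hy ω, map_sub, map_zsmul, map_zsmul]
  rcases neg_one_pow_eq_or ℤ p with hp | hp <;> rcases neg_one_pow_eq_or ℤ q with hq | hq <;>
    simp only [pow_add, pow_mul, pow_one, hp, hq, one_pow, mul_one, one_mul, mul_neg, neg_neg,
      one_smul, neg_smul, neg_mul, smul_sub, smul_neg, smul_add] <;> abel

theorem contraction_mem {p m : ℕ} {y : ExteriorAlgebra A L} {ω : Forms A L M}
    (hy : y ∈ ⋀[A]^p L) (hω : ω ∈ formDegree k A L M (p + m)) :
    contraction k A L M y ω ∈ formDegree k A L M m := fun l hl x hx => by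
  rw [contraction_apply]
  exact hω (p + l) (by omega) _ (mul_mem_exteriorPower hy hx)

theorem contraction_eq_zero {p n : ℕ} {y : ExteriorAlgebra A L} {ω : Forms A L M} (h : n < p)
    (hy : y ∈ ⋀[A]^p L) (hω : ω ∈ formDegree k A L M n) :
    contraction k A L M y ω = 0 := form_ext fun l X => by
  rw [contraction_apply]
  exact hω (p + l) (by omega) _ (mul_mem_exteriorPower hy (ιMulti_mem X))

theorem deRham_mem {n : ℕ} {ω : Forms A L M} (hω : ω ∈ formDegree k A L M n) :
    deRham k A L M ω ∈ formDegree k A L M (n + 1) := fun m hm x hx => by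
  induction hx using homogeneous_induction generalizing n ω with
  | algebraMap a => exact deRham_algebraMap a ω
  | add m x y _ _ hx hy => rw [map_add, hx hω hm, hy hω hm, add_zero]
  | ι_mul m Z x hx h =>
    have hmn : m ≠ n := by omega
    rw [deRham_ι_mul, lieForm_apply, hω m hmn _ hx, hω m hmn _ (lieDer_mem Z hx), smul_zero,
      sub_zero, zero_sub, neg_eq_zero]
    -- The induction hypothesis is applied to `ι_Z ω`, of degree one less; for a form of degree zero
    -- this contraction is zero.
    cases n with
    | zero =>
      rw [contraction_eq_zero Nat.zero_lt_one (ι_mem Z) hω, map_zero, LinearMap.zero_apply]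
    | succ n => exact h (contraction_mem (ι_mem Z) (by rwa [add_comm])) (by omega)

theorem lieDerivative_mem {p m n : ℕ} {y : ExteriorAlgebra A L} {ω : Forms A L M}
    (h : n + 1 = p + m) (hy : y ∈ ⋀[A]^p L) (hω : ω ∈ formDegree k A L M n) :
    lieDerivative k A L M y ω ∈ formDegree k A L M m := by
  rw [lieDerivative_of_mem hy]
  refine Submodule.sub_mem _ ?_ (Submodule.smul_of_tower_mem _ _
    (contraction_mem hy (h ▸ deRham_mem hω)))
  -- For `m = 0` one has `n + 1 = p`, so `ι_y ω` vanishes for degree reasons and only the other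
  -- summand of the commutator remains.
  cases m with
  | zero =>
    rw [contraction_eq_zero (by omega) hy hω, map_zero]
    exact Submodule.zero_mem _
  | succ m =>
    obtain rfl : n = p + m := by omega
    exact deRham_mem (contraction_mem hy hω)

theorem lieDerivative_eq_zero {p n : ℕ} {y : ExteriorAlgebra A L} {ω : Forms A L M}
    (h : n + 1 < p) (hy : y ∈ ⋀[A]^p L) (hω : ω ∈ formDegree k A L M n) :
    lieDerivative k A L M y ω = 0 := by
  rw [lieDerivative_of_mem hy, contraction_eq_zero (by omega) hy hω,
    contraction_eq_zero h hy (deRham_mem hω), map_zero, smul_zero, sub_zero]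

variable (k A L M) in
theorem isNoncommutativeCalculus :
    IsNoncommutativeCalculus (vectorDegree k A L) (wedge k A L).flip (-(schoutenBilin k A L).flip)
      (formDegree k A L M) (deRham k A L M) (contraction k A L M) (lieDerivative k A L M) where
  gerstenhaber := (isGerstenhaberAlgebra_schoutenBilin k A L).opposite
  B_mem hω := deRham_mem hω
  B_sq ω := deRham_deRham ω
  con_mem hy hω := contraction_mem hy hω
  con_zero h hy hω := contraction_eq_zero h hy hω
  lie_mem h hy hω := lieDerivative_mem h hy hω
  lie_zero h hy hω := lieDerivative_eq_zero h hy hω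
  con_mul y z ω := contraction_mul z y ω
  lie_br {p q y z} hy hz ω := by
    rw [← lieDerivative_schouten hy hz]
    simp only [LinearMap.neg_apply, LinearMap.flip_apply, map_neg, schoutenBilin_apply]
  con_lie {p q y z} hy hz ω := by
    rw [contraction_lieDerivative hy hz]
    simp only [LinearMap.neg_apply, LinearMap.flip_apply, map_neg, schoutenBilin_apply]
    abel
  lie_eq hy ω := lieDerivative_of_mem hy ω

end Calculus

/-! ### Comparison with the operators on cochains -/

section Comparison

variable {k A L : Type*} [CommRing k] [CommRing A] [Algebra k A] [LieRing L] [LieAlgebra k L]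
  [Module A L] [LieRingModule L A] [LieRinehartRing A L] [LieRinehartAlgebra k A L]

/-- An alternating function is its own antisymmetrisation. -/
theorem antisymmetrisation_eq [Algebra ℚ k] {N : Type*} [AddCommGroup N] [Module A N] {n : ℕ}
    (G : (Fin n → L) → N) (X : Fin n → L)
    (hG : ∀ σ : Equiv.Perm (Fin n), G (fun i => X (σ i)) = Equiv.Perm.sign σ • G X) :
    algebraMap k A (algebraMap ℚ k (1 / (n.factorial : ℚ))) •
      ∑ σ : Equiv.Perm (Fin n), Equiv.Perm.sign σ • G (fun i => X (σ i)) = G X := by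
  have h : ∀ σ : Equiv.Perm (Fin n), Equiv.Perm.sign σ • G (fun i => X (σ i)) = G X := fun σ => by
    rw [hG, smul_smul, Int.units_mul_self, one_smul]
  rw [Finset.sum_congr rfl fun σ _ => h σ, Finset.sum_const, Finset.card_univ, Fintype.card_perm,
    Fintype.card_fin, ← Nat.cast_smul_eq_nsmul A, smul_smul]
  have : (n.factorial : A) = algebraMap k A (algebraMap ℚ k (n.factorial : ℚ)) := by simp
  rw [this, ← map_mul, ← map_mul, one_div, inv_mul_cancel₀ (by exact_mod_cast n.factorial_ne_zero),
    map_one, map_one, one_smul]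

theorem ιMulti_perm {n : ℕ} (X : Fin n → L) (σ : Equiv.Perm (Fin n)) :
    ιMulti A n (fun i => X (σ i)) = Equiv.Perm.sign σ • ιMulti A n X :=
  AlternatingMap.map_perm _ X σ

theorem altMap_apply [Algebra ℚ k] {p : ℕ} (Y : Fin p → L) :
    altMap k A L p Y = algebraMap k A (algebraMap ℚ k (1 / (p.factorial : ℚ))) •
      ∑ σ : Equiv.Perm (Fin p), Equiv.Perm.sign σ •
        PiTensorProduct.tprod A fun i => VL.ofL k A L (Y (σ i)) := by
  rw [altMap, AlternatingMap.smul_apply, MultilinearMap.alternatization_apply]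
  rfl

theorem alt_ιMulti [Algebra ℚ k] {p : ℕ} (Y : Fin p → L) :
    alt k A L p (exteriorPower.ιMulti A p Y) = altMap k A L p Y :=
  exteriorPower.alternatingMapLinearEquiv_apply_ιMulti _ Y

theorem altTotal_ιMulti [Algebra ℚ k] {n : ℕ} (X : Fin n → L) :
    altTotal k A L (ιMulti A n X) = TensorPower.toTensorAlgebra (altMap k A L n X) :=
  ExteriorAlgebra.liftAlternating_apply_ιMulti _ X

theorem altTotal_ιMulti_eq_sum [Algebra ℚ k] {n : ℕ} (X : Fin n → L) :
    altTotal k A L (ιMulti A n X) = algebraMap k A (algebraMap ℚ k (1 / (n.factorial : ℚ))) •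
      ∑ σ : Equiv.Perm (Fin n), Equiv.Perm.sign σ •
        TensorAlgebra.tprod A (VL k A L) n fun i => VL.ofL k A L (X (σ i)) := by
  rw [altTotal_ιMulti, altMap_apply, map_smul, map_sum]
  simp only [Units.smul_def, map_zsmul, TensorPower.toTensorAlgebra_tprod]

theorem altTotal_coe [Algebra ℚ k] {p : ℕ} (y : ⋀[A]^p L) :
    altTotal k A L y = TensorPower.toTensorAlgebra (alt k A L p y) := by
  have : (altTotal k A L) ∘ₗ (⋀[A]^p L).subtype
      = TensorPower.toTensorAlgebra ∘ₗ alt k A L p := by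
    refine exteriorPower.linearMap_ext (AlternatingMap.ext fun Y => ?_)
    change altTotal k A L (ιMulti A p Y)
      = TensorPower.toTensorAlgebra (alt k A L p (exteriorPower.ιMulti A p Y))
    rw [altTotal_ιMulti, alt_ιMulti]
  exact LinearMap.congr_fun this y

variable (k A L) in
/-- The tensors all of whose entries are vector fields. -/
def vectorTensors : Subalgebra A (TVL k A L) :=
  Algebra.adjoin A (Set.range fun X : L => TensorAlgebra.ι A (VL.ofL k A L X))

theorem ι_mem_vectorTensors (X : L) :
    TensorAlgebra.ι A (VL.ofL k A L X) ∈ vectorTensors k A L := Algebra.subset_adjoin ⟨X, rfl⟩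

theorem tprod_mem_vectorTensors {n : ℕ} (X : Fin n → L) :
    TensorAlgebra.tprod A (VL k A L) n (fun i => VL.ofL k A L (X i)) ∈ vectorTensors k A L := by
  rw [TensorAlgebra.tprod_apply]
  refine list_prod_mem fun t ht => ?_
  obtain ⟨i, rfl⟩ := List.mem_ofFn.mp ht
  exact ι_mem_vectorTensors (X i)

theorem prodWhere_mem_vectorTensors {n : ℕ} (P : Fin n → Prop) [DecidablePred P] (X : Fin n → L) :
    prodWhere P (fun i => TensorAlgebra.ι A (VL.ofL k A L (X i))) ∈ vectorTensors k A L := by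
  refine list_prod_mem fun t ht => ?_
  obtain ⟨i, rfl⟩ := List.mem_ofFn.mp ht
  dsimp only
  split_ifs
  · exact ι_mem_vectorTensors (X i)
  · exact one_mem _

theorem altTotal_mem_vectorTensors [Algebra ℚ k] (x : ExteriorAlgebra A L) :
    altTotal k A L x ∈ vectorTensors k A L := by
  induction x using ιMulti_induction with
  | algebraMap a =>
    rw [altTotal, ExteriorAlgebra.liftAlternating_algebraMap]
    refine Subalgebra.smul_mem _ ?_ a
    have := altTotal_ιMulti_eq_sum (k := k) (A := A) (L := L) (n := 0) 0
    change TensorPower.toTensorAlgebra (altMap k A L 0 0) ∈ _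
    rw [← altTotal_ιMulti, this]
    exact Subalgebra.smul_mem _ (sum_mem fun σ _ => by
      rw [Units.smul_def]
      exact zsmul_mem (tprod_mem_vectorTensors _) _) _
  | add x y hx hy => rw [map_add]; exact add_mem hx hy
  | ιMulti n X =>
    rw [altTotal_ιMulti_eq_sum]
    exact Subalgebra.smul_mem _ (sum_mem fun σ _ => by
      rw [Units.smul_def]
      exact zsmul_mem (tprod_mem_vectorTensors _) _) _

variable {pr : VL k A L →ₗ[A] L}

theorem wedgeProj_ι (hpr : ∀ X : L, pr (VL.ofL k A L X) = X) (X : L) :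
    wedgeProj pr (TensorAlgebra.ι A (VL.ofL k A L X)) = ι A X := by
  rw [wedgeProj, TensorAlgebra.lift_ι_apply, LinearMap.comp_apply, hpr]

theorem wedgeProj_tprod (hpr : ∀ X : L, pr (VL.ofL k A L X) = X) {n : ℕ} (X : Fin n → L) :
    wedgeProj pr (TensorAlgebra.tprod A (VL k A L) n fun i => VL.ofL k A L (X i))
      = ιMulti A n X := by
  rw [TensorAlgebra.tprod_apply, map_list_prod, List.map_ofFn, ExteriorAlgebra.ιMulti_apply]
  congr 2
  funext i
  exact wedgeProj_ι hpr (X i)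

theorem wedgeProj_prodWhere (hpr : ∀ X : L, pr (VL.ofL k A L X) = X) {n : ℕ}
    (P : Fin n → Prop) [DecidablePred P] (X : Fin n → L) :
    wedgeProj pr (prodWhere P fun i => TensorAlgebra.ι A (VL.ofL k A L (X i)))
      = prodWhere P fun i => ι A (X i) := by
  rw [prodWhere, prodWhere, map_list_prod, List.map_ofFn]
  congr 2
  funext i
  dsimp only [Function.comp_apply]
  split_ifs
  · exact wedgeProj_ι hpr (X i)
  · exact map_one _

theorem wedgeProj_altTotal [Algebra ℚ k] (hpr : ∀ X : L, pr (VL.ofL k A L X) = X)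
    (x : ExteriorAlgebra A L) : wedgeProj pr (altTotal k A L x) = x := by
  have : (wedgeProj pr).toLinearMap ∘ₗ altTotal k A L = LinearMap.id :=
    form_ext fun n X => by
      rw [LinearMap.comp_apply, altTotal_ιMulti_eq_sum, map_smul, map_sum]
      simp only [Units.smul_def, map_zsmul, AlgHom.toLinearMap_apply, wedgeProj_tprod hpr]
      exact antisymmetrisation_eq (k := k) (fun X => ιMulti A n X) X fun σ => ιMulti_perm X σ
  exact LinearMap.congr_fun this x

/-- The torsion free connection `Z ↦ pr (X Z)`, extended to multivector fields. -/
def projDer (hpr : ∀ X : L, pr (VL.ofL k A L X) = X) (X : L) :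
    ExteriorAlgebra A L →+ ExteriorAlgebra A L :=
  derAlong X (AddMonoidHom.mk' (fun Z => pr (VL.ofL k A L X * VL.ofL k A L Z)) fun Y Z => by
      rw [map_add, mul_add, map_add]) fun a Z => by
    have : VL.ofL k A L X * VL.ofL k A L (a • Z)
        = a • (VL.ofL k A L X * VL.ofL k A L Z) + ⁅X, a⁆ • VL.ofL k A L Z := by
      rw [map_smul, VL.smul_eq, ← mul_assoc, VL.ofL_mul_ofA, add_mul, VL.smul_eq, VL.smul_eq,
        mul_assoc]
    change pr (VL.ofL k A L X * VL.ofL k A L (a • Z)) = _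
    rw [this, map_add, map_smul, map_smul, hpr]
    rfl

/-- Torsion freeness of `∇_X Z = pr (X Z)`: the commutator `XY - YX` in the enveloping algebra
already lies in `L`, where `pr` is the identity. This is the only link between `pr` and the bracket.
-/
theorem pr_mul_sub (hpr : ∀ X : L, pr (VL.ofL k A L X) = X) (X Y : L) :
    pr (VL.ofL k A L X * VL.ofL k A L Y) - pr (VL.ofL k A L Y * VL.ofL k A L X) = ⁅X, Y⁆ := by
  rw [← map_sub, ← VL.ofL_lie, add_sub_cancel_right, hpr]

theorem projDer_ι_mul (hpr : ∀ X : L, pr (VL.ofL k A L X) = X) (X Z : L)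
    (x : ExteriorAlgebra A L) : projDer hpr X (ι A Z * x)
      = ι A (pr (VL.ofL k A L X * VL.ofL k A L Z)) * x + ι A Z * projDer hpr X x :=
  derAlong_ι_mul _ _ _ Z x

theorem projDer_mul (hpr : ∀ X : L, pr (VL.ofL k A L X) = X) (X : L)
    (x y : ExteriorAlgebra A L) :
    projDer hpr X (x * y) = projDer hpr X x * y + x * projDer hpr X y := derAlong_mul _ _ _ x y

theorem projDer_mem (hpr : ∀ X : L, pr (VL.ofL k A L X) = X) (X : L) {n : ℕ}
    {x : ExteriorAlgebra A L} (hx : x ∈ ⋀[A]^n L) : projDer hpr X x ∈ ⋀[A]^n L :=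
  derAlong_mem _ _ _ hx

theorem projDer_ιMulti (hpr : ∀ X : L, pr (VL.ofL k A L X) = X) (X : L) {n : ℕ} (Y : Fin n → L) :
    projDer hpr X (ιMulti A n Y) = ∑ i : Fin n, (-1 : ℤ) ^ (i : ℕ) •
      (ι A (pr (VL.ofL k A L X * VL.ofL k A L (Y i))) * wedgeOmit {i} Y) :=
  derAlong_ιMulti _ _ _ Y

/-- Both sides are derivations over the anchor, so generators suffice. The restriction to entries in
`L` matters: for general `v`, the value `pr (X v)` need not be determined by `pr v`. -/
theorem wedgeProj_diagDer (hpr : ∀ X : L, pr (VL.ofL k A L X) = X) (X : L) {t : TVL k A L}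
    (ht : t ∈ vectorTensors k A L) :
    wedgeProj pr (diagDer X t) = projDer hpr X (wedgeProj pr t) := by
  induction ht using Algebra.adjoin_induction with
  | mem t ht =>
    obtain ⟨Z, rfl⟩ := ht
    dsimp only
    rw [diagDer_ι, wedgeProj_ι hpr, projDer, derAlong_ι, wedgeProj, TensorAlgebra.lift_ι_apply]
    rfl
  | algebraMap a =>
    rw [diagDer_algebraMap, AlgHom.commutes, AlgHom.commutes, projDer, derAlong_algebraMap]
  | add s t _ _ hs ht => rw [map_add, map_add, map_add, map_add, hs, ht]
  | mul s t _ _ hs ht => rw [diagDer_mul, map_add, map_mul, map_mul, map_mul, hs, ht, projDer_mul,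
      add_comm]

/-- The factor `w` of degree `p` moves to the front past `i` vector fields. -/
theorem prod_ofFn_replace {p m : ℕ} {w : ExteriorAlgebra A L} (hw : w ∈ ⋀[A]^p L) (X : Fin m → L)
    (i : Fin m) : (List.ofFn fun l => if l = i then w else ι A (X l)).prod
      = (-1 : ℤ) ^ (p * (i : ℕ)) • (w * wedgeOmit {i} X) := by
  induction m with
  | zero => exact i.elim0
  | succ m ih =>
    refine Fin.cases ?_ (fun i => ?_) i
    · rw [wedgeOmit_singleton_zero, List.ofFn_succ, List.prod_cons, ExteriorAlgebra.ιMulti_apply]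
      simp [Fin.tail]
    · rw [wedgeOmit_singleton_succ, List.ofFn_succ, List.prod_cons]
      simp only [Fin.succ_inj, (Fin.succ_ne_zero i).symm, if_false]
      have := ih (Fin.tail X) i
      simp only [Fin.tail] at this
      rw [this, mul_ι_mul hw, smul_smul, ← pow_add, Fin.val_succ, mul_smul_comm, mul_add, mul_one,
        add_assoc, ← two_mul, pow_add, pow_mul _ 2]
      simp [Fin.tail]

/-- The last `i` factors move past `x` and the `p - 1 - i` factors in front, giving `i (m + p - 1 -
i)` transpositions; modulo two this is the stated exponent. -/
theorem prodWhere_sandwich {p m : ℕ} (Y : Fin p → L) (i : Fin p) {x : ExteriorAlgebra A L}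
    (hx : x ∈ ⋀[A]^m L) :
    prodWhere (fun l => i < l) (fun l => ι A (Y l)) *
        (x * prodWhere (fun l => l < i) fun l => ι A (Y l))
      = (-1 : ℤ) ^ ((m + p + 1) * (i : ℕ) + i) • (wedgeOmit {i} Y * x) := by
  induction p generalizing m x with
  | zero => exact i.elim0
  | succ p ih =>
    have hs : ∀ (P : Fin (p + 1) → Prop) [DecidablePred P], prodWhere P (fun l => ι A (Y l))
        = (if P 0 then ι A (Y 0) else 1)
          * prodWhere (fun l => P l.succ) fun l => ι A (Fin.tail Y l) := fun P _ => by
      rw [prodWhere, List.ofFn_succ, List.prod_cons]; rfl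
    refine Fin.cases ?_ (fun i => ?_) i
    · rw [wedgeOmit_singleton_zero, hs, hs]
      simp [prodWhere, ExteriorAlgebra.ιMulti_apply]
    · cases p with
      | zero => exact i.elim0
      | succ p =>
        rw [wedgeOmit_singleton_succ, hs, hs]
        simp only [Fin.succ_lt_succ_iff, Fin.succ_pos, Fin.not_lt_zero, if_true, if_false, one_mul]
        rw [← mul_assoc x, ih (Fin.tail Y) i (mul_mem_exteriorPower hx (ι_mem (Y 0))), ← mul_assoc,
          mul_ι, sgn_of_mem (mul_mem_exteriorPower (wedgeOmit_singleton_mem _ i) hx), mul_smul_comm,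
          smul_smul, ← pow_add, Fin.val_succ, mul_assoc,
          show (m + (p + 1 + 1) + 1) * ((i : ℕ) + 1) + ((i : ℕ) + 1)
            = (m + 1 + (p + 1) + 1) * (i : ℕ) + i + (p + m) + 2 * 2 by ring, pow_add _ _ (2 * 2)]
        simp

/-- The boundary of a product of vector fields, expressed through a torsion free connection. -/
theorem sum_projDer_wedgeOmit (hpr : ∀ X : L, pr (VL.ofL k A L X) = X) {p : ℕ} (Y : Fin p → L) :
    ∑ i : Fin p, (-1 : ℤ) ^ (i : ℕ) • projDer hpr (Y i) (wedgeOmit {i} Y)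
      = -∑ i : Fin p, ∑ j ∈ Finset.Ioi i, (-1 : ℤ) ^ ((i : ℕ) + (j : ℕ)) •
          (ι A ⁅Y i, Y j⁆ * wedgeOmit {i, j} Y) := by
  induction p with
  | zero => simp
  | succ n ih =>
    have ih' := ih (Fin.tail Y)
    -- The pairs `(0, i)` receive `∇_{Y i} Y 0` from the later summands and `∇_{Y 0} Y i` from the
    -- first one, and these combine to `[Y 0, Y i]`. Everything else is `Y 0` times the induction
    -- hypothesis.
    have e1 : ∀ i : Fin n, (-1 : ℤ) ^ ((i : ℕ) + 1) • projDer hpr (Y i.succ)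
        (ι A (Y 0) * wedgeOmit {i} (Fin.tail Y)) = -((-1 : ℤ) ^ (i : ℕ) •
          (ι A (pr (VL.ofL k A L (Fin.tail Y i) * VL.ofL k A L (Y 0))) * wedgeOmit {i} (Fin.tail Y)))
          - ι A (Y 0) * ((-1 : ℤ) ^ (i : ℕ) •
            projDer hpr (Fin.tail Y i) (wedgeOmit {i} (Fin.tail Y))) := fun i => by
      rw [projDer_ι_mul, pow_succ, mul_neg_one, neg_smul, smul_add, neg_add, mul_smul_comm,
        sub_eq_add_neg]; rfl
    have e2 : ∀ i j : Fin n, (-1 : ℤ) ^ ((i : ℕ) + 1 + ((j : ℕ) + 1)) •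
        (ι A ⁅Y i.succ, Y j.succ⁆ * (ι A (Y 0) * wedgeOmit {i, j} (Fin.tail Y)))
          = -(ι A (Y 0) * ((-1 : ℤ) ^ ((i : ℕ) + (j : ℕ)) •
          (ι A ⁅Fin.tail Y i, Fin.tail Y j⁆ * wedgeOmit {i, j} (Fin.tail Y)))) :=
      fun i j => by
        rw [← mul_assoc, ι_mul_ι, neg_mul, smul_neg, mul_assoc, mul_smul_comm,
          show (i : ℕ) + 1 + ((j : ℕ) + 1) = (i : ℕ) + (j : ℕ) + 2 by ring, pow_add]
        simp [Fin.tail]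
    have e3 : ∀ i : Fin n, (-1 : ℤ) ^ ((i : ℕ) + 1) •
        (ι A ⁅Y 0, Y i.succ⁆ * wedgeOmit {i} (Fin.tail Y)) = (-1 : ℤ) ^ (i : ℕ) •
          (ι A (pr (VL.ofL k A L (Fin.tail Y i) * VL.ofL k A L (Y 0))) * wedgeOmit {i} (Fin.tail Y))
          - (-1 : ℤ) ^ (i : ℕ) • (ι A (pr (VL.ofL k A L (Y 0) * VL.ofL k A L (Fin.tail Y i)))
            * wedgeOmit {i} (Fin.tail Y)) := fun i => by
      rw [← pr_mul_sub hpr, map_sub, sub_mul, pow_succ, mul_neg_one, neg_smul, smul_sub, neg_sub]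
      rfl
    rw [Fin.sum_univ_succ, sum_Ioi_succ]
    simp only [wedgeOmit_singleton_zero, wedgeOmit_singleton_succ, wedgeOmit_pair_zero_succ,
      wedgeOmit_pair_succ_succ, Fin.val_zero, pow_zero, one_smul, Fin.val_succ, zero_add,
      e1, e2, e3, projDer_ιMulti, Finset.sum_sub_distrib, Finset.sum_neg_distrib,
      ← Finset.mul_sum, ih']
    rw [mul_neg]
    abel

/-- By torsion freeness `∇_{Xⁱ} Yʲ = ∇_{Yʲ} Xⁱ - [Yʲ, Xⁱ]`; the overall sign comes from moving this
vector field past the remaining `Y`'s. It exchanges the roles of `X` and `Y`, so that the insertion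
terms can be compared with the rotated ones. -/
theorem sum_projDer_mul_wedgeOmit (hpr : ∀ X : L, pr (VL.ofL k A L X) = X) {p m : ℕ}
    (Y : Fin p → L) (X : Fin m → L) :
    ∑ i : Fin m, (-1 : ℤ) ^ (i : ℕ) • (projDer hpr (X i) (ιMulti A p Y) * wedgeOmit {i} X)
      = (-1 : ℤ) ^ (p + 1) • ∑ j : Fin p, (-1 : ℤ) ^ (j : ℕ) • (wedgeOmit {j} Y *
        (projDer hpr (Y j) (ιMulti A m X) - lieDer (Y j) (ιMulti A m X))) := by
  cases p with
  | zero => simp [projDer, derAlong_one]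
  | succ p =>
    have h : ∀ Z : L, projDer hpr Z (ιMulti A m X) - lieDer Z (ιMulti A m X)
        = ∑ i : Fin m, (-1 : ℤ) ^ (i : ℕ) •
          (ι A (pr (VL.ofL k A L (X i) * VL.ofL k A L Z)) * wedgeOmit {i} X) := fun Z => by
      rw [projDer_ιMulti, lieDer_ιMulti, ← Finset.sum_sub_distrib]
      refine Finset.sum_congr rfl fun i _ => ?_
      rw [← smul_sub, ← sub_mul, ← map_sub, ← pr_mul_sub hpr, sub_sub_cancel]
    simp only [h]
    simp only [projDer_ιMulti, Finset.sum_mul, Finset.mul_sum, Finset.smul_sum]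
    rw [Finset.sum_comm]
    refine Finset.sum_congr rfl fun j _ => Finset.sum_congr rfl fun i _ => ?_
    rw [mul_smul_comm, mul_ι_mul (wedgeOmit_singleton_mem Y j), smul_mul_assoc, mul_assoc,
      smul_smul, smul_smul, smul_smul, smul_smul]
    congr 1
    have : (-1 : ℤ) ^ p * (-1 : ℤ) ^ p = 1 := by rw [← mul_pow]; simp
    linear_combination (-(-1 : ℤ) ^ (i : ℕ) * (-1 : ℤ) ^ (j : ℕ)) * this

end Comparison

/-! ### The transported operators equal the classical ones. -/

section Transport

variable {k A L : Type*} [CommRing k] [CommRing A] [Algebra k A] [LieRing L] [LieAlgebra k L]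
  [Module A L] [LieRingModule L A] [LieRinehartRing A L] [LieRinehartAlgebra k A L]
variable {M : Type*} [AddCommGroup M] [Module k M] [Module A M] [IsScalarTower k A M]
  [Module (VL k A L) M] [IsScalarTower A (VL k A L) M]
variable {pr : VL k A L →ₗ[A] L}

/-- Additive properties of multivector fields of positive degree need only be checked on products
of vector fields. -/
theorem exteriorPower_succ_induction {p : ℕ} {C : ⋀[A]^(p + 1) L → Prop}
    (add : ∀ x y, C x → C y → C (x + y)) (ιMulti : ∀ X, C (exteriorPower.ιMulti A (p + 1) X))
    (y : ⋀[A]^(p + 1) L) : C y := by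
  have hy : y ∈ Submodule.span A (Set.range (exteriorPower.ιMulti A (p + 1) (M := L))) := by
    rw [exteriorPower.ιMulti_span]; trivial
  induction hy using Submodule.closure_induction with
  | zero => simpa using ιMulti 0
  | add x y _ _ hx hy => exact add x y hx hy
  | smul_mem a x hx =>
    obtain ⟨X, rfl⟩ := hx
    have := ιMulti (Function.update X 0 (a • X 0))
    rwa [AlternatingMap.map_update_smul, Function.update_eq_self] at this

/-- The part of the Lie derivative of cochains that involves the action on `w`. -/
theorem cochainLie_insert_sum (hpr : ∀ X : L, pr (VL.ofL k A L X) = X) {p m : ℕ}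
    {t : TVL k A L} (ht : t ∈ vectorTensors k A L) (ht' : wedgeProj pr t ∈ ⋀[A]^p L)
    (ω : Forms A L M) (X : Fin m → L) :
    ∑ i : Fin m, (-1 : ℤ) ^ ((p + 1) * (i : ℕ)) • (ω ∘ₗ (wedgeProj pr).toLinearMap)
        (insertAt t i fun l => VL.ofL k A L (X l))
      = ω (∑ i : Fin m, (-1 : ℤ) ^ (i : ℕ) •
          (projDer hpr (X i) (wedgeProj pr t) * wedgeOmit {i} X)) := by
  rw [map_sum]
  refine Finset.sum_congr rfl fun i _ => ?_
  have : wedgeProj pr (insertAt t i fun l => VL.ofL k A L (X l))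
      = (List.ofFn fun l => if l = i then projDer hpr (X i) (wedgeProj pr t)
          else ι A (X l)).prod := by
    rw [insertAt, MultilinearMap.compLinearMap_apply, MultilinearMap.mkPiAlgebraFin_apply,
      map_list_prod, List.map_ofFn]
    congr 2
    funext l
    dsimp only [Function.comp_apply]
    split_ifs with h
    · subst h
      change wedgeProj pr (diag (VL.ofL k A L (X l)) t) = _
      rw [diag_ofL, wedgeProj_diagDer hpr _ ht]
    · exact wedgeProj_ι hpr (X l)
  rw [LinearMap.comp_apply, AlgHom.toLinearMap_apply, this,
    prod_ofFn_replace (projDer_mem hpr _ ht'), map_zsmul, map_zsmul, smul_smul, ← pow_add,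
    show (p + 1) * (i : ℕ) + p * (i : ℕ) = (i : ℕ) + 2 * (p * (i : ℕ)) by ring, pow_add,
    pow_mul _ 2]
  simp

/-- The part of the Lie derivative of cochains that involves the action on values. -/
theorem cochainLie_rot_sum (hpr : ∀ X : L, pr (VL.ofL k A L X) = X) {p m : ℕ}
    (ω : Forms A L M) (Y : Fin p → L) (X : Fin m → L) :
    ∑ i : Fin p, (-1 : ℤ) ^ ((m + p + 1) * (i : ℕ) + (p + 1)) •
        rotTerm (ω ∘ₗ (wedgeProj pr).toLinearMap) i (fun l => VL.ofL k A L (Y l))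
          (TensorAlgebra.tprod A (VL k A L) m fun l => VL.ofL k A L (X l))
      = lieDerivative k A L M (ιMulti A p Y) ω (ιMulti A m X)
        - ω (∑ i : Fin m, (-1 : ℤ) ^ (i : ℕ) •
          (projDer hpr (X i) (ιMulti A p Y) * wedgeOmit {i} X)) := by
  have h1 : ∀ i : Fin p, (-1 : ℤ) ^ ((m + p + 1) * (i : ℕ) + (p + 1)) •
        rotTerm (ω ∘ₗ (wedgeProj pr).toLinearMap) i (fun l => VL.ofL k A L (Y l))
          (TensorAlgebra.tprod A (VL k A L) m fun l => VL.ofL k A L (X l))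
      = (-1 : ℤ) ^ (p + 1) • ((-1 : ℤ) ^ (i : ℕ) •
          (VL.ofL k A L (Y i) • ω (wedgeOmit {i} Y * ιMulti A m X))
        - ω ((-1 : ℤ) ^ (i : ℕ) • projDer hpr (Y i) (wedgeOmit {i} Y * ιMulti A m X))) := fun i => by
    have ht : prodWhere (fun l => i < l) (fun l => TensorAlgebra.ι A (VL.ofL k A L (Y l))) *
        (TensorAlgebra.tprod A (VL k A L) m (fun l => VL.ofL k A L (X l)) *
          prodWhere (fun l => l < i) fun l => TensorAlgebra.ι A (VL.ofL k A L (Y l)))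
        ∈ vectorTensors k A L :=
      mul_mem (prodWhere_mem_vectorTensors _ Y)
        (mul_mem (tprod_mem_vectorTensors X) (prodWhere_mem_vectorTensors _ Y))
    have e : (-1 : ℤ) ^ ((m + p + 1) * (i : ℕ) + (p + 1)) * (-1 : ℤ) ^ ((m + p + 1) * (i : ℕ) + i)
        = (-1 : ℤ) ^ (p + 1) * (-1 : ℤ) ^ (i : ℕ) := by
      rw [← pow_add, ← pow_add, show (m + p + 1) * (i : ℕ) + (p + 1) + ((m + p + 1) * (i : ℕ) + i)
        = p + 1 + i + 2 * ((m + p + 1) * (i : ℕ)) by ring, pow_add, pow_mul _ 2]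
      simp
    rw [rotTerm_apply, homAct_ofL, homDer_apply, LinearMap.comp_apply, LinearMap.comp_apply,
      AlgHom.toLinearMap_apply, AlgHom.toLinearMap_apply, wedgeProj_diagDer hpr _ ht,
      map_mul (wedgeProj pr), map_mul (wedgeProj pr), wedgeProj_prodWhere hpr, wedgeProj_prodWhere hpr, wedgeProj_tprod hpr,
      prodWhere_sandwich Y i (ιMulti_mem X), map_zsmul, map_zsmul, map_zsmul, map_zsmul,
      smul_comm (VL.ofL k A L (Y i)), ← smul_sub, ← smul_sub, smul_smul, smul_smul, e]
  -- After `h1`, the connection acts on `wedgeOmit {i} Y * X` as a derivation. Its action on the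
  -- `Y`-part gives the brackets `[Yⁱ, Yʲ]`, and its action on `X` combines with the insertion sum
  -- into Lie derivatives along the `Yʲ`.
  have h2 := congrArg (fun w => ω (w * ιMulti A m X)) (sum_projDer_wedgeOmit hpr Y)
  rw [Finset.sum_congr rfl fun i _ => h1 i, ← Finset.smul_sum, sum_projDer_mul_wedgeOmit hpr,
    map_zsmul, lieDerivative_ιMulti_apply, ← smul_sub]
  congr 1
  simp only [neg_mul, map_neg, Finset.sum_mul, map_sum, smul_mul_assoc, map_zsmul] at h2
  simp only [projDer_mul, map_sum, map_zsmul, map_add, smul_add, mul_sub, map_sub, smul_sub,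
    Finset.sum_sub_distrib, Finset.sum_add_distrib, h2, pow_succ, mul_neg_one, neg_smul,
    Finset.sum_neg_distrib]
  abel

theorem cochainLie_apply_tprod {p m : ℕ} (w : ⨂[A]^p (VL k A L)) (f : Cochains k A L M)
    (v : Fin m → VL k A L) :
    cochainLie w f (TensorAlgebra.tprod A (VL k A L) m v) =
      ∑ i : Fin m, (-1 : ℤ) ^ ((p + 1) * (i : ℕ)) •
        f (insertAt (TensorPower.toTensorAlgebra w) i v)
      + ∑ i : Fin p, (-1 : ℤ) ^ ((m + p + 1) * (i : ℕ) + (p + 1)) •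
        PiTensorProduct.lift (rotMultilinear f i) w (TensorAlgebra.tprod A (VL k A L) m v) := by
  rw [cochainLie, ofMultilinear_tprod, _root_.add_apply, _root_.sum_apply,
    _root_.sum_apply]
  rfl

variable [Algebra ℚ k]

/-- The insertion part sees `Alt y` only through its projection, which is `y`. The rotation part is
multilinear in the entries, so on a product of vector fields it is the antisymmetrisation of the sum
in `cochainLie_rot_sum`, which is already alternating. -/
theorem cochainLie_alt_tprod (hpr : ∀ X : L, pr (VL.ofL k A L X) = X) {p m : ℕ}
    (y : ⋀[A]^p L) (ω : Forms A L M) (X : Fin m → L) :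
    cochainLie (alt k A L p y) (ω ∘ₗ (wedgeProj pr).toLinearMap)
        (TensorAlgebra.tprod A (VL k A L) m fun l => VL.ofL k A L (X l))
      = lieDerivative k A L M (y : ExteriorAlgebra A L) ω (ιMulti A m X) := by
  have hmem : TensorPower.toTensorAlgebra (alt k A L p y) ∈ vectorTensors k A L := by
    rw [← altTotal_coe]; exact altTotal_mem_vectorTensors _
  have hproj : wedgeProj pr (TensorPower.toTensorAlgebra (alt k A L p y))
      = (y : ExteriorAlgebra A L) := by
    rw [← altTotal_coe, wedgeProj_altTotal hpr]
  rw [cochainLie_apply_tprod, cochainLie_insert_sum hpr hmem (hproj ▸ y.2), hproj]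
  -- In degree zero there are no rotation terms, and the insertion sum consists of the derivatives
  -- `Xⁱ(a)`. In positive degree, products of vector fields generate additively, which is needed
  -- because the Lie derivative is not `A`-linear in `y`.
  cases p with
  | zero =>
    obtain ⟨y, hy⟩ := y
    change _ ∈ LinearMap.range (ι A : L →ₗ[A] _) ^ 0 at hy
    rw [pow_zero] at hy
    obtain ⟨a, rfl⟩ := Submodule.mem_one.mp hy
    rw [Fin.sum_univ_zero, add_zero, lieDerivative_algebraMap_apply, contractD_ιMulti]
    simp only [projDer, derAlong_algebraMap, ← Algebra.smul_def]
  | succ p =>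
    clear hmem hproj
    rw [← eq_sub_iff_add_eq']
    induction y using exteriorPower_succ_induction with
    | add y z hy hz =>
      have h := congrArg₂ (· + ·) hy hz
      rw [← Finset.sum_add_distrib] at h
      refine Eq.trans (Finset.sum_congr rfl fun i _ => ?_) (h.trans ?_)
      · rw [map_add, map_add, LinearMap.add_apply, smul_add]
      · simp only [map_add, LinearMap.add_apply, smul_add, Finset.sum_add_distrib,
          Submodule.coe_add, add_mul]
        abel
    | ιMulti Y =>
      -- The whole rotation sum as a function of the vector fields. `hG` shows that the total is
      -- alternating, by identifying it with an expression that depends only on the wedge product.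
      let G : (Fin (p + 1) → L) → M := fun Y => ∑ i : Fin (p + 1),
        (-1 : ℤ) ^ ((m + (p + 1) + 1) * (i : ℕ) + (p + 1 + 1)) •
        rotTerm (ω ∘ₗ (wedgeProj pr).toLinearMap) i (fun l => VL.ofL k A L (Y l))
          (TensorAlgebra.tprod A (VL k A L) m fun l => VL.ofL k A L (X l))
      have hG : ∀ Y, G Y = _ := fun Y => cochainLie_rot_sum hpr ω Y X
      rw [exteriorPower.ιMulti_apply_coe, ← hG, ← antisymmetrisation_eq (k := k) (A := A) G Y
        fun σ => by
          rw [hG, hG, ιMulti_perm]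
          simp only [Units.smul_def, map_zsmul, LinearMap.smul_apply, smul_mul_assoc, smul_sub,
            map_sum, Finset.smul_sum, smul_comm _ ((Equiv.Perm.sign σ : ℤˣ) : ℤ)]]
      rw [alt_ιMulti, altMap_apply, Finset.smul_sum]
      simp only [Units.smul_def, map_smul, map_sum, map_zsmul, LinearMap.smul_apply,
        LinearMap.sum_apply, PiTensorProduct.lift.tprod, G, Finset.smul_sum]
      rw [Finset.sum_comm]
      refine Finset.sum_congr rfl fun σ _ => Finset.sum_congr rfl fun i _ => ?_
      rw [smul_comm _ (algebraMap k A _), smul_comm _ ((Equiv.Perm.sign σ : ℤˣ) : ℤ)]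
      rfl

/-- The value on each permuted tensor is an alternating function of the `X`'s, so the outer
antisymmetrisation leaves it unchanged. -/
theorem transportedLie_eq (hpr : ∀ X : L, pr (VL.ofL k A L X) = X) {p : ℕ} (y : ⋀[A]^p L)
    (ω : Forms A L M) :
    transportedLie pr y ω = lieDerivative k A L M (y : ExteriorAlgebra A L) ω :=
  form_ext fun m X => by
    rw [transportedLie, LinearMap.comp_apply, altTotal_ιMulti_eq_sum, map_smul, map_sum]
    simp only [Units.smul_def, map_zsmul, cochainLie_alt_tprod hpr]
    exact antisymmetrisation_eq (k := k)
      (fun X => lieDerivative k A L M (y : ExteriorAlgebra A L) ω (ιMulti A m X)) X fun σ => by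
        rw [ιMulti_perm, Units.smul_def, map_zsmul]; rfl

/-- `wedgeProj pr` is multiplicative and a left inverse of `altTotal`, so both factors of the
product are recovered. -/
theorem transportedContraction_eq (hpr : ∀ X : L, pr (VL.ofL k A L X) = X) {p : ℕ} (y : ⋀[A]^p L)
    (ω : Forms A L M) :
    transportedContraction pr y ω = contraction k A L M (y : ExteriorAlgebra A L) ω :=
  LinearMap.ext fun x => by
    change ω (wedgeProj pr (TensorPower.toTensorAlgebra (alt k A L p y) * altTotal k A L x)) = _
    rw [map_mul, ← altTotal_coe, wedgeProj_altTotal hpr, wedgeProj_altTotal hpr]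
    rfl

end Transport

end LieRinehart

theorem proposition7p3 (k A L M : Type*) [CommRing k] [Algebra ℚ k] [CommRing A] [Algebra k A]
    [LieRing L] [LieAlgebra k L] [Module A L] [LieRingModule L A] [LieRinehartRing A L]
    [LieRinehartAlgebra k A L] [Module.Flat A L]
    [AddCommGroup M] [Module k M] [Module A M] [IsScalarTower k A M]
    [Module (LieRinehart.VL k A L) M] [IsScalarTower A (LieRinehart.VL k A L) M] :
    (∃! d : Module.End k (LieRinehart.Forms A L M), LieRinehart.IsDeRhamDifferential d) ∧
    (∃! br : ExteriorAlgebra A L →ₗ[k] ExteriorAlgebra A L →ₗ[k] ExteriorAlgebra A L,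
      LieRinehart.IsSchoutenBracket br) ∧
    (∃! lie : ExteriorAlgebra A L →ₗ[k] Module.End k (LieRinehart.Forms A L M),
      LieRinehart.IsLieDerivative lie) ∧
    ∀ (d : Module.End k (LieRinehart.Forms A L M))
      (br : ExteriorAlgebra A L →ₗ[k] ExteriorAlgebra A L →ₗ[k] ExteriorAlgebra A L)
      (lie : ExteriorAlgebra A L →ₗ[k] Module.End k (LieRinehart.Forms A L M)),
      LieRinehart.IsDeRhamDifferential d → LieRinehart.IsSchoutenBracket br →
      LieRinehart.IsLieDerivative lie →
      LieRinehart.IsGerstenhaberAlgebra (LieRinehart.vectorDegree k A L)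
        (LieRinehart.wedge k A L) br ∧
      LieRinehart.IsNoncommutativeCalculus (LieRinehart.vectorDegree k A L)
        (LieRinehart.wedge k A L).flip (-br.flip) (LieRinehart.formDegree k A L M) d
        (LieRinehart.contraction k A L M) lie ∧
      ∀ pr : LieRinehart.VL k A L →ₗ[A] L, (∀ X : L, pr (LieRinehart.VL.ofL k A L X) = X) →
        (∀ x : ExteriorAlgebra A L,
          LieRinehart.wedgeProj pr (LieRinehart.altTotal k A L x) = x) ∧
        ∀ (p : ℕ) (y : ⋀[A]^p L) (ω : LieRinehart.Forms A L M),
          LieRinehart.transportedContraction pr y ω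
            = LieRinehart.contraction k A L M (y : ExteriorAlgebra A L) ω ∧
          LieRinehart.transportedLie pr y ω = lie (y : ExteriorAlgebra A L) ω := by
  refine ⟨⟨LieRinehart.deRham k A L M, LieRinehart.isDeRhamDifferential_deRham k A L M,
      fun d hd => hd.unique (LieRinehart.isDeRhamDifferential_deRham k A L M)⟩,
    ⟨LieRinehart.schoutenBilin k A L, LieRinehart.isSchoutenBracket_schoutenBilin k A L,
      fun br hbr => hbr.unique (LieRinehart.isSchoutenBracket_schoutenBilin k A L)⟩,
    ⟨LieRinehart.lieDerivative k A L M, LieRinehart.isLieDerivative_lieDerivative k A L M,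
      fun lie hlie => hlie.unique (LieRinehart.isLieDerivative_lieDerivative k A L M)⟩,
    fun d br lie hd hbr hlie => ?_⟩
  -- Uniqueness identifies the given operators with the constructed ones, for which the identities
  -- were proved.
  obtain rfl := hd.unique (LieRinehart.isDeRhamDifferential_deRham k A L M)
  obtain rfl := hbr.unique (LieRinehart.isSchoutenBracket_schoutenBilin k A L)
  obtain rfl := hlie.unique (LieRinehart.isLieDerivative_lieDerivative k A L M)
  exact ⟨LieRinehart.isGerstenhaberAlgebra_schoutenBilin k A L,
    LieRinehart.isNoncommutativeCalculus k A L M, fun pr hpr =>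
      ⟨LieRinehart.wedgeProj_altTotal hpr, fun p y ω =>
        ⟨LieRinehart.transportedContraction_eq hpr y ω, LieRinehart.transportedLie_eq hpr y ω⟩⟩⟩
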